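/- Let $q\in\mathbb{C}$ with $0<|q|<1$ and let $M\ge 1$ be an integer. Write $(a)_\infty=\prod_{i\ge0}(1-aq^i)$, $(a)_l=\prod_{i=0}^{l-1}(1-aq^i)$ for $l\in\mathbb{Z}_{\ge0}$, and $(a_1,\ldots,a_r)_\infty=(a_1)_\infty\cdots(a_r)_\infty$. For $x=(x_1,\ldots,x_M)$ put $\Delta(x)=\prod_{1\le i<j\le M}(x_i-x_j)$. Kajihara's $q$-hypergeometric series is $$W^{M,N}(\{x_i\}_{1\le i\le M};a;\{u_j\}_{1\le j\le M+N};\{v_k\}_{1\le k\le N};z)=\sum_{l\in\mathbb{Z}_{\ge0}^M}z^{|l|}\frac{\Delta(xq^l)}{\Delta(x)}\prod_{i=1}^M\left(\frac{1-ax_iq^{|l|+l_i}}{1-ax_i}\,\frac{(ax_i)_{|l|}\prod_{j=1}^{M+N}(x_iu_j)_{l_i}}{\prod_{j=1}^M(qx_i/x_j)_{l_i}\prod_{k=1}^N(aqx_i/v_k)_{l_i}}\right)\frac{\prod_{k=1}^N(v_k)_{|l|}}{\prod_{j=1}^{M+N}(aq/u_j)_{|l|}},$$ where $|l|=l_1+\cdots+l_M$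 and $xq^l=(x_iq^{l_i})_i$. For nonzero complex parameters $a_1,\ldots,a_{M+3},b_1,\ldots,b_{M+3}$ put $$\begin{aligned}W\!\left(\begin{array}{c}\{a_i\}\\ \{b_i\}\end{array}\right)&=\prod_{i=1}^M\frac{(qa_i/a_{M+2},\,qa_i/a_{M+3})_\infty}{(q^2a_ib_{M+3}/(a_{M+2}a_{M+3}))_\infty}\prod_{j=1}^{M+2}(q^2b_jb_{M+3}/(a_{M+2}a_{M+3}))_\infty\prod_{j=1}^{M+3}\frac{1}{(qb_j/a_{M+2},\,qb_j/a_{M+3})_\infty}\\&\quad\times\frac{(a_{M+1}/b_{M+3},\,a_{M+2}/a_{M+3},\,a_{M+3}/a_{M+2})_\infty}{a_{M+3}-a_{M+2}}\\&\quad\times W^{M,2}\!\left(\{a_i\}_{1\le i\le M};\frac{qb_{M+3}}{a_{M+2}a_{M+3}};\Big\{\frac1{b_j}\Big\}_{1\le j\le M+2};\frac{qb_{M+3}}{a_{M+2}},\frac{qb_{M+3}}{a_{M+3}};\frac{a_{M+1}}{b_{M+3}}\right).\end{aligned}$$ Let $D$ be the set of all nonzero parameters with $a_1\cdots a_{M+3}=q^2b_1\cdots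 b_{M+3}$ and $|a_{M+1}/b_{M+3}|<1$ for which none of the denominators in this formula (in the product and in the terms of the series) vanishes. Let $T_{a_k}$ and $T_{b_k}$ be the $q$-shift operators $a_k\mapsto qa_k$ and $b_k\mapsto qb_k$. Put $T=T_{a_1}T_{b_1}$, $\hat a=(a_2,\ldots,a_{M+3})$, $\hat b=(b_2,\ldots,b_{M+3})$, let $e_k$ be the elementary symmetric function of degree $k$, and put $$\begin{aligned}\hat E_M&=b_1^{M+2}T^{-1}\prod_{i=0}^M\Big(1-\frac{a_1q^i}{b_1}T\Big)\\&\quad+\sum_{k=1}^{M+1}(-1)^kb_1^{M+2-k}\big[e_k(\hat a)T^{-1}-q\,e_k(\hat b)\big]\prod_{i=0}^{M-k}\Big(1-\frac{a_1q^i}{b_1}T\Big)\prod_{i=0}^{k-2}(1-q^{-i}T)\\&\quad+(-1)^Ma_2\cdots a_{M+3}T^{-1}\prod_{i=0}^M(1-q^{-i}T).\end{aligned}$$ The system $q$-$RP^M$ for a function $y$ of $(\{a_i\},\{b_i\})$ consists of the following equations, for all $k,l\in\{2,\ldots,M+3\}$ with $k\ne l$: $$\begin{aligned}&\hat E_My=0,\\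 &[(a_1-a_kq)T_{a_k}T_{a_l}^{-1}-(a_l-a_kq)T_{a_k}T_{a_1}^{-1}+(a_l-a_1)]y=0,\\ &[(b_1-a_1)T_{a_1}T_{a_k}^{-1}-(q^{-1}a_k-a_1)T_{a_1}T_{b_1}+(q^{-1}a_k-b_1)]y=0,\\ &[(b_1-q^{-1}b_l)T_{b_k}T_{b_l}^{-1}-(b_k-q^{-1}b_l)T_{b_1}T_{b_l}^{-1}+(b_k-b_1)]y=0,\\ &[(a_1-b_1)T_{b_k}T_{b_1}^{-1}-(b_kq-b_1)(T_{a_1}T_{b_1})^{-1}+(b_kq-a_1)]y=0,\\ &[(b_1-a_k)T_{a_k}T_{b_l}-(b_l-a_k)T_{a_k}T_{b_1}+(b_l-b_1)]y=0,\\ &[(b_l-a_1)T_{a_k}^{-1}T_{b_l}^{-1}-(b_l-a_k)T_{a_1}^{-1}T_{b_l}^{-1}+(a_1-a_k)]y=0,\\ &\Big(q\prod_{k=1}^{M+3}T_{a_k}T_{b_k}-1\Big)y=0.\end{aligned}$$ Then the series in the definition of $W$ converges absolutely at every point of $D$, and the function $W$ on $D$ satisfies the system $q$-$RP^M$: each equation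 holds at every point for which all the shifted points at which the equation evaluates $W$ (for $\hat E_M$, the images of the point under $T^n$, $-1\le n\le M$) lie in $D$. -/

import Mathlib

noncomputable section

namespace QRP

/-! ### `q`-shifted factorials -/

/-- The infinite `q`-shifted factorial `(a)_∞ = ∏_{i ≥ 0} (1 - a q^i)`. -/
def pochInf (q a : ℂ) : ℂ := ∏' i : ℕ, (1 - a * q ^ i)

/-- The `q`-shifted factorial `(a)_n = (1 - a)(1 - a q) ⋯ (1 - a q^(n-1))`, `n ≥ 0`. -/
def poch (q a : ℂ) (n : ℕ) : ℂ := ∏ i ∈ Finset.range n, (1 - a * q ^ i)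

/-! ### Kajihara's very well-poised series `W^{M,N}` -/

/-- The Vandermonde product `Δ(x) = ∏_{i < j} (x_i - x_j)`. -/
def vandermonde {M : ℕ} (x : Fin M → ℂ) : ℂ :=
  ∏ i : Fin M, ∏ j ∈ Finset.Ioi i, (x i - x j)

/-- The term with multi-index `l` of `W^{M,N}({x_i}; a; {u_j}; {v_k}; z)`. -/
def kajiharaTerm (q : ℂ) {M N : ℕ} (x : Fin M → ℂ) (a : ℂ) (u : Fin (M + N) → ℂ)
    (v : Fin N → ℂ) (z : ℂ) (l : Fin M → ℕ) : ℂ :=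
  z ^ (∑ i, l i) * (vandermonde (fun i => x i * q ^ l i) / vandermonde x) *
    (∏ i, ((1 - a * x i * q ^ ((∑ j, l j) + l i)) / (1 - a * x i) *
      (poch q (a * x i) (∑ j, l j) * ∏ j, poch q (x i * u j) (l i)) /
      ((∏ j, poch q (q * x i / x j) (l i)) * ∏ k, poch q (a * q * x i / v k) (l i)))) *
    ((∏ k, poch q (v k) (∑ j, l j)) / ∏ j, poch q (a * q / u j) (∑ j, l j))

/-- Kajihara's `q`-hypergeometric series `W^{M,N}({x_i}; a; {u_j}; {v_k}; z)`. -/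
def kajiharaW (q : ℂ) {M N : ℕ} (x : Fin M → ℂ) (a : ℂ) (u : Fin (M + N) → ℂ)
    (v : Fin N → ℂ) (z : ℂ) : ℂ :=
  ∑' l : Fin M → ℕ, kajiharaTerm q x a u v z l

/-- None of the denominators in the terms of `W^{M,N}` vanishes. -/
structure KajiharaDenomNeZero (q : ℂ) {M N : ℕ} (x : Fin M → ℂ) (a : ℂ) (u : Fin (M + N) → ℂ)
    (v : Fin N → ℂ) : Prop where
  x_ne : ∀ i, x i ≠ 0
  u_ne : ∀ j, u j ≠ 0
  v_ne : ∀ k, v k ≠ 0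
  vandermonde_ne : vandermonde x ≠ 0
  one_sub_ne : ∀ i, 1 - a * x i ≠ 0
  xx_ne : ∀ i j n, poch q (q * x i / x j) n ≠ 0
  xv_ne : ∀ i k n, poch q (a * q * x i / v k) n ≠ 0
  au_ne : ∀ j n, poch q (a * q / u j) n ≠ 0

/-! ### The normalized function `W({a_i}; {b_i})` -/

/-- The parameters `({a_i}, {b_i})`, `1 ≤ i ≤ M + 3`; the entry of index `i` is stored at the
place `i - 1` of `Fin (M + 3)`. -/
abbrev Param (M : ℕ) : Type := (Fin (M + 3) → ℂ) × (Fin (M + 3) → ℂ)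

namespace Param

variable {M : ℕ}

/-- `a_i` for `1 ≤ i ≤ M`. -/
def aInit (p : Param M) (i : Fin M) : ℂ := p.1 (Fin.castAdd 3 i)

/-- `a_{M+1}`. -/
def aM1 (p : Param M) : ℂ := p.1 (Fin.natAdd M 0)

/-- `a_{M+2}`. -/
def aM2 (p : Param M) : ℂ := p.1 (Fin.natAdd M 1)

/-- `a_{M+3}`. -/
def aM3 (p : Param M) : ℂ := p.1 (Fin.natAdd M 2)

/-- `b_j` for `1 ≤ j ≤ M + 2`. -/
def bInit (p : Param M) (j : Fin (M + 2)) : ℂ := p.2 (Fin.castSucc j)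

/-- `b_{M+3}`. -/
def bM3 (p : Param M) : ℂ := p.2 (Fin.last (M + 2))

/-- The argument `a = q b_{M+3} / (a_{M+2} a_{M+3})` of the Kajihara series. -/
def kA (q : ℂ) (p : Param M) : ℂ := q * p.bM3 / (p.aM2 * p.aM3)

/-- The arguments `u_j = 1 / b_j`, `1 ≤ j ≤ M + 2`, of the Kajihara series. -/
def kU (p : Param M) (j : Fin (M + 2)) : ℂ := 1 / p.bInit j

/-- The arguments `v = (q b_{M+3} / a_{M+2}, q b_{M+3} / a_{M+3})` of the Kajihara series. -/
def kV (q : ℂ) (p : Param M) : Fin 2 → ℂ := ![q * p.bM3 / p.aM2, q * p.bM3 / p.aM3]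

/-- The argument `z = a_{M+1} / b_{M+3}` of the Kajihara series. -/
def kZ (p : Param M) : ℂ := p.aM1 / p.bM3

end Param

/-- The explicit product by which `W^{M,2}` is normalized. -/
def normFactor (q : ℂ) {M : ℕ} (p : Param M) : ℂ :=
  (∏ i : Fin M, pochInf q (q * p.aInit i / p.aM2) * pochInf q (q * p.aInit i / p.aM3) /
      pochInf q (q ^ 2 * p.aInit i * p.bM3 / (p.aM2 * p.aM3))) *
    (∏ j : Fin (M + 2), pochInf q (q ^ 2 * p.bInit j * p.bM3 / (p.aM2 * p.aM3))) *
    (∏ j : Fin (M + 3), 1 / (pochInf q (q * p.2 j / p.aM2) * pochInf q (q * p.2 j / p.aM3))) *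
    (pochInf q (p.aM1 / p.bM3) * pochInf q (p.aM2 / p.aM3) * pochInf q (p.aM3 / p.aM2)) *
    (1 / (p.aM3 - p.aM2))

/-- The normalized function `W({a_i}; {b_i})`. -/
def normW (q : ℂ) {M : ℕ} (p : Param M) : ℂ :=
  normFactor q p * kajiharaW q p.aInit (p.kA q) p.kU (p.kV q) p.kZ

/-- The domain of definition of `W({a_i}; {b_i})`: nonzero parameters subject to
`a_1 ⋯ a_{M+3} = q² b_1 ⋯ b_{M+3}` and `|a_{M+1} / b_{M+3}| < 1` for which no denominator in the
normalizing product or in the terms of the series vanishes. -/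
structure InDomain (q : ℂ) {M : ℕ} (p : Param M) : Prop where
  a_ne : ∀ i, p.1 i ≠ 0
  b_ne : ∀ i, p.2 i ≠ 0
  balance : ∏ i, p.1 i = q ^ 2 * ∏ i, p.2 i
  norm_lt : ‖p.aM1 / p.bM3‖ < 1
  aM3_sub_ne : p.aM3 - p.aM2 ≠ 0
  ab_ne : ∀ i, pochInf q (q ^ 2 * p.aInit i * p.bM3 / (p.aM2 * p.aM3)) ≠ 0
  bM2_ne : ∀ j, pochInf q (q * p.2 j / p.aM2) ≠ 0
  bM3_ne : ∀ j, pochInf q (q * p.2 j / p.aM3) ≠ 0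
  series_ne : KajiharaDenomNeZero q p.aInit (p.kA q) p.kU (p.kV q)

/-- The domain of `W({a_i}; {b_i})` as a set. -/
def domain (q : ℂ) (M : ℕ) : Set (Param M) := {p | InDomain q p}

/-! ### The `q`-difference system `q-RP^M` -/

/-- The substitution `a_k ↦ q^e a_k`. -/
def shA (q : ℂ) {M : ℕ} (k : Fin (M + 3)) (e : ℤ) (p : Param M) : Param M :=
  (Function.update p.1 k (q ^ e * p.1 k), p.2)

/-- The substitution `b_k ↦ q^e b_k`. -/
def shB (q : ℂ) {M : ℕ} (k : Fin (M + 3)) (e : ℤ) (p : Param M) : Param M :=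
  (p.1, Function.update p.2 k (q ^ e * p.2 k))

/-- The algebra of linear operators on functions of `({a_i}, {b_i})`; its product is the
composition of operators. -/
abbrev Op (M : ℕ) : Type := Module.End ℂ (Param M → ℂ)

/-- Multiplication by a function of the parameters, as an operator. -/
def mulOp {M : ℕ} (c : Param M → ℂ) : Op M := LinearMap.mulLeft ℂ c

/-- The `q`-shift operator `(T_{a_1} T_{b_1})^e`. -/
def opT (q : ℂ) (M : ℕ) (e : ℤ) : Op M :=
  LinearMap.funLeft ℂ ℂ (fun p : Param M => shA q 0 e (shB q 0 e p))

/-- `∏_{i=0}^{n-1} (1 - (a_1 q^i / b_1) T)` with `T = T_{a_1} T_{b_1}`. -/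
def prodAB (q : ℂ) (M n : ℕ) : Op M :=
  ((List.range n).map fun i =>
    1 - mulOp (fun p : Param M => p.1 0 * q ^ i / p.2 0) * opT q M 1).prod

/-- `∏_{i=0}^{n-1} (1 - q^{-i} T)` with `T = T_{a_1} T_{b_1}`. -/
def prodQ (q : ℂ) (M n : ℕ) : Op M :=
  ((List.range n).map fun i => 1 - (q ^ (-(i : ℤ))) • opT q M 1).prod

/-- The elementary symmetric function `e_k(c_2, …, c_{M+3})`. -/
def esymmTail {M : ℕ} (k : ℕ) (c : Fin (M + 3) → ℂ) : ℂ :=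
  ((Finset.univ : Finset (Fin (M + 2))).val.map fun i => c i.succ).esymm k

/-- The operator `Ê_M`. -/
def opE (q : ℂ) (M : ℕ) : Op M :=
  mulOp (fun p => p.2 0 ^ (M + 2)) * opT q M (-1) * prodAB q M (M + 1) +
    (∑ k ∈ Finset.Icc 1 (M + 1),
      mulOp (fun p => (-1) ^ k * p.2 0 ^ (M + 2 - k)) *
        (mulOp (fun p => esymmTail k p.1) * opT q M (-1) -
          mulOp (fun p => q * esymmTail k p.2)) *
        prodAB q M (M + 1 - k) * prodQ q M (k - 1)) +
    mulOp (fun p => (-1) ^ M * ∏ i : Fin (M + 2), p.1 i.succ) * opT q M (-1) * prodQ q M (M + 1)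

/-- The function `y`, defined on the set `D` of parameters, satisfies the system `q-RP^M`: each
equation holds at every point for which all points where the equation evaluates `y` lie in `D`.
The index `0 : Fin (M + 3)` is the paper's index `1`, so `k ≠ 0` means `2 ≤ k ≤ M + 3`. -/
structure SatisfiesQRP (q : ℂ) (M : ℕ) (D : Set (Param M)) (y : Param M → ℂ) : Prop where
  /-- `Ê_M y = 0`; this involves `T^n y` for `-1 ≤ n ≤ M`. -/
  eqE : ∀ p : Param M,
    (∀ n : ℤ, -1 ≤ n → n ≤ M → shA q 0 n (shB q 0 n p) ∈ D) → opE q M y p = 0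
  eqAA : ∀ k l : Fin (M + 3), k ≠ 0 → l ≠ 0 → k ≠ l → ∀ p ∈ D,
    shA q k 1 (shA q l (-1) p) ∈ D → shA q k 1 (shA q 0 (-1) p) ∈ D →
    (p.1 0 - p.1 k * q) * y (shA q k 1 (shA q l (-1) p))
      - (p.1 l - p.1 k * q) * y (shA q k 1 (shA q 0 (-1) p))
      + (p.1 l - p.1 0) * y p = 0
  eqA : ∀ k : Fin (M + 3), k ≠ 0 → ∀ p ∈ D,
    shA q 0 1 (shA q k (-1) p) ∈ D → shA q 0 1 (shB q 0 1 p) ∈ D →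
    (p.2 0 - p.1 0) * y (shA q 0 1 (shA q k (-1) p))
      - (q⁻¹ * p.1 k - p.1 0) * y (shA q 0 1 (shB q 0 1 p))
      + (q⁻¹ * p.1 k - p.2 0) * y p = 0
  eqBB : ∀ k l : Fin (M + 3), k ≠ 0 → l ≠ 0 → k ≠ l → ∀ p ∈ D,
    shB q k 1 (shB q l (-1) p) ∈ D → shB q 0 1 (shB q l (-1) p) ∈ D →
    (p.2 0 - q⁻¹ * p.2 l) * y (shB q k 1 (shB q l (-1) p))
      - (p.2 k - q⁻¹ * p.2 l) * y (shB q 0 1 (shB q l (-1) p))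
      + (p.2 k - p.2 0) * y p = 0
  eqB : ∀ k : Fin (M + 3), k ≠ 0 → ∀ p ∈ D,
    shB q k 1 (shB q 0 (-1) p) ∈ D → shA q 0 (-1) (shB q 0 (-1) p) ∈ D →
    (p.1 0 - p.2 0) * y (shB q k 1 (shB q 0 (-1) p))
      - (p.2 k * q - p.2 0) * y (shA q 0 (-1) (shB q 0 (-1) p))
      + (p.2 k * q - p.1 0) * y p = 0
  eqAB : ∀ k l : Fin (M + 3), k ≠ 0 → l ≠ 0 → k ≠ l → ∀ p ∈ D,
    shA q k 1 (shB q l 1 p) ∈ D → shA q k 1 (shB q 0 1 p) ∈ D →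
    (p.2 0 - p.1 k) * y (shA q k 1 (shB q l 1 p))
      - (p.2 l - p.1 k) * y (shA q k 1 (shB q 0 1 p))
      + (p.2 l - p.2 0) * y p = 0
  eqABinv : ∀ k l : Fin (M + 3), k ≠ 0 → l ≠ 0 → k ≠ l → ∀ p ∈ D,
    shA q k (-1) (shB q l (-1) p) ∈ D → shA q 0 (-1) (shB q l (-1) p) ∈ D →
    (p.2 l - p.1 0) * y (shA q k (-1) (shB q l (-1) p))
      - (p.2 l - p.1 k) * y (shA q 0 (-1) (shB q l (-1) p))
      + (p.1 0 - p.1 k) * y p = 0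
  /-- `(q ∏_k T_{a_k} T_{b_k} - 1) y = 0`. -/
  eqScale : ∀ p ∈ D, q • p ∈ D → q * y (q • p) - y p = 0

end QRP

end

namespace QRP

open Filter Topology

/-! ### Basic facts on `q`-shifted factorials -/

/-! The function `W` is a Jackson integral. Put E(t) = ∏ (a_i t)_∞ / ∏ (b_i t)_∞, and let S_i be the
sum of t E(t) over the lattice t ∈ q^ℤ / a_i; since (a_i t)_∞ = 0 at t = q^m / a_i for m ≤ 0, this
is really a one-sided sum. The key formula (`normW_eq_jackS`) is q (q)_∞ W = S_{M+3} - S_{M+2} on D.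

Given this, the system is elementary. A shift of one parameter multiplies E(t) by a factor linear in
t, or by its inverse, so the six three-term equations hold for the integrand at each t, hence for
each S_i (`jackS_relation`); the scaling equation is the substitution t ↦ t / q. For Ê_M, the value
of t Ê_M E(t) at t = qs is q times a difference Φ(s) - Φ(qs) up to a factor independent of s
(`opE_jackE`), because the elementary symmetric functions assemble into ∏ (1 - a_i s) and ∏ (1 - q
b_i s). Since Φ(1 / a_i) = 0 and Φ(q^n / a_i) → 1, the sum Ê_M S_i does not depend on i
(`opE_jackS`), and the difference of two of them vanishes.

The key formula is `hasExpansion`, proved by induction on the number M of pairs (x_i, b_i), after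
multiplication by products that make the integral entire in the b_j. Three facts carry it. (1)
Integral and series satisfy the same three-term relation in (b_0, b_1, b_2). For the integral it is
the identity Σ (b_1 - b_2)(1 - b_0 t) = 0, summed cyclically. For the series, partial fractions with
M + 4 nodes write the combination of summands as a discrete divergence, and Lagrange interpolation
with M + 1 nodes makes its sum telescope (`threeTerm_tsum_kTerm`). (2) If x_1 = b_1 = w, both sides
lose this pair and the same factor, so the claim for M - 1 applies; with (1) it follows for b_1 =
q^n w, n ≥ 0 (`hasExpansion_of_eq_mul_pow`). (3) Both sides extend analytically in b_1 to a disc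
around 0 along a curve that preserves the balancing condition. The points q^n w accumulate at 0, so
the identity theorem gives all b_1 (`HasExpansion.of_frequently`). The case M = 0 is the
Al-Salam–Verma integral, obtained by iterating a contiguity relation (`jFull_zero_eval`). -/

@[simp] lemma poch_zero (q a : ℂ) : poch q a 0 = 1 := by simp [poch]

lemma poch_succ (q a : ℂ) (n : ℕ) : poch q a (n + 1) = poch q a n * (1 - a * q ^ n) := by
  simp [poch, Finset.prod_range_succ]

lemma poch_succ' (q a : ℂ) (n : ℕ) : poch q a (n + 1) = (1 - a) * poch q (a * q) n := by
  simp only [poch, Finset.prod_range_succ']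
  rw [mul_comm]
  congr 1
  · simp
  · exact Finset.prod_congr rfl fun i _ => by ring

lemma poch_add (q a : ℂ) (m n : ℕ) :
    poch q a (m + n) = poch q a m * poch q (a * q ^ m) n := by
  simp only [poch, Finset.prod_range_add]
  congr 1
  exact Finset.prod_congr rfl fun i _ => by ring

lemma poch_ne_zero {q a : ℂ} {n : ℕ} (h : ∀ i < n, 1 - a * q ^ i ≠ 0) : poch q a n ≠ 0 :=
  Finset.prod_ne_zero_iff.2 fun i hi => h i (Finset.mem_range.1 hi)

lemma one_sub_ne_zero_of_poch {q a : ℂ} (h : ∀ n, poch q a n ≠ 0) (i : ℕ) : 1 - a * q ^ i ≠ 0 :=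
  Finset.prod_ne_zero_iff.1 (h (i + 1)) i (Finset.self_mem_range_succ i)

@[simp] lemma pochInf_zero (q : ℂ) : pochInf q 0 = 1 := by simp [pochInf]

variable {q : ℂ}

lemma summable_norm_mul_pow (hq : ‖q‖ < 1) (a : ℂ) : Summable fun i : ℕ => ‖-(a * q ^ i)‖ := by
  simpa using (summable_geometric_of_lt_one (norm_nonneg _) hq).mul_left ‖a‖

lemma multipliable_one_sub_mul_pow (hq : ‖q‖ < 1) (a : ℂ) :
    Multipliable fun i : ℕ => 1 - a * q ^ i := by
  simpa [sub_eq_add_neg] using multipliable_one_add_of_summable (summable_norm_mul_pow hq a)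

lemma tendsto_poch (hq : ‖q‖ < 1) (a : ℂ) :
    Tendsto (fun n => poch q a n) atTop (𝓝 (pochInf q a)) :=
  (multipliable_one_sub_mul_pow hq a).hasProd.tendsto_prod_nat

lemma pochInf_eq_poch_mul (hq : ‖q‖ < 1) (a : ℂ) (n : ℕ) :
    pochInf q a = poch q a n * pochInf q (a * q ^ n) := by
  have h1 : Tendsto (fun m => poch q a (n + m)) atTop (𝓝 (pochInf q a)) := by
    simpa only [add_comm] using (tendsto_add_atTop_iff_nat n).2 (tendsto_poch hq a)
  refine tendsto_nhds_unique h1 ?_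
  simp only [poch_add]
  exact (tendsto_poch hq _).const_mul _

lemma pochInf_eq_one_sub_mul (hq : ‖q‖ < 1) (a : ℂ) :
    pochInf q a = (1 - a) * pochInf q (q * a) := by
  simpa [poch_succ, mul_comm a q] using pochInf_eq_poch_mul hq a 1

lemma pochInf_ne_zero (hq : ‖q‖ < 1) {a : ℂ} (h : ∀ i : ℕ, 1 - a * q ^ i ≠ 0) :
    pochInf q a ≠ 0 := by
  have := tprod_one_add_ne_zero_of_summable (f := fun i : ℕ => -(a * q ^ i))
    (fun i => by simpa [sub_eq_add_neg] using h i) (summable_norm_mul_pow hq a)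
  simpa [pochInf, sub_eq_add_neg] using this

lemma one_sub_ne_zero_of_pochInf (hq : ‖q‖ < 1) {a : ℂ} (h : pochInf q a ≠ 0) (i : ℕ) :
    1 - a * q ^ i ≠ 0 := by
  intro h0
  refine h ?_
  rw [pochInf_eq_poch_mul hq a (i + 1), poch_succ, h0, mul_zero, zero_mul]

lemma pochInf_mul_pow_ne_zero (hq : ‖q‖ < 1) {a : ℂ} (h : pochInf q a ≠ 0) (n : ℕ) :
    pochInf q (a * q ^ n) ≠ 0 :=
  right_ne_zero_of_mul (pochInf_eq_poch_mul hq a n ▸ h)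

lemma poch_ne_zero_of_pochInf (hq : ‖q‖ < 1) {a : ℂ} (h : pochInf q a ≠ 0) (n : ℕ) :
    poch q a n ≠ 0 :=
  left_ne_zero_of_mul (pochInf_eq_poch_mul hq a n ▸ h)

lemma pochInf_eq_zero (hq : ‖q‖ < 1) {a : ℂ} {i : ℕ} (h : a * q ^ i = 1) : pochInf q a = 0 := by
  by_contra h0
  exact one_sub_ne_zero_of_pochInf hq h0 i (by rw [h, sub_self])

lemma pochInf_ne_zero_of_poch (hq : ‖q‖ < 1) {a : ℂ} (h : ∀ n, poch q a n ≠ 0) :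
    pochInf q a ≠ 0 :=
  pochInf_ne_zero hq (one_sub_ne_zero_of_poch h)

/-- A bound for all the products `(a)_n` and `(a)_∞`. -/
noncomputable def pochBound (q : ℂ) (r : ℝ) : ℝ := Real.exp (r * (1 - ‖q‖)⁻¹)

lemma pochBound_pos (q : ℂ) (r : ℝ) : 0 < pochBound q r := Real.exp_pos _

lemma pochBound_mono (hq : ‖q‖ < 1) {r s : ℝ} (h : r ≤ s) : pochBound q r ≤ pochBound q s :=
  Real.exp_le_exp.2 (mul_le_mul_of_nonneg_right h (inv_nonneg.2 (by linarith)))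

/-- The homogeneous product `(z - w)(z - w q) ⋯ (z - w q^(n-1))`. -/
noncomputable def hpoch (q z w : ℂ) (n : ℕ) : ℂ := ∏ i ∈ Finset.range n, (z - w * q ^ i)

lemma hpoch_mul (q z w : ℂ) (n : ℕ) : hpoch q z (z * w) n = z ^ n * poch q w n := by
  rw [hpoch, poch, ← Finset.card_range n, ← Finset.prod_const, Finset.card_range,
    ← Finset.prod_mul_distrib]
  exact Finset.prod_congr rfl fun i _ => by ring

/-- Each factor is at most ρ (1 + |w| |q|^i / ρ), and 1 + u ≤ e^u reduces the product to a geometric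
series. An upper bound ρ replaces |z| itself so that z = 0 is allowed; the factor ρ^n later gives
decay uniform near b = 0. -/
lemma norm_hpoch_le (hq : ‖q‖ < 1) {z w : ℂ} {ρ : ℝ} (hρ : 0 < ρ) (hz : ‖z‖ ≤ ρ) (n : ℕ) :
    ‖hpoch q z w n‖ ≤ ρ ^ n * pochBound q (‖w‖ / ρ) := by
  have h1 : ‖hpoch q z w n‖ ≤ ∏ i ∈ Finset.range n, (ρ * Real.exp (‖w‖ / ρ * ‖q‖ ^ i)) := by
    rw [hpoch, norm_prod]
    refine Finset.prod_le_prod (fun _ _ => norm_nonneg _) fun i _ => ?_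
    calc ‖z - w * q ^ i‖ ≤ ‖z‖ + ‖w * q ^ i‖ := norm_sub_le _ _
      _ ≤ ρ + ‖w‖ * ‖q‖ ^ i := by rw [norm_mul, norm_pow]; linarith
      _ = ρ * (‖w‖ / ρ * ‖q‖ ^ i + 1) := by field_simp; ring
      _ ≤ _ := mul_le_mul_of_nonneg_left (Real.add_one_le_exp _) hρ.le
  refine h1.trans ?_
  rw [Finset.prod_mul_distrib, Finset.prod_const, Finset.card_range, ← Real.exp_sum,
    ← Finset.mul_sum]
  refine mul_le_mul_of_nonneg_left (Real.exp_le_exp.2 ?_) (by positivity)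
  refine mul_le_mul_of_nonneg_left ?_ (by positivity)
  rw [← tsum_geometric_of_lt_one (norm_nonneg _) hq]
  exact (summable_geometric_of_lt_one (norm_nonneg _) hq).sum_le_tsum _
    (fun i _ => by positivity)

lemma norm_poch_le (hq : ‖q‖ < 1) {a : ℂ} {r : ℝ} (ha : ‖a‖ ≤ r) (n : ℕ) :
    ‖poch q a n‖ ≤ pochBound q r := by
  have := norm_hpoch_le hq (z := 1) (w := a) one_pos (by simp) n
  have h2 : hpoch q 1 a n = poch q a n := rfl
  rw [h2, one_pow, one_mul, div_one] at this
  exact this.trans (pochBound_mono hq ha)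

lemma norm_pochInf_le (hq : ‖q‖ < 1) {a : ℂ} {r : ℝ} (ha : ‖a‖ ≤ r) :
    ‖pochInf q a‖ ≤ pochBound q r :=
  le_of_tendsto (tendsto_poch hq a).norm (Eventually.of_forall fun n => norm_poch_le hq ha n)

lemma norm_mul_pow_le (hq : ‖q‖ < 1) (a : ℂ) (n : ℕ) : ‖a * q ^ n‖ ≤ ‖a‖ := by
  rw [norm_mul, norm_pow]
  exact mul_le_of_le_one_right (norm_nonneg _) (pow_le_one₀ (norm_nonneg _) hq.le)

lemma norm_pochInf_mul_pow_le (hq : ‖q‖ < 1) {a : ℂ} {r : ℝ} (ha : ‖a‖ ≤ r) (n : ℕ) :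
    ‖pochInf q (a * q ^ n)‖ ≤ pochBound q r :=
  norm_pochInf_le hq ((norm_mul_pow_le hq a n).trans ha)

/-- The reciprocal equals (a)_n / (a)_∞, so one nonvanishing condition controls all n. -/
lemma norm_inv_pochInf_mul_pow_le (hq : ‖q‖ < 1) {a : ℂ} (h : pochInf q a ≠ 0) (n : ℕ) :
    ‖(pochInf q (a * q ^ n))⁻¹‖ ≤ pochBound q ‖a‖ * ‖(pochInf q a)⁻¹‖ := by
  have h1 := poch_ne_zero_of_pochInf hq h n
  have h2 : (pochInf q (a * q ^ n))⁻¹ = poch q a n * (pochInf q a)⁻¹ := by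
    rw [pochInf_eq_poch_mul hq a n, mul_inv, mul_inv_cancel_left₀ h1]
  rw [h2, norm_mul]
  exact mul_le_mul_of_nonneg_right (norm_poch_le hq le_rfl n) (norm_nonneg _)

lemma norm_inv_poch_le (hq : ‖q‖ < 1) {a : ℂ} (h : pochInf q a ≠ 0) (n : ℕ) :
    ‖(poch q a n)⁻¹‖ ≤ pochBound q ‖a‖ * ‖(pochInf q a)⁻¹‖ := by
  have h1 := pochInf_mul_pow_ne_zero hq h n
  have h2 : (poch q a n)⁻¹ = pochInf q (a * q ^ n) * (pochInf q a)⁻¹ := by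
    rw [pochInf_eq_poch_mul hq a n, mul_inv, mul_left_comm, mul_inv_cancel₀ h1, mul_one]
  rw [h2, norm_mul]
  exact mul_le_mul_of_nonneg_right (norm_pochInf_mul_pow_le hq le_rfl n) (norm_nonneg _)

lemma differentiable_poch (q : ℂ) (n : ℕ) : Differentiable ℂ fun a => poch q a n := by
  unfold poch
  fun_prop

lemma differentiable_pochInf (hq : ‖q‖ < 1) : Differentiable ℂ (pochInf q) := by
  have key : ∀ r : ℝ, DifferentiableOn ℂ (pochInf q) (Metric.ball 0 r) := by
    intro r
    have hu : Summable fun i : ℕ => r * ‖q‖ ^ i :=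
      (summable_geometric_of_lt_one (norm_nonneg _) hq).mul_left r
    have h := hu.hasProdLocallyUniformlyOn_nat_one_add (f := fun i (a : ℂ) => -(a * q ^ i))
      (K := Metric.ball (0 : ℂ) r) Metric.isOpen_ball
      (Eventually.of_forall fun i a ha => by
        rw [norm_neg, norm_mul, norm_pow]
        exact mul_le_mul_of_nonneg_right (by simpa using (mem_ball_zero_iff.1 ha).le)
          (by positivity)) (fun i => by fun_prop)
    have h2 := TendstoLocallyUniformlyOn.differentiableOn
      (hasProdLocallyUniformlyOn_iff_tendstoLocallyUniformlyOn.1 h)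
      (.of_forall fun s => by
        simpa [Finset.prod_fn] using DifferentiableOn.finsetProd (fun _ _ => by fun_prop))
      Metric.isOpen_ball
    refine h2.congr fun a _ => ?_
    simp [pochInf, sub_eq_add_neg]
  intro a
  exact (key (‖a‖ + 1)).differentiableAt (Metric.isOpen_ball.mem_nhds (by simp))

lemma continuous_pochInf (hq : ‖q‖ < 1) : Continuous (pochInf q) :=
  (differentiable_pochInf hq).continuous

lemma continuous_poch (q : ℂ) (n : ℕ) : Continuous fun a => poch q a n :=
  (differentiable_poch q n).continuous

lemma tendsto_pochInf_mul_pow (hq : ‖q‖ < 1) (a : ℂ) :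
    Tendsto (fun n : ℕ => pochInf q (a * q ^ n)) atTop (𝓝 1) := by
  have h : Tendsto (fun n : ℕ => a * q ^ n) atTop (𝓝 0) := by
    simpa using (tendsto_pow_atTop_nhds_zero_of_norm_lt_one hq).const_mul a
  have h2 := ((continuous_pochInf hq).tendsto 0).comp h
  rw [pochInf_zero] at h2
  exact h2

end QRP

namespace QRP

open Filter Topology

/-! ### Telescoping of Kajihara's series -/

/-- The `if` form lets products over `Option` and `Sum` types be split into their parts by
simplification. -/
lemma prod_erase_eq_prod_ite {ι R : Type*} [Fintype ι] [DecidableEq ι] [CommMonoid R] (i : ι)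
    (f : ι → R) : ∏ j ∈ Finset.univ.erase i, f j = ∏ j, if j = i then 1 else f j := by
  rw [← Finset.mul_prod_erase Finset.univ (fun j => if j = i then 1 else f j) (Finset.mem_univ i),
    if_pos rfl, one_mul]
  exact Finset.prod_congr rfl fun j hj => by rw [if_neg (Finset.ne_of_mem_erase hj)]

/-- As a function of one coordinate the Vandermonde product is a constant times a product of linear
factors. The sign from the order of the indices is absorbed into the constant. -/
lemma exists_vandermonde_update {M : ℕ} (v : Fin M → ℂ) (i : Fin M) :
    ∃ R : ℂ, ∀ w, vandermonde (Function.update v i w) =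
      R * ∏ j ∈ Finset.univ.erase i, (w - v j) := by
  have h : ∀ u : Fin M → ℂ, vandermonde u = ∏ k, ∏ j, if k < j then u k - u j else 1 := by
    intro u
    refine Finset.prod_congr rfl fun k _ => ?_
    rw [← Finset.prod_filter]
    exact Finset.prod_congr (by ext; simp) fun _ _ => rfl
  refine ⟨(∏ k ∈ Finset.univ.erase i, ∏ j ∈ Finset.univ.erase i,
    if k < j then v k - v j else 1) * ∏ j ∈ Finset.univ.erase i, (if i < j then 1 else -1),
    fun w => ?_⟩
  rw [h, ← Finset.mul_prod_erase _ _ (Finset.mem_univ i)]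
  have h1 : ∀ k ∈ Finset.univ.erase i,
      (∏ j, if k < j then Function.update v i w k - Function.update v i w j else 1) =
      (if k < i then v k - w else 1) *
        ∏ j ∈ Finset.univ.erase i, if k < j then v k - v j else 1 := by
    intro k hk
    have hk := Finset.ne_of_mem_erase hk
    rw [← Finset.mul_prod_erase _ _ (Finset.mem_univ i)]
    congr 1
    · simp [Function.update_of_ne hk]
    · exact Finset.prod_congr rfl fun j hj => by
        rw [Function.update_of_ne hk, Function.update_of_ne (Finset.ne_of_mem_erase hj)]
  rw [Finset.prod_congr rfl h1, ← Finset.mul_prod_erase _ _ (Finset.mem_univ i)]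
  simp only [lt_irrefl, if_false, one_mul, Finset.prod_mul_distrib]
  have key : (∏ j ∈ Finset.univ.erase i,
      if i < j then Function.update v i w i - Function.update v i w j else 1) *
      (∏ k ∈ Finset.univ.erase i, if k < i then v k - w else 1) =
      (∏ j ∈ Finset.univ.erase i, if i < j then 1 else -1) *
        ∏ j ∈ Finset.univ.erase i, (w - v j) := by
    rw [← Finset.prod_mul_distrib, ← Finset.prod_mul_distrib]
    refine Finset.prod_congr rfl fun j hj => ?_
    have hj := Finset.ne_of_mem_erase hj
    rw [Function.update_self, Function.update_of_ne hj]
    rcases lt_or_gt_of_ne hj with h | h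
    · simp [h, h.not_gt]
    · simp [h, h.not_gt]
  linear_combination (∏ k ∈ Finset.univ.erase i, ∏ j ∈ Finset.univ.erase i,
    if k < j then v k - v j else 1) * key

lemma vandermonde_update_mul {M : ℕ} (v : Fin M → ℂ) (i : Fin M) (w : ℂ) :
    vandermonde (Function.update v i w) * ∏ j ∈ Finset.univ.erase i, (v i - v j) =
      vandermonde v * ∏ j ∈ Finset.univ.erase i, (w - v j) := by
  obtain ⟨R, hR⟩ := exists_vandermonde_update v i
  have h := hR (v i)
  rw [Function.update_eq_self] at h
  rw [hR, h]
  ring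

/-- The sum is the coefficient of top degree in the Lagrange interpolation of P, and P has smaller
degree. -/
lemma sum_eval_div_prod_eq_zero {ι : Type*} [Fintype ι] [DecidableEq ι] {v : ι → ℂ}
    (hv : Function.Injective v) (P : Polynomial ℂ) (hP : P.natDegree + 1 < Fintype.card ι) :
    ∑ i, P.eval (v i) / ∏ j ∈ Finset.univ.erase i, (v i - v j) = 0 := by
  have hdeg : P.degree < (Finset.univ : Finset ι).card := by
    refine P.degree_le_natDegree.trans_lt ?_
    rw [Finset.card_univ]
    exact_mod_cast (Nat.lt_succ_self _).trans hP
  rw [← Lagrange.coeff_eq_sum hv.injOn hdeg]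
  refine Polynomial.coeff_eq_zero_of_natDegree_lt ?_
  rw [Finset.card_univ]
  omega

/-- The factor of the summand of Kajihara's series that does not depend on the `b_j`, with the
total degree `Λ` and the multi-index `l` as independent variables. -/
noncomputable def core (q a α β z : ℂ) {M : ℕ} (x : Fin M → ℂ) (l : Fin M → ℕ) (Λ : ℕ) : ℂ :=
  z ^ Λ * (vandermonde (fun i => x i * q ^ l i) / vandermonde x) *
    (∏ i, ((1 - a * x i * q ^ (Λ + l i)) *
      (pochInf q (q * x i / α * q ^ l i) * pochInf q (q * x i / β * q ^ l i)) /
      (pochInf q (a * x i * q ^ Λ) * ∏ j, poch q (q * x i / x j) (l i)))) *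
    (poch q (a * β) Λ * poch q (a * α) Λ)

/-- The factor of the summand of Kajihara's series that belongs to one parameter `b`. -/
noncomputable def bfac (q a : ℂ) {M : ℕ} (x : Fin M → ℂ) (b : ℂ) (l : Fin M → ℕ) (Λ : ℕ) : ℂ :=
  pochInf q (a * q * b * q ^ Λ) * ∏ i, poch q (x i / b) (l i)

variable {q : ℂ}

lemma bfac_eq_one_sub_mul (hq : ‖q‖ < 1) (a : ℂ) {M : ℕ} (x : Fin M → ℂ) (b : ℂ) (l : Fin M → ℕ)
    (Λ : ℕ) : bfac q a x b l Λ = (1 - a * q * b * q ^ Λ) * bfac q a x b l (Λ + 1) := by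
  rw [bfac, pochInf_eq_one_sub_mul hq, bfac, mul_assoc]
  congr 3
  ring

lemma bfac_update (a : ℂ) {M : ℕ} (x : Fin M → ℂ) (b : ℂ) {m : Fin M → ℕ} {i : Fin M} {n : ℕ}
    (hi : m i = n + 1) (Λ : ℕ) :
    bfac q a x b m Λ = bfac q a x b (Function.update m i n) Λ * (1 - x i * q ^ n / b) := by
  simp only [bfac]
  rw [mul_assoc (pochInf q _)]
  congr 1
  rw [← Finset.mul_prod_erase Finset.univ (fun j => poch q (x j / b) (m j)) (Finset.mem_univ i),
    hi, poch_succ,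
    ← Finset.mul_prod_erase Finset.univ (fun j => poch q (x j / b) (Function.update m i n j))
      (Finset.mem_univ i), Function.update_self,
    Finset.prod_congr rfl fun j hj => by
      rw [← Function.update_of_ne (Finset.ne_of_mem_erase hj) n m]]
  ring

/-- The left product is, up to a factor -a q^Λ, the product of `q * b - node` over all nodes. This
is why shifts of b appear as residues at the extra nodes q b. -/
lemma bfac_mul_left (hq0 : q ≠ 0) (hq : ‖q‖ < 1) (a : ℂ) {M : ℕ} (x : Fin M → ℂ) {b : ℂ}
    (hb : b ≠ 0) (l : Fin M → ℕ) (Λ : ℕ) :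
    bfac q a x (q * b) l Λ * ((1 - a * q * b * q ^ Λ) * ∏ i, (q * b - x i * q ^ l i)) =
      bfac q a x b l Λ * ∏ i, (q * b - x i) := by
  have h1 : ∀ i, poch q (x i / (q * b)) (l i) * (q * b - x i * q ^ l i) =
      poch q (x i / b) (l i) * (q * b - x i) := by
    intro i
    have h2 := poch_succ q (x i / (q * b)) (l i)
    rw [poch_succ', show x i / (q * b) * q = x i / b by field_simp] at h2
    have h3 : ∀ w : ℂ, q * b - w = (q * b) * (1 - w / (q * b)) := fun w => by field_simp
    rw [h3, h3, mul_div_right_comm (x i)]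
    linear_combination -(q * b) * h2
  have h4 : pochInf q (a * q * b * q ^ Λ) =
      (1 - a * q * b * q ^ Λ) * pochInf q (a * q * (q * b) * q ^ Λ) := by
    rw [pochInf_eq_one_sub_mul hq]
    congr 2
    ring
  rw [bfac, bfac, h4]
  calc _ = (1 - a * q * b * q ^ Λ) * pochInf q (a * q * (q * b) * q ^ Λ) *
        ∏ i, (poch q (x i / (q * b)) (l i) * (q * b - x i * q ^ l i)) := by
        rw [Finset.prod_mul_distrib]; ring
    _ = _ := by rw [Finset.prod_congr rfl fun i _ => h1 i, Finset.prod_mul_distrib]; ring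

/-- Here Λ moves and l is fixed; in `core_update` l_i moves and Λ is fixed. The telescoping sum is
taken at Λ = |l| + 1, off the diagonal Λ = |l|, so the two moves must be separated. -/
lemma core_succ (hq : ‖q‖ < 1) {a : ℂ} (α β z : ℂ) {M : ℕ} {x : Fin M → ℂ}
    (hax : ∀ i, pochInf q (a * x i) ≠ 0) (l : Fin M → ℕ) (Λ : ℕ) :
    core q a α β z x l (Λ + 1) * ∏ i, (1 - a * x i * q ^ (Λ + l i)) =
      core q a α β z x l Λ * (z * (∏ i, (1 - a * x i * q ^ (Λ + 1 + l i))) *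
        (∏ i, (1 - a * x i * q ^ Λ)) * ((1 - a * β * q ^ Λ) * (1 - a * α * q ^ Λ))) := by
  have h1 : ∀ i, pochInf q (a * x i * q ^ Λ) =
      (1 - a * x i * q ^ Λ) * pochInf q (a * x i * q ^ (Λ + 1)) := by
    intro i
    rw [pochInf_eq_one_sub_mul hq]
    congr 2
    ring
  have h2 : ∀ i, (1 - a * x i * q ^ Λ) ≠ 0 := fun i => one_sub_ne_zero_of_pochInf hq (hax i) Λ
  have h3 := Finset.prod_ne_zero_iff.2 fun i (_ : i ∈ Finset.univ) => h2 i
  simp only [core, poch_succ, h1, Finset.prod_div_distrib, Finset.prod_mul_distrib]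
  rw [pow_succ]
  set W := ∏ i, pochInf q (a * x i * q ^ (Λ + 1))
  set Y := ∏ i, ∏ j, poch q (q * x i / x j) (l i)
  have h4 : ∀ A B : ℂ, A / (W * Y) = (∏ i, (1 - a * x i * q ^ Λ)) * (A /
      ((∏ i, (1 - a * x i * q ^ Λ)) * W * Y)) := by
    intro A B
    rw [mul_div_assoc', mul_assoc (∏ i, (1 - a * x i * q ^ Λ)), mul_div_mul_left _ _ h3]
  rw [h4 _ 0]
  ring

lemma core_update (hq : ‖q‖ < 1) {a : ℂ} (α β z : ℂ) {M : ℕ} {x : Fin M → ℂ}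
    (hx : ∀ i j (n : ℕ), q * x i / x j * q ^ n ≠ 1)
    {m : Fin M → ℕ} {i : Fin M} {n : ℕ} (hi : m i = n + 1) (Λ : ℕ) :
    core q a α β z x m Λ * ((∏ j ∈ Finset.univ.erase i, (x i * q ^ n - x j * q ^ m j)) *
      (1 - a * (x i * q ^ n) * q ^ Λ) * ((1 - x i * q ^ m i / α) * (1 - x i * q ^ m i / β)) *
      ∏ j, (1 - x i * q ^ m i / x j)) =
    core q a α β z x (Function.update m i n) Λ *
      ((∏ j ∈ Finset.univ.erase i, (x i * q ^ m i - x j * q ^ m j)) *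
        (1 - a * (x i * q ^ m i) * q ^ Λ)) := by
  have hV := vandermonde_update_mul (fun j => x j * q ^ m j) i (x i * q ^ n)
  have hupd : Function.update (fun j => x j * q ^ m j) i (x i * q ^ n) =
      fun j => x j * q ^ (Function.update m i n j) := by
    ext j
    by_cases h : j = i
    · subst h; simp
    · simp [Function.update_of_ne h]
  rw [hupd] at hV
  set F : (Fin M → ℕ) → Fin M → ℂ := fun l i => ((1 - a * x i * q ^ (Λ + l i)) *
      (pochInf q (q * x i / α * q ^ l i) * pochInf q (q * x i / β * q ^ l i)) /
      (pochInf q (a * x i * q ^ Λ) * ∏ j, poch q (q * x i / x j) (l i))) with hF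
  have hFi : F m i * ((1 - a * (x i * q ^ n) * q ^ Λ) * ((1 - x i * q ^ m i / α) *
      (1 - x i * q ^ m i / β)) * ∏ j, (1 - x i * q ^ m i / x j)) =
      F (Function.update m i n) i * (1 - a * (x i * q ^ m i) * q ^ Λ) := by
    have hne : ∏ j, (1 - q * x i / x j * q ^ n) ≠ 0 :=
      Finset.prod_ne_zero_iff.2 fun j _ => sub_ne_zero.2 (hx i j n).symm
    have e1 : ∀ w, pochInf q (q * x i / w * q ^ n) =
        (1 - x i * q ^ m i / w) * pochInf q (q * x i / w * q ^ m i) := by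
      intro w
      rw [pochInf_eq_one_sub_mul hq, hi]
      congr 2 <;> ring
    simp only [hF, Function.update_self]
    have e2 : ∀ j, (1 - x i * q ^ m i / x j) = (1 - q * x i / x j * q ^ n) := by
      intro j; rw [hi]; ring
    rw [e1 α, e1 β, Finset.prod_congr rfl fun j _ => e2 j]
    rw [show (∏ j, poch q (q * x i / x j) (m i)) =
      (∏ j, poch q (q * x i / x j) n) * ∏ j, (1 - q * x i / x j * q ^ n) by
      rw [hi, ← Finset.prod_mul_distrib]
      exact Finset.prod_congr rfl fun j _ => poch_succ _ _ _]
    set Q := ∏ j, (1 - q * x i / x j * q ^ n)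
    set W := pochInf q (a * x i * q ^ Λ)
    set Y := ∏ j, poch q (q * x i / x j) n
    have h4 : ∀ A : ℂ, A / (W * Y) = Q * (A / (W * (Y * Q))) := by
      intro A
      rw [← mul_assoc, mul_comm _ Q, mul_div_assoc', mul_div_mul_left _ _ hne]
    rw [h4]
    ring
  have hFj : ∏ j ∈ Finset.univ.erase i, F m j =
      ∏ j ∈ Finset.univ.erase i, F (Function.update m i n) j :=
    Finset.prod_congr rfl fun j hj => by
      simp only [hF, Function.update_of_ne (Finset.ne_of_mem_erase hj)]
  have hc : ∀ l, core q a α β z x l Λ = z ^ Λ *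
      (vandermonde (fun i => x i * q ^ l i) / vandermonde x) *
      (F l i * ∏ j ∈ Finset.univ.erase i, F l j) * (poch q (a * β) Λ * poch q (a * α) Λ) := by
    intro l
    rw [Finset.mul_prod_erase _ _ (Finset.mem_univ i)]
    rfl
  rw [hc, hc, hFj]
  linear_combination (z ^ Λ * (poch q (a * β) Λ * poch q (a * α) Λ) / vandermonde x *
    ∏ j ∈ Finset.univ.erase i, F (Function.update m i n) j) *
    (vandermonde (fun i => x i * q ^ m i) *
      (∏ j ∈ Finset.univ.erase i, (x i * q ^ n - x j * q ^ m j)) * hFi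
    - F (Function.update m i n) i * (1 - a * (x i * q ^ m i) * q ^ Λ) * hV)

end QRP

/-! ### Partial fractions for the three-term combination of summands. -/

namespace QRP

open Filter Topology

/-- The interpolation identity for M + 4 nodes, namely the M + 1 values of s and the three points r.
The bound M + 2 is the largest degree for which it holds, and it is the one needed for `numP`. -/
lemma sum_option_erase_eq_zero {M : ℕ} {s : Option (Fin M) → ℂ} (hs : Function.Injective s)
    {r₀ r₁ r₂ : ℂ} (h01 : r₀ ≠ r₁) (h02 : r₀ ≠ r₂) (h12 : r₁ ≠ r₂) (h0 : ∀ o, r₀ ≠ s o)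
    (h1 : ∀ o, r₁ ≠ s o) (h2 : ∀ o, r₂ ≠ s o) (P : Polynomial ℂ) (hP : P.natDegree ≤ M + 2) :
    (∑ o, P.eval (s o) / ((s o - r₀) * (s o - r₁) * (s o - r₂) *
      ∏ o' ∈ Finset.univ.erase o, (s o - s o'))) +
      P.eval r₀ / ((r₀ - r₁) * (r₀ - r₂) * ∏ o, (r₀ - s o)) +
      P.eval r₁ / ((r₁ - r₀) * (r₁ - r₂) * ∏ o, (r₁ - s o)) +
      P.eval r₂ / ((r₂ - r₀) * (r₂ - r₁) * ∏ o, (r₂ - s o)) = 0 := by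
  have hv : Function.Injective (Sum.elim s ![r₀, r₁, r₂]) := by
    refine hs.sumElim ?_ ?_
    · intro i j
      fin_cases i <;> fin_cases j <;> simp [h01, h02, h12, h01.symm, h02.symm, h12.symm]
    · intro o u
      fin_cases u <;> simp [(h0 o).symm, (h1 o).symm, (h2 o).symm]
  have h := sum_eval_div_prod_eq_zero hv P (by simp; omega)
  simp only [prod_erase_eq_prod_ite, Fintype.sum_sum_type, Fintype.prod_sum_type, Sum.elim_inl,
    Sum.elim_inr, Sum.inl.injEq, Sum.inr.injEq, reduceCtorEq, if_false, Fin.sum_univ_three,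
    Fin.prod_univ_three, Matrix.cons_val_zero, Matrix.cons_val_one, Matrix.cons_val] at h ⊢
  simp only [show (0 : Fin 3) ≠ 1 by decide, show (0 : Fin 3) ≠ 2 by decide,
    show (1 : Fin 3) ≠ 2 by decide, show (1 : Fin 3) ≠ 0 by decide,
    show (2 : Fin 3) ≠ 0 by decide, show (2 : Fin 3) ≠ 1 by decide, if_true, if_false, one_mul,
    mul_one] at h
  rw [← h]
  simp only [add_assoc]
  congr 1
  · exact Finset.sum_congr rfl fun o _ => by congr 1; ring
  · congr 1
    · congr 1; ring
    · congr 1 <;> (congr 1; ring)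

/-- The points `1 / (a q^Λ)`, `x_i q^(l_i)`. -/
noncomputable def node (q a : ℂ) {M : ℕ} (x : Fin M → ℂ) (l : Fin M → ℕ) (Λ : ℕ) :
    Option (Fin M) → ℂ
  | none => (a * q ^ Λ)⁻¹
  | some i => x i * q ^ l i

/-- The summands of the telescoping sum. -/
noncomputable def tele (q a α β z : ℂ) {N : ℕ} (x : Fin (N + 1) → ℂ) (c : Fin N → ℂ)
    (b₀ b₁ b₂ : ℂ) (l : Fin (N + 1) → ℕ) (o : Option (Fin (N + 1))) : ℂ :=
  (q ^ (∑ i, l i + 1))⁻¹ * core q a α β z x l (∑ i, l i + 1) *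
    (∏ j, bfac q a x (c j) l (∑ i, l i + 1)) *
    (bfac q a x b₀ l (∑ i, l i + 1) * bfac q a x b₁ l (∑ i, l i + 1) *
      bfac q a x b₂ l (∑ i, l i + 1)) *
    ((∏ j, (c j - node q a x l (∑ i, l i + 1) o)) /
      ∏ o' ∈ Finset.univ.erase o,
        (node q a x l (∑ i, l i + 1) o - node q a x l (∑ i, l i + 1) o'))

/-- The summand of the normalized series as a function of the parameters. -/
noncomputable def serTerm (q a α β z : ℂ) {N : ℕ} (x : Fin (N + 1) → ℂ) (c : Fin N → ℂ)
    (b₀ b₁ b₂ : ℂ) (l : Fin (N + 1) → ℕ) : ℂ :=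
  core q a α β z x l (∑ i, l i) * (∏ j, bfac q a x (c j) l (∑ i, l i)) *
    (bfac q a x b₀ l (∑ i, l i) * bfac q a x b₁ l (∑ i, l i) * bfac q a x b₂ l (∑ i, l i))

/-- The three-term combination of a function of `(b₀, b₁, b₂)`. -/
noncomputable def threeTerm (q α β : ℂ) (V : ℂ → ℂ → ℂ → ℂ) (b₀ b₁ b₂ : ℂ) : ℂ :=
  (b₁ - b₂) * ((1 - q * b₀ / α) * (1 - q * b₀ / β)) * V (q * b₀) b₁ b₂ +
  (b₂ - b₀) * ((1 - q * b₁ / α) * (1 - q * b₁ / β)) * V b₀ (q * b₁) b₂ +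
  (b₀ - b₁) * ((1 - q * b₂ / α) * (1 - q * b₂ / β)) * V b₀ b₁ (q * b₂)

/-- The parameters `x_i`, `a` are in general position. -/
structure Generic (q a : ℂ) {M : ℕ} (x : Fin M → ℂ) : Prop where
  a_ne : a ≠ 0
  x_ne : ∀ i, x i ≠ 0
  ax_ne : ∀ i, pochInf q (a * x i) ≠ 0
  ratio_ne : ∀ i j (n : ℕ), q * x i / x j * q ^ n ≠ 1
  inj : ∀ i j, i ≠ j → x i ≠ x j

variable {q a : ℂ}

lemma Generic.mul_pow_ne (hq0 : q ≠ 0) {M : ℕ} {x : Fin M → ℂ} (h : Generic q a x)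
    {i j : Fin M} (hij : i ≠ j) (k n : ℕ) : x i * q ^ k ≠ x j * q ^ n := by
  wlog hkn : n ≤ k generalizing i j k n
  · exact (this hij.symm n k (by omega)).symm
  obtain ⟨e, rfl⟩ := Nat.exists_eq_add_of_le hkn
  intro h1
  have h2 : x i * q ^ e = x j := by
    have := pow_ne_zero n hq0
    apply mul_right_cancel₀ this
    rw [← h1]; ring
  rcases e with _ | e
  · exact h.inj i j hij (by simpa using h2)
  · refine h.ratio_ne i j e ?_
    have := h.x_ne j
    rw [← h2] at this ⊢
    have := h.x_ne i
    field_simp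
    ring

lemma Generic.one_sub_ne (hq : ‖q‖ < 1) {M : ℕ} {x : Fin M → ℂ} (h : Generic q a x)
    (i : Fin M) (n : ℕ) : 1 - a * x i * q ^ n ≠ 0 := one_sub_ne_zero_of_pochInf hq (h.ax_ne i) n

lemma Generic.node_injective (hq0 : q ≠ 0) (hq : ‖q‖ < 1) {M : ℕ} {x : Fin M → ℂ}
    (h : Generic q a x) (l : Fin M → ℕ) (Λ : ℕ) : Function.Injective (node q a x l Λ) := by
  have h0 : ∀ i, node q a x l Λ none ≠ node q a x l Λ (some i) := by
    intro i hi
    have h1 := h.a_ne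
    have h2 := pow_ne_zero Λ hq0
    refine h.one_sub_ne hq i (Λ + l i) ?_
    simp only [node] at hi
    have h3 : a * q ^ Λ * (x i * q ^ l i) = 1 := by
      rw [← hi]; field_simp
    rw [pow_add]
    linear_combination -h3
  rintro (_ | i) (_ | j) hij
  · rfl
  · exact absurd hij (h0 j)
  · exact absurd hij.symm (h0 i)
  · by_contra hne
    exact h.mul_pow_ne hq0 (fun e => hne (by rw [e])) _ _ hij

/-- The polynomial ∏ (c_j - s) has degree at most N, and there are N + 2 nodes. This makes `tele` a
discrete flux of zero divergence. -/
lemma sum_tele_eq_zero (hq0 : q ≠ 0) (hq : ‖q‖ < 1) (α β z : ℂ) {N : ℕ} {x : Fin (N + 1) → ℂ}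
    (h : Generic q a x) (c : Fin N → ℂ) (b₀ b₁ b₂ : ℂ) (l : Fin (N + 1) → ℕ) :
    ∑ o, tele q a α β z x c b₀ b₁ b₂ l o = 0 := by
  simp only [tele]
  rw [← Finset.mul_sum]
  have hs := h.node_injective hq0 hq l (∑ i, l i + 1)
  have := sum_eval_div_prod_eq_zero hs (∏ j, (Polynomial.C (c j) - Polynomial.X)) (by
    refine (Nat.succ_le_succ (Polynomial.natDegree_prod_le _ _)).trans_lt ?_
    have : ∀ j ∈ Finset.univ, (Polynomial.C (c j) - Polynomial.X).natDegree ≤ 1 :=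
      fun j _ => (Polynomial.natDegree_sub_le _ _).trans (by simp)
    have := Finset.sum_le_sum this
    simp at this
    simp
    omega)
  simp only [Polynomial.eval_prod, Polynomial.eval_sub, Polynomial.eval_C, Polynomial.eval_X]
    at this
  rw [this, mul_zero]

/-- The numerator polynomial of the first partial fraction identity. -/
noncomputable def numP (α β : ℂ) {M : ℕ} (x : Fin M → ℂ) (s : ℂ) : ℂ :=
  (1 - s / α) * (1 - s / β) * ∏ i, (s - x i)

lemma exists_eval_eq_numP (α β : ℂ) {M : ℕ} (x : Fin M → ℂ) :
    ∃ P : Polynomial ℂ, P.natDegree ≤ M + 2 ∧ ∀ s, P.eval s = numP α β x s := by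
  refine ⟨(1 - Polynomial.C α⁻¹ * Polynomial.X) * (1 - Polynomial.C β⁻¹ * Polynomial.X) *
    ∏ i, (Polynomial.X - Polynomial.C (x i)), ?_, fun s => ?_⟩
  · have h1 : ∀ w : ℂ, (1 - Polynomial.C w * Polynomial.X).natDegree ≤ 1 := fun w =>
      (Polynomial.natDegree_sub_le _ _).trans (by
        have := Polynomial.natDegree_C_mul_le w (Polynomial.X : Polynomial ℂ)
        simpa using this)
    have h2 : (∏ i, (Polynomial.X - Polynomial.C (x i))).natDegree = M := by
      simp [Polynomial.natDegree_prod_of_monic _ _ fun i _ => Polynomial.monic_X_sub_C (x i)]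
    refine Polynomial.natDegree_mul_le.trans ?_
    have := Polynomial.natDegree_mul_le (p := 1 - Polynomial.C α⁻¹ * Polynomial.X)
      (q := 1 - Polynomial.C β⁻¹ * Polynomial.X)
    have := h1 α⁻¹
    have := h1 β⁻¹
    omega
  · simp only [numP, Polynomial.eval_mul, Polynomial.eval_prod, Polynomial.eval_sub,
      Polynomial.eval_C, Polynomial.eval_X, Polynomial.eval_one]
    ring

lemma prod_sub_eq_pow_mul {ι : Type*} [Fintype ι] {t : ℂ} (ht : t ≠ 0) (f : ι → ℂ) :
    ∏ i, (t - f i) = t ^ Fintype.card ι * ∏ i, (1 - t⁻¹ * f i) := by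
  rw [← Finset.card_univ, ← Finset.prod_const, ← Finset.prod_mul_distrib]
  exact Finset.prod_congr rfl fun i _ => by field_simp

/-- The common factor of the terms of the first partial fraction identity. -/
noncomputable def pfTerm (q a α β : ℂ) {M : ℕ} (x : Fin M → ℂ) (b₀ b₁ b₂ : ℂ) (m : Fin M → ℕ)
    (L : ℕ) (o : Option (Fin M)) : ℂ :=
  numP α β x (node q a x m L o) / ((node q a x m L o - q * b₀) * (node q a x m L o - q * b₁) *
    (node q a x m L o - q * b₂) *
    ∏ o' ∈ Finset.univ.erase o, (node q a x m L o - node q a x m L o'))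

/-- The step from Λ = |m| + 1 down to |m| is `core_succ` for the core and one linear factor for each
b. These factors are exactly those of the partial fraction term at the node 1 / (a q^|m|). -/
lemma tele_none (hq0 : q ≠ 0) (hq : ‖q‖ < 1) {α β : ℂ} (hα : α ≠ 0) (hβ : β ≠ 0) (z : ℂ) {N : ℕ}
    {x : Fin (N + 1) → ℂ} (h : Generic q a x) (c : Fin N → ℂ) {b₀ b₁ b₂ : ℂ}
    (m : Fin (N + 1) → ℕ)
    (h0 : q * b₀ ≠ node q a x m (∑ i, m i) none) (h1 : q * b₁ ≠ node q a x m (∑ i, m i) none)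
    (h2 : q * b₂ ≠ node q a x m (∑ i, m i) none) :
    tele q a α β z x c b₀ b₁ b₂ m none =
      (-1) ^ N * (q ^ (∑ i, m i))⁻¹ * (z * α * β) * serTerm q a α β z x c b₀ b₁ b₂ m *
        pfTerm q a α β x b₀ b₁ b₂ m (∑ i, m i) none := by
  have ha := h.a_ne
  simp only [tele, serTerm, pfTerm, numP]
  set L := ∑ i, m i with hL
  have hQ : q ^ L ≠ 0 := pow_ne_zero _ hq0
  have hcore := core_succ hq α β z h.ax_ne m L
  have hW0 : ∏ i, (1 - a * x i * q ^ (L + m i)) ≠ 0 :=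
    Finset.prod_ne_zero_iff.2 fun i _ => h.one_sub_ne hq i _
  have hW1 : ∏ i, (1 - a * x i * q ^ (L + 1 + m i)) ≠ 0 :=
    Finset.prod_ne_zero_iff.2 fun i _ => h.one_sub_ne hq i _
  have ht : (a * q ^ (L + 1))⁻¹ ≠ 0 := by
    have := pow_ne_zero (L + 1) hq0
    positivity
  have hs : (a * q ^ L)⁻¹ ≠ 0 := by positivity
  have e1 : ∀ Λ, ∏ o' ∈ Finset.univ.erase none, (node q a x m Λ none - node q a x m Λ o') =
      ∏ i, ((a * q ^ Λ)⁻¹ - x i * q ^ m i) := by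
    intro Λ
    rw [prod_erase_eq_prod_ite, Fintype.prod_option]
    simp [node]
  have e2 : ∏ i, ((a * q ^ (L + 1))⁻¹ - x i * q ^ m i) =
      (a * q ^ (L + 1))⁻¹ ^ (N + 1) * ∏ i, (1 - a * x i * q ^ (L + 1 + m i)) := by
    rw [prod_sub_eq_pow_mul ht, Fintype.card_fin]
    congr 1
    exact Finset.prod_congr rfl fun i _ => by rw [inv_inv, pow_add _ _ (m i)]; ring
  have e3 : ∏ i, ((a * q ^ L)⁻¹ - x i * q ^ m i) =
      (a * q ^ L)⁻¹ ^ (N + 1) * ∏ i, (1 - a * x i * q ^ (L + m i)) := by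
    rw [prod_sub_eq_pow_mul hs, Fintype.card_fin]
    congr 1
    exact Finset.prod_congr rfl fun i _ => by rw [inv_inv, pow_add]; ring
  have e4 : ∏ i, ((a * q ^ L)⁻¹ - x i) =
      (a * q ^ L)⁻¹ ^ (N + 1) * ∏ i, (1 - a * x i * q ^ L) := by
    rw [prod_sub_eq_pow_mul hs, Fintype.card_fin]
    congr 1
    exact Finset.prod_congr rfl fun i _ => by rw [inv_inv]; ring
  have e5 : ∏ j, (c j - (a * q ^ (L + 1))⁻¹) =
      (-1) ^ N * (a * q ^ (L + 1))⁻¹ ^ N * ∏ j, (1 - a * q * c j * q ^ L) := by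
    have : ∀ j, c j - (a * q ^ (L + 1))⁻¹ = (-1) * ((a * q ^ (L + 1))⁻¹ - c j) := fun j => by ring
    rw [Finset.prod_congr rfl fun j _ => this j, Finset.prod_mul_distrib,
      prod_sub_eq_pow_mul ht, Fintype.card_fin, Finset.prod_const, Finset.card_univ,
      Fintype.card_fin, mul_assoc]
    congr 2
    exact Finset.prod_congr rfl fun i _ => by rw [inv_inv]; ring
  have e6 : ∏ j, bfac q a x (c j) m L =
      (∏ j, (1 - a * q * c j * q ^ L)) * ∏ j, bfac q a x (c j) m (L + 1) := by
    rw [← Finset.prod_mul_distrib]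
    exact Finset.prod_congr rfl fun j _ => bfac_eq_one_sub_mul hq _ _ _ _ _
  have e7 : ∀ b, node q a x m L none - q * b = (a * q ^ L)⁻¹ * (1 - a * q * b * q ^ L) := by
    intro b
    simp only [node]
    field_simp
  have e8 : ∀ b, q * b ≠ node q a x m L none → 1 - a * q * b * q ^ L ≠ 0 := by
    intro b hb h0
    have := e7 b
    rw [h0, mul_zero] at this
    exact hb (sub_eq_zero.1 this).symm
  have h0 := e8 _ h0
  have h1 := e8 _ h1
  have h2 := e8 _ h2
  rw [e1, e1, e7, e7, e7, bfac_eq_one_sub_mul hq a x b₀ m L, bfac_eq_one_sub_mul hq a x b₁ m L,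
    bfac_eq_one_sub_mul hq a x b₂ m L, e6]
  simp only [node]
  rw [e2, e3, e4, e5]
  set W0 := ∏ i, (1 - a * x i * q ^ (L + m i))
  set W1 := ∏ i, (1 - a * x i * q ^ (L + 1 + m i))
  set W2 := ∏ i, (1 - a * x i * q ^ L)
  have hc1 := eq_div_of_mul_eq hW0 hcore
  rw [hc1]
  set w0 := 1 - a * q * b₀ * q ^ L
  set w1 := 1 - a * q * b₁ * q ^ L
  set w2 := 1 - a * q * b₂ * q ^ L
  set S := (a * q ^ L)⁻¹ with hS
  set T := (a * q ^ (L + 1))⁻¹ with hT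
  have hS' : a * q ^ L = S⁻¹ := by rw [hS, inv_inv]
  have hT' : T = S * q⁻¹ := by rw [hT, hS, pow_succ]; field_simp
  have hQ1 : (q ^ (L + 1))⁻¹ = (q ^ L)⁻¹ * q⁻¹ := by rw [pow_succ]; field_simp
  rw [show a * β * q ^ L = β * S⁻¹ by rw [← hS']; ring,
    show a * α * q ^ L = α * S⁻¹ by rw [← hS']; ring, hQ1, pow_succ T N, hT', pow_succ S N]
  clear_value W0 W1 W2 w0 w1 w2 S
  generalize core q a α β z x m L = K
  generalize ∏ j, bfac q a x (c j) m (L + 1) = B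
  generalize bfac q a x b₀ m (L + 1) = B0
  generalize bfac q a x b₁ m (L + 1) = B1
  generalize bfac q a x b₂ m (L + 1) = B2
  generalize ∏ j, (1 - a * q * c j * q ^ L) = C
  generalize q ^ L = Q at *
  field_simp
  ring

/-- The field identity behind `tele_some`, with ε = (-1)^N and all products as atoms. No condition
on S and wm is needed since both sides contain only (S wm)⁻¹. -/
lemma tele_some_aux {a b₀ b₁ b₂ Q Y S wn wm w0 w1 w2 X ε : ℂ} (A B K PB PC PX B0 B1 B2 C : ℂ)
    (hq0 : q ≠ 0) (ha : a ≠ 0) (hb0 : b₀ ≠ 0) (hb1 : b₁ ≠ 0) (hb2 : b₂ ≠ 0) (hQ : Q ≠ 0)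
    (hY : Y ≠ 0) (hyn : wn ≠ 0) (h0 : w0 ≠ 0)
    (h1 : w1 ≠ 0) (h2 : w2 ≠ 0) (hX : X ≠ 0) (hsg : ε * ε = 1) :
    Q⁻¹ * (K * (Y * wn * (A * B) * PX) / (S * wm)) * PB * (B0 * B1 * B2) *
      (C * PC / (-wn * (a * Q)⁻¹ * Y)) =
    ε * Q⁻¹ * (C / X * (q ^ 3 * b₀ * b₁ * b₂)) * (K * (PB * PC) *
      (B0 * w0 * (B1 * w1) * (B2 * w2))) *
      (A * B * (ε * -1 * X * PX) / (-(q * b₀) * w0 * (-(q * b₁) * w1) * (-(q * b₂) * w2) *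
        (-wm * (a * Q)⁻¹ * S))) := by
  have e1 : Q⁻¹ * (Y * wn / (S * wm)) * (1 / (-wn * (a * Q)⁻¹ * Y)) = -a * (S * wm)⁻¹ := by
    field_simp
  have e2 : Q⁻¹ * (1 / X) * (q ^ 3 * b₀ * b₁ * b₂) * (w0 * w1 * w2) * X *
      (1 / (-(q * b₀) * w0 * (-(q * b₁) * w1) * (-(q * b₂) * w2))) = -Q⁻¹ := by
    rw [show -(q * b₀) * w0 * (-(q * b₁) * w1) * (-(q * b₂) * w2) =
      -(q ^ 3 * b₀ * b₁ * b₂ * (w0 * w1 * w2)) by ring]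
    field_simp
  have e3 : Q⁻¹ * (1 / (-wm * (a * Q)⁻¹ * S)) = -a * (S * wm)⁻¹ := by
    have : (-wm * (a * Q)⁻¹ * S) = -((a * Q)⁻¹ * (S * wm)) := by ring
    rw [this]
    generalize S * wm = T
    by_cases hT : T = 0
    · simp [hT]
    · field_simp
  calc _ = K * A * B * PX * PB * B0 * B1 * B2 * C * PC *
        (Q⁻¹ * (Y * wn / (S * wm)) * (1 / (-wn * (a * Q)⁻¹ * Y))) := by ring
    _ = K * A * B * PX * PB * B0 * B1 * B2 * C * PC * (ε * ε) * -(-Q⁻¹) *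
        (1 / (-wm * (a * Q)⁻¹ * S)) := by rw [e1, hsg, ← e3]; ring
    _ = _ := by rw [← e2]; ring

/-- The multi-index m - e_i has total degree |m| - 1, so Λ = |m| on both sides and only l_i moves.
The constant differs from that of `tele_none` only in place of z α β; the balancing condition
equates the two. -/
lemma tele_some (hq0 : q ≠ 0) (hq : ‖q‖ < 1) {α β : ℂ} (z : ℂ) {N : ℕ}
    {x : Fin (N + 1) → ℂ} (h : Generic q a x) {c : Fin N → ℂ} (hc : ∀ j, c j ≠ 0) {b₀ b₁ b₂ : ℂ}
    (hb0 : b₀ ≠ 0) (hb1 : b₁ ≠ 0) (hb2 : b₂ ≠ 0) (m : Fin (N + 1) → ℕ) {i : Fin (N + 1)} {n : ℕ}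
    (hi : m i = n + 1)
    (h0 : q * b₀ ≠ node q a x m (∑ i, m i) (some i))
    (h1 : q * b₁ ≠ node q a x m (∑ i, m i) (some i))
    (h2 : q * b₂ ≠ node q a x m (∑ i, m i) (some i)) :
    tele q a α β z x c b₀ b₁ b₂ (Function.update m i n) (some i) =
      (-1) ^ N * (q ^ (∑ i, m i))⁻¹ * ((∏ j, c j) / (∏ i, x i) * (q ^ 3 * b₀ * b₁ * b₂)) *
        serTerm q a α β z x c b₀ b₁ b₂ m *
        pfTerm q a α β x b₀ b₁ b₂ m (∑ i, m i) (some i) := by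
  have ha := h.a_ne
  have hsum : ∑ k, Function.update m i n k + 1 = ∑ k, m k := by
    rw [← Finset.add_sum_erase _ _ (Finset.mem_univ i),
      ← Finset.add_sum_erase Finset.univ (fun k => m k) (Finset.mem_univ i), hi, Function.update_self,
      Finset.sum_congr rfl fun j hj => Function.update_of_ne (Finset.ne_of_mem_erase hj) n m]
    exact add_right_comm _ _ _
  simp only [tele, serTerm, pfTerm, numP, hsum]
  set L := ∑ i, m i with hL
  have hQ : q ^ L ≠ 0 := pow_ne_zero _ hq0
  have hcore := core_update (a := a) hq α β z h.ratio_ne hi L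
  have hS : ∏ j ∈ Finset.univ.erase i, (x i * q ^ m i - x j * q ^ m j) ≠ 0 :=
    Finset.prod_ne_zero_iff.2 fun j hj => sub_ne_zero.2
      (h.mul_pow_ne hq0 (Finset.ne_of_mem_erase hj).symm _ _)
  have hY : ∏ j ∈ Finset.univ.erase i, (x i * q ^ n - x j * q ^ m j) ≠ 0 :=
    Finset.prod_ne_zero_iff.2 fun j hj => sub_ne_zero.2
      (h.mul_pow_ne hq0 (Finset.ne_of_mem_erase hj).symm _ _)
  have hy1 : ∀ k, 1 - a * (x i * q ^ k) * q ^ L ≠ 0 := fun k => by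
    have := h.one_sub_ne hq i (k + L)
    rwa [show a * (x i * q ^ k) * q ^ L = a * x i * q ^ (k + L) by ring]
  have e1 : ∀ (l : Fin (N + 1) → ℕ), ∏ o' ∈ Finset.univ.erase (some i),
      (node q a x l L (some i) - node q a x l L o') =
      (x i * q ^ l i - (a * q ^ L)⁻¹) *
        ∏ j ∈ Finset.univ.erase i, (x i * q ^ l i - x j * q ^ l j) := by
    intro l
    rw [prod_erase_eq_prod_ite, Fintype.prod_option, prod_erase_eq_prod_ite]
    simp [node]
  have e2 : ∏ j ∈ Finset.univ.erase i,
      (x i * q ^ n - x j * q ^ (Function.update m i n j)) =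
      ∏ j ∈ Finset.univ.erase i, (x i * q ^ n - x j * q ^ m j) :=
    Finset.prod_congr rfl fun j hj => by rw [Function.update_of_ne (Finset.ne_of_mem_erase hj)]
  have e3 : ∀ y : ℂ, y - (a * q ^ L)⁻¹ = -(1 - a * y * q ^ L) * (a * q ^ L)⁻¹ := by
    intro y
    field_simp
    ring
  have e4 : ∏ j, (x i * q ^ m i - x j) =
      (-1) ^ (N + 1) * (∏ j, x j) * ∏ j, (1 - x i * q ^ m i / x j) := by
    have h1 : ∀ j, x i * q ^ m i - x j = -1 * x j * (1 - x i * q ^ m i / x j) := by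
      intro j
      have := h.x_ne j
      field_simp
      ring
    rw [Finset.prod_congr rfl fun j _ => h1 j, Finset.prod_mul_distrib, Finset.prod_mul_distrib,
      Finset.prod_const, Finset.card_univ, Fintype.card_fin]
  have e5 : ∏ j, (c j - x i * q ^ n) = (∏ j, c j) * ∏ j, (1 - x i * q ^ n / c j) := by
    rw [← Finset.prod_mul_distrib]
    refine Finset.prod_congr rfl fun j _ => ?_
    have := hc j
    field_simp
  have e6 : ∏ j, bfac q a x (c j) m L =
      (∏ j, bfac q a x (c j) (Function.update m i n) L) * ∏ j, (1 - x i * q ^ n / c j) := by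
    rw [← Finset.prod_mul_distrib]
    exact Finset.prod_congr rfl fun j _ => bfac_update _ _ _ hi _
  have hX : ∏ j, x j ≠ 0 := Finset.prod_ne_zero_iff.2 fun j _ => h.x_ne j
  have e7 : ∀ {b}, b ≠ 0 → x i * q ^ m i - q * b = -(q * b) * (1 - x i * q ^ n / b) := by
    intro b hb
    rw [hi]
    field_simp
    ring
  have e8 : ∀ {b}, b ≠ 0 → q * b ≠ node q a x m L (some i) → 1 - x i * q ^ n / b ≠ 0 := by
    intro b hb hne h0
    have := e7 hb
    rw [h0, mul_zero] at this
    exact hne (sub_eq_zero.1 this).symm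
  have h0 := e8 hb0 h0
  have h1 := e8 hb1 h1
  have h2 := e8 hb2 h2
  rw [e1, e1, Function.update_self, e2, e6, bfac_update a x b₀ hi, bfac_update a x b₁ hi,
    bfac_update a x b₂ hi]
  simp only [node, Function.update_self]
  rw [e4, e5, e3, e3, e7 hb0, e7 hb1, e7 hb2]
  have hyn := hy1 n
  have hym := hy1 (m i)
  set Y := ∏ j ∈ Finset.univ.erase i, (x i * q ^ n - x j * q ^ m j)
  set S := ∏ j ∈ Finset.univ.erase i, (x i * q ^ m i - x j * q ^ m j)
  set wn := 1 - a * (x i * q ^ n) * q ^ L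
  set wm := 1 - a * (x i * q ^ m i) * q ^ L
  have hc1 := eq_div_of_mul_eq (mul_ne_zero hS hym) hcore.symm
  rw [hc1]
  set w0 := 1 - x i * q ^ n / b₀
  set w1 := 1 - x i * q ^ n / b₁
  set w2 := 1 - x i * q ^ n / b₂
  set X := ∏ j, x j
  generalize 1 - x i * q ^ m i / α = A
  generalize 1 - x i * q ^ m i / β = B
  clear_value Y S wn wm w0 w1 w2 X
  generalize core q a α β z x m L = K
  generalize ∏ j, bfac q a x (c j) _ L = PB
  generalize ∏ j, (1 - x i * q ^ n / c j) = PC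
  generalize ∏ j, (1 - x i * q ^ m i / x j) = PX
  generalize bfac q a x b₀ _ L = B0
  generalize bfac q a x b₁ _ L = B1
  generalize bfac q a x b₂ _ L = B2
  generalize ∏ j, c j = C
  have hsg : ((-1 : ℂ) ^ N) * (-1) ^ N = 1 := by rw [← mul_pow]; simp
  rw [pow_succ (-1 : ℂ) N]
  generalize (-1 : ℂ) ^ N = ε at *
  exact tele_some_aux _ _ _ _ _ _ _ _ _ _ hq0 ha hb0 hb1 hb2 hQ hY hyn h0 h1 h2 hX hsg

/-- By `bfac_mul_left`, the three shifted summands are the partial fraction terms at q b_0, q b_1, q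
b_2 times a common factor. Since all terms add up to zero, the remaining nodes give the right-hand
side. -/
lemma threeTerm_serTerm (hq0 : q ≠ 0) (hq : ‖q‖ < 1) {α β : ℂ} (z : ℂ) {N : ℕ}
    {x : Fin (N + 1) → ℂ} (h : Generic q a x) (c : Fin N → ℂ) {b₀ b₁ b₂ : ℂ}
    (hb0 : b₀ ≠ 0) (hb1 : b₁ ≠ 0) (hb2 : b₂ ≠ 0) (m : Fin (N + 1) → ℕ)
    (h01 : b₀ ≠ b₁) (h02 : b₀ ≠ b₂) (h12 : b₁ ≠ b₂)
    (h0 : ∀ o, q * b₀ ≠ node q a x m (∑ i, m i) o) (h1 : ∀ o, q * b₁ ≠ node q a x m (∑ i, m i) o)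
    (h2 : ∀ o, q * b₂ ≠ node q a x m (∑ i, m i) o) :
    threeTerm q α β (fun b₀ b₁ b₂ => serTerm q a α β z x c b₀ b₁ b₂ m) b₀ b₁ b₂ =
      q ^ 2 * ((b₀ - b₁) * (b₁ - b₂) * (b₀ - b₂)) * (a * q ^ (∑ i, m i))⁻¹ *
        serTerm q a α β z x c b₀ b₁ b₂ m *
        ∑ o, pfTerm q a α β x b₀ b₁ b₂ m (∑ i, m i) o := by
  have ha := h.a_ne
  obtain ⟨P, hP, hPe⟩ := exists_eval_eq_numP α β x
  have hs := h.node_injective hq0 hq m (∑ i, m i)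
  have hmul : ∀ {b b' : ℂ}, b ≠ b' → q * b ≠ q * b' := fun hb => fun e =>
    hb (mul_left_cancel₀ hq0 e)
  have key := sum_option_erase_eq_zero hs (hmul h01) (hmul h02) (hmul h12) h0 h1 h2 P hP
  simp only [hPe] at key
  simp only [threeTerm, serTerm]
  change (∑ o, pfTerm q a α β x b₀ b₁ b₂ m (∑ i, m i) o) + _ + _ + _ = 0 at key
  set L := ∑ i, m i with hL
  have hQ : q ^ L ≠ 0 := pow_ne_zero _ hq0
  have e1 : ∀ {b}, b ≠ 0 → (∀ o, q * b ≠ node q a x m L o) →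
      (∏ o, (q * b - node q a x m L o) ≠ 0) ∧ bfac q a x (q * b) m L =
      bfac q a x b m L * (∏ i, (q * b - x i)) * (-(a * q ^ L)⁻¹) /
        ∏ o, (q * b - node q a x m L o) := by
    intro b hb hne
    have hne0 : ∏ o, (q * b - node q a x m L o) ≠ 0 :=
      Finset.prod_ne_zero_iff.2 fun o _ => sub_ne_zero.2 (hne o)
    refine ⟨hne0, ?_⟩
    rw [eq_div_iff hne0, ← bfac_mul_left hq0 hq a x hb m L, Fintype.prod_option]
    simp only [node]
    field_simp
    ring
  obtain ⟨n0, e0⟩ := e1 hb0 h0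
  obtain ⟨n1, e1'⟩ := e1 hb1 h1
  obtain ⟨n2, e2⟩ := e1 hb2 h2
  rw [e0, e1', e2]
  rw [add_assoc, add_assoc, ← eq_neg_iff_add_eq_zero] at key
  rw [key]
  simp only [numP]
  have d01 := sub_ne_zero.2 h01
  have d02 := sub_ne_zero.2 h02
  have d12 := sub_ne_zero.2 h12
  have r1 : ∀ u v : ℂ, q * u - q * v = q * (u - v) := fun u v => by ring
  rw [r1, r1, r1, r1, r1, r1, ← neg_sub b₀ b₁, ← neg_sub b₁ b₂, ← neg_sub b₀ b₂]
  generalize ∏ o, (q * b₀ - node q a x m L o) = N0 at *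
  generalize ∏ o, (q * b₁ - node q a x m L o) = N1 at *
  generalize ∏ o, (q * b₂ - node q a x m L o) = N2 at *
  generalize b₀ - b₁ = u01 at *
  generalize b₀ - b₂ = u02 at *
  generalize b₁ - b₂ = u12 at *
  generalize ∏ i, (q * b₀ - x i) = X0
  generalize ∏ i, (q * b₁ - x i) = X1
  generalize ∏ i, (q * b₂ - x i) = X2
  generalize (1 - q * b₀ / α) = A0
  generalize (1 - q * b₁ / α) = A1
  generalize (1 - q * b₂ / α) = A2
  generalize (1 - q * b₀ / β) = B0
  generalize (1 - q * b₁ / β) = B1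
  generalize (1 - q * b₂ / β) = B2
  clear key e0 e1 e1' e2 h0 h1 h2
  field_simp
  ring

end QRP

/-! ### The three-term relation for the series. -/

namespace QRP

open Filter Topology

variable {q a : ℂ}

/-- The right-hand side of the telescoping identity. -/
noncomputable def teleSum (q a α β z : ℂ) {N : ℕ} (x : Fin (N + 1) → ℂ) (c : Fin N → ℂ)
    (b₀ b₁ b₂ : ℂ) (m : Fin (N + 1) → ℕ) : ℂ :=
  tele q a α β z x c b₀ b₁ b₂ m none + ∑ i, if m i = 0 then 0 else
    tele q a α β z x c b₀ b₁ b₂ (Function.update m i (m i - 1)) (some i)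

lemma threeTerm_serTerm_eq_teleSum_of_ne (hq0 : q ≠ 0) (hq : ‖q‖ < 1) {α β : ℂ} (hα : α ≠ 0)
    (hβ : β ≠ 0) {z : ℂ} {N : ℕ} {x : Fin (N + 1) → ℂ} (h : Generic q a x) {c : Fin N → ℂ}
    (hc : ∀ j, c j ≠ 0) {b₀ b₁ b₂ : ℂ} (hb0 : b₀ ≠ 0) (hb1 : b₁ ≠ 0) (hb2 : b₂ ≠ 0)
    (hbal : (∏ j, c j) / (∏ i, x i) * (q ^ 3 * b₀ * b₁ * b₂) = z * α * β) (m : Fin (N + 1) → ℕ)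
    (h01 : b₀ ≠ b₁) (h02 : b₀ ≠ b₂) (h12 : b₁ ≠ b₂)
    (h0 : ∀ o, q * b₀ ≠ node q a x m (∑ i, m i) o) (h1 : ∀ o, q * b₁ ≠ node q a x m (∑ i, m i) o)
    (h2 : ∀ o, q * b₂ ≠ node q a x m (∑ i, m i) o) :
    (z * a * α * β) *
      threeTerm q α β (fun b₀ b₁ b₂ => serTerm q a α β z x c b₀ b₁ b₂ m) b₀ b₁ b₂ =
      (-1) ^ N * q ^ 2 * ((b₀ - b₁) * (b₁ - b₂) * (b₀ - b₂)) *
        teleSum q a α β z x c b₀ b₁ b₂ m := by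
  have ha := h.a_ne
  have hQ : q ^ (∑ i, m i) ≠ 0 := pow_ne_zero _ hq0
  have hR : teleSum q a α β z x c b₀ b₁ b₂ m = (-1) ^ N * (q ^ (∑ i, m i))⁻¹ * (z * α * β) *
      serTerm q a α β z x c b₀ b₁ b₂ m * ∑ o, pfTerm q a α β x b₀ b₁ b₂ m (∑ i, m i) o := by
    rw [teleSum, Fintype.sum_option, mul_add,
      ← tele_none hq0 hq hα hβ z h c m (h0 none) (h1 none) (h2 none), Finset.mul_sum]
    congr 1
    refine Finset.sum_congr rfl fun i _ => ?_
    split_ifs with hi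
    -- For m_i = 0 there is no index m - e_i; the partial fraction term disappears too, because its
    -- node x_i is a zero of `numP`.
    · have : pfTerm q a α β x b₀ b₁ b₂ m (∑ i, m i) (some i) = 0 := by
        have : ∏ j, (x i - x j) = 0 := Finset.prod_eq_zero (Finset.mem_univ i) (sub_self _)
        simp [pfTerm, numP, node, hi, this]
      rw [this, mul_zero]
    · rw [tele_some hq0 hq z h hc hb0 hb1 hb2 m (i := i) (n := m i - 1) (by omega) (h0 _) (h1 _)
        (h2 _), hbal]
  rw [hR, threeTerm_serTerm hq0 hq z h c hb0 hb1 hb2 m h01 h02 h12 h0 h1 h2]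
  have hsg : ((-1 : ℂ) ^ N) * (-1) ^ N = 1 := by rw [← mul_pow]; simp
  have e : (a * q ^ (∑ i, m i))⁻¹ * a = (q ^ (∑ i, m i))⁻¹ := by field_simp
  linear_combination (z * α * β * (q ^ 2 * ((b₀ - b₁) * (b₁ - b₂) * (b₀ - b₂))) *
    serTerm q a α β z x c b₀ b₁ b₂ m * ∑ o, pfTerm q a α β x b₀ b₁ b₂ m (∑ i, m i) o) *
    (e - (q ^ (∑ i, m i))⁻¹ * hsg)

lemma eventually_mul_pow_ne {A : ℂ} (hA : A ≠ 0) (B : ℂ) {k : ℕ} (hk : k ≠ 0) :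
    ∀ᶠ s in 𝓝[≠] (1 : ℂ), A * s ^ k ≠ B := by
  have hP : Polynomial.C A * Polynomial.X ^ k - Polynomial.C B ≠ 0 := by
    intro h
    have := congrArg (fun P => Polynomial.coeff P k) h
    simp [Polynomial.coeff_C, hk] at this
    exact hA this
  have hfin : {s : ℂ | A * s ^ k = B}.Finite := by
    refine (Polynomial.C A * Polynomial.X ^ k - Polynomial.C B).roots.toFinset.finite_toSet.subset
      fun s hs => ?_
    simp only [Finset.mem_coe, Multiset.mem_toFinset, Polynomial.mem_roots hP, Polynomial.IsRoot,
      Polynomial.eval_sub, Polynomial.eval_mul, Polynomial.eval_C, Polynomial.eval_pow,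
      Polynomial.eval_X]
    exact sub_eq_zero.2 hs
  exact nhdsNE_le_cofinite _ hfin.compl_mem_cofinite

lemma continuousAt_bfac (hq : ‖q‖ < 1) {M : ℕ} (x : Fin M → ℂ) {f : ℂ → ℂ} {s : ℂ}
    (hf : ContinuousAt f s) (hs : f s ≠ 0) (l : Fin M → ℕ) (Λ : ℕ) :
    ContinuousAt (fun t => bfac q a x (f t) l Λ) s := by
  unfold bfac
  have h1 : ContinuousAt (fun t => a * q * f t * q ^ Λ) s := by fun_prop
  refine ((continuous_pochInf hq).continuousAt.comp h1).mul ?_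
  refine tendsto_finsetProd _ fun i _ => ?_
  exact (continuous_poch q (l i)).continuousAt.tendsto.comp (tendsto_const_nhds.div hf hs)

lemma continuousAt_serTerm (hq : ‖q‖ < 1) (α β z : ℂ) {N : ℕ} (x : Fin (N + 1) → ℂ)
    (c : Fin N → ℂ) {f g h : ℂ → ℂ} {s : ℂ} (hf : ContinuousAt f s) (hg : ContinuousAt g s)
    (hh : ContinuousAt h s) (hfs : f s ≠ 0) (hgs : g s ≠ 0) (hhs : h s ≠ 0)
    (l : Fin (N + 1) → ℕ) :
    ContinuousAt (fun t => serTerm q a α β z x c (f t) (g t) (h t) l) s := by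
  unfold serTerm
  exact continuousAt_const.mul (((continuousAt_bfac hq x hf hfs l _).mul
    (continuousAt_bfac hq x hg hgs l _)).mul (continuousAt_bfac hq x hh hhs l _))

lemma continuousAt_tele (hq : ‖q‖ < 1) (α β z : ℂ) {N : ℕ} (x : Fin (N + 1) → ℂ)
    (c : Fin N → ℂ) {f g h : ℂ → ℂ} {s : ℂ} (hf : ContinuousAt f s) (hg : ContinuousAt g s)
    (hh : ContinuousAt h s) (hfs : f s ≠ 0) (hgs : g s ≠ 0) (hhs : h s ≠ 0)
    (l : Fin (N + 1) → ℕ) (o : Option (Fin (N + 1))) :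
    ContinuousAt (fun t => tele q a α β z x c (f t) (g t) (h t) l o) s := by
  unfold tele
  exact (continuousAt_const.mul (((continuousAt_bfac hq x hf hfs l _).mul
    (continuousAt_bfac hq x hg hgs l _)).mul (continuousAt_bfac hq x hh hhs l _))).mul
    continuousAt_const

/-- Coincidences among the b's and the nodes only obstruct the partial fractions, not the identity:
both sides are continuous in the b's. -/
lemma threeTerm_serTerm_eq_teleSum (hq0 : q ≠ 0) (hq : ‖q‖ < 1) {α β : ℂ} (hα : α ≠ 0)
    (hβ : β ≠ 0) {z : ℂ} {N : ℕ} {x : Fin (N + 1) → ℂ} (h : Generic q a x) {c : Fin N → ℂ}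
    (hc : ∀ j, c j ≠ 0) {b₀ b₁ b₂ : ℂ} (hb0 : b₀ ≠ 0) (hb1 : b₁ ≠ 0) (hb2 : b₂ ≠ 0)
    (hbal : (∏ j, c j) / (∏ i, x i) * (q ^ 3 * b₀ * b₁ * b₂) = z * α * β)
    (m : Fin (N + 1) → ℕ) :
    (z * a * α * β) *
      threeTerm q α β (fun b₀ b₁ b₂ => serTerm q a α β z x c b₀ b₁ b₂ m) b₀ b₁ b₂ =
      (-1) ^ N * q ^ 2 * ((b₀ - b₁) * (b₁ - b₂) * (b₀ - b₂)) *
        teleSum q a α β z x c b₀ b₁ b₂ m := by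
  -- The exponents 1, 2, -3 are distinct and nonzero and add up to 0. So the product of the three
  -- parameters, and with it the balancing condition, is kept, while each coincidence excludes only
  -- finitely many s.
  set f : ℂ → ℂ := fun s => b₀ * s with hf
  set g : ℂ → ℂ := fun s => b₁ * s ^ 2 with hg
  set k : ℂ → ℂ := fun s => b₂ / s ^ 3 with hk
  have cf : ContinuousAt f 1 := by fun_prop
  have cg : ContinuousAt g 1 := by fun_prop
  have ck : ContinuousAt k 1 := by
    refine ContinuousAt.div continuousAt_const (by fun_prop) (by simp)
  have f1 : f 1 = b₀ := by simp [hf]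
  have g1 : g 1 = b₁ := by simp [hg]
  have k1 : k 1 = b₂ := by simp [hk]
  have cf' : ContinuousAt (fun s => q * f s) 1 := continuousAt_const.mul cf
  have cg' : ContinuousAt (fun s => q * g s) 1 := continuousAt_const.mul cg
  have ck' : ContinuousAt (fun s => q * k s) 1 := continuousAt_const.mul ck
  have nf : f 1 ≠ 0 := by rwa [f1]
  have ng : g 1 ≠ 0 := by rwa [g1]
  have nk : k 1 ≠ 0 := by rwa [k1]
  have nf' := mul_ne_zero hq0 nf
  have ng' := mul_ne_zero hq0 ng
  have nk' := mul_ne_zero hq0 nk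
  have cL : ContinuousAt (fun s => (z * a * α * β) *
      threeTerm q α β (fun b₀ b₁ b₂ => serTerm q a α β z x c b₀ b₁ b₂ m) (f s) (g s) (k s)) 1 := by
    unfold threeTerm
    have s1 := continuousAt_serTerm (a := a) hq α β z x c cf' cg ck nf' ng nk m
    have s2 := continuousAt_serTerm (a := a) hq α β z x c cf cg' ck nf ng' nk m
    have s3 := continuousAt_serTerm (a := a) hq α β z x c cf cg ck' nf ng nk' m
    fun_prop
  have cR : ContinuousAt (fun s => (-1) ^ N * q ^ 2 *
      ((f s - g s) * (g s - k s) * (f s - k s)) * teleSum q a α β z x c (f s) (g s) (k s) m) 1 := by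
    have t1 : ContinuousAt (fun s => teleSum q a α β z x c (f s) (g s) (k s) m) 1 := by
      unfold teleSum
      refine (continuousAt_tele hq α β z x c cf cg ck nf ng nk _ _).add ?_
      refine tendsto_finsetSum _ fun i _ => ?_
      by_cases hi : m i = 0
      · simp only [hi, if_true]; exact tendsto_const_nhds
      · simp only [hi, if_false]
        exact continuousAt_tele hq α β z x c cf cg ck nf ng nk _ _
    fun_prop
  have hn : ∀ o, node q a x m (∑ i, m i) o ≠ 0 := by
    have := h.a_ne
    rintro (_ | i)
    · exact inv_ne_zero (mul_ne_zero h.a_ne (pow_ne_zero _ hq0))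
    · exact mul_ne_zero (h.x_ne i) (pow_ne_zero _ hq0)
  have key : ∀ᶠ s in 𝓝[≠] (1 : ℂ), (z * a * α * β) *
      threeTerm q α β (fun b₀ b₁ b₂ => serTerm q a α β z x c b₀ b₁ b₂ m) (f s) (g s) (k s) =
      (-1) ^ N * q ^ 2 * ((f s - g s) * (g s - k s) * (f s - k s)) *
        teleSum q a α β z x c (f s) (g s) (k s) m := by
    filter_upwards [eventually_mul_pow_ne one_ne_zero 0 one_ne_zero,
      eventually_mul_pow_ne hb1 b₀ one_ne_zero, eventually_mul_pow_ne hb0 b₂ four_ne_zero,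
      eventually_mul_pow_ne hb1 b₂ (k := 5) (by norm_num),
      eventually_all.2 fun o => eventually_mul_pow_ne (mul_ne_zero hq0 hb0)
        (node q a x m (∑ i, m i) o) one_ne_zero,
      eventually_all.2 fun o => eventually_mul_pow_ne (mul_ne_zero hq0 hb1)
        (node q a x m (∑ i, m i) o) two_ne_zero,
      eventually_all.2 fun o => eventually_mul_pow_ne (hn o) (q * b₂) three_ne_zero]
      with s s0 s1 s2 s3 s4 s5 s6
    have s0 : s ≠ 0 := by simpa using s0
    refine threeTerm_serTerm_eq_teleSum_of_ne hq0 hq hα hβ h hc (mul_ne_zero hb0 s0)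
      (mul_ne_zero hb1 (pow_ne_zero _ s0)) (div_ne_zero hb2 (pow_ne_zero _ s0)) ?_ m ?_ ?_ ?_
      ?_ ?_ ?_
    · rw [← hbal]
      field_simp
    · intro e
      refine s1 (mul_right_cancel₀ s0 ?_)
      rw [e]; ring
    · intro e
      refine s2 ?_
      rw [eq_div_iff (pow_ne_zero _ s0)] at e
      rw [← e]; ring
    · intro e
      refine s3 ?_
      rw [eq_div_iff (pow_ne_zero _ s0)] at e
      rw [← e]; ring
    · intro o e
      exact s4 o (by rw [← e]; ring)
    · intro o e
      exact s5 o (by rw [← e]; ring)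
    · intro o e
      refine s6 o ?_
      rw [← e]; field_simp
  have t1 := (cL.tendsto.mono_left nhdsWithin_le_nhds : Tendsto _ (𝓝[≠] (1 : ℂ)) _)
  have t2 := (cR.tendsto.mono_left nhdsWithin_le_nhds : Tendsto _ (𝓝[≠] (1 : ℂ)) _)
  have := tendsto_nhds_unique (t1.congr' key) t2
  simpa only [f1, g1, k1] using this

/-- Reindexing by m = l + e_i; indices with m_i = 0 are not of this form. -/
lemma sum_piAntidiag_update {ι : Type*} [Fintype ι] [DecidableEq ι] (i : ι) (n : ℕ)
    (f : (ι → ℕ) → ℂ) :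
    ∑ m ∈ Finset.piAntidiag Finset.univ (n + 1),
      (if m i = 0 then 0 else f (Function.update m i (m i - 1))) =
    ∑ l ∈ Finset.piAntidiag Finset.univ n, f l := by
  have hs : ∀ (m : ι → ℕ) (k : ℕ), ∑ j, Function.update m i k j + m i = ∑ j, m j + k := by
    intro m k
    rw [← Finset.add_sum_erase _ _ (Finset.mem_univ i),
      ← Finset.add_sum_erase Finset.univ (fun k => m k) (Finset.mem_univ i), Function.update_self,
      Finset.sum_congr rfl fun j hj => Function.update_of_ne (Finset.ne_of_mem_erase hj) k m]
    ring
  have e : ∀ m : ι → ℕ, (if m i = 0 then 0 else f (Function.update m i (m i - 1))) =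
      if m i ≠ 0 then f (Function.update m i (m i - 1)) else 0 := fun m => by rw [ite_not]
  rw [Finset.sum_congr rfl fun m _ => e m, ← Finset.sum_filter]
  refine Finset.sum_nbij' (fun m => Function.update m i (m i - 1))
    (fun l => Function.update l i (l i + 1)) ?_ ?_ ?_ ?_ fun _ _ => rfl
  · intro m hm
    simp only [Finset.mem_filter, Finset.mem_piAntidiag, Finset.mem_univ, implies_true,
      and_true] at hm ⊢
    have := hs m (m i - 1)
    change ∑ j, m j = _ ∧ _ at hm
    change ∑ j, Function.update m i (m i - 1) j = n
    omega
  · intro l hl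
    simp only [Finset.mem_filter, Finset.mem_piAntidiag, Finset.mem_univ, implies_true,
      and_true, Function.update_self] at hl ⊢
    have := hs l (l i + 1)
    change ∑ j, l j = _ at hl
    change ∑ j, Function.update l i (l i + 1) j = n + 1 ∧ _
    omega
  · intro m hm
    have hm := (Finset.mem_filter.1 hm).2
    simp [Nat.sub_add_cancel (Nat.one_le_iff_ne_zero.2 hm)]
  · intro l _
    simp

/-- The multi-indices of total degree less than `K`. -/
def degreeLT (ι : Type*) [Fintype ι] [DecidableEq ι] (K : ℕ) : Finset (ι → ℕ) :=
  (Finset.range K).biUnion fun n => Finset.piAntidiag Finset.univ n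

lemma sum_degreeLT {ι : Type*} [Fintype ι] [DecidableEq ι] (f : (ι → ℕ) → ℂ) (K : ℕ) :
    ∑ m ∈ degreeLT ι K, f m =
      ∑ n ∈ Finset.range K, ∑ m ∈ Finset.piAntidiag Finset.univ n, f m := by
  refine Finset.sum_biUnion fun n _ n' _ hn => ?_
  refine Finset.disjoint_left.2 fun m h1 h2 => hn ?_
  rw [← (Finset.mem_piAntidiag.1 h1).1, (Finset.mem_piAntidiag.1 h2).1]

lemma tendsto_degreeLT (ι : Type*) [Fintype ι] [DecidableEq ι] :
    Tendsto (degreeLT ι) atTop atTop := by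
  refine tendsto_atTop_finset_of_monotone (fun K K' h => ?_) fun m => ⟨∑ i, m i + 1, ?_⟩
  · exact Finset.biUnion_subset_biUnion_of_subset_left _ (Finset.range_mono h)
  · refine Finset.mem_biUnion.2 ⟨∑ i, m i, Finset.self_mem_range_succ _, ?_⟩
    simp

/-- The inflow into degree n + 1 is the sum over |l| = n and i of `tele l (some i)`, which is minus
the sum of `tele l none` by `sum_tele_eq_zero`. Consecutive degrees cancel and the top degree
remains. -/
lemma sum_degreeLT_teleSum (hq0 : q ≠ 0) (hq : ‖q‖ < 1) (α β z : ℂ) {N : ℕ}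
    {x : Fin (N + 1) → ℂ} (h : Generic q a x) (c : Fin N → ℂ) (b₀ b₁ b₂ : ℂ) (K : ℕ) :
    ∑ m ∈ degreeLT _ (K + 1), teleSum q a α β z x c b₀ b₁ b₂ m =
      ∑ m ∈ Finset.piAntidiag Finset.univ K, tele q a α β z x c b₀ b₁ b₂ m none := by
  have hstep : ∀ n, ∑ m ∈ Finset.piAntidiag Finset.univ (n + 1),
      teleSum q a α β z x c b₀ b₁ b₂ m =
      (∑ m ∈ Finset.piAntidiag Finset.univ (n + 1), tele q a α β z x c b₀ b₁ b₂ m none) -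
      ∑ m ∈ Finset.piAntidiag Finset.univ n, tele q a α β z x c b₀ b₁ b₂ m none := by
    intro n
    simp only [teleSum]
    rw [Finset.sum_add_distrib, Finset.sum_comm,
      Finset.sum_congr rfl fun i _ => sum_piAntidiag_update i n fun l =>
        tele q a α β z x c b₀ b₁ b₂ l (some i), Finset.sum_comm, sub_eq_add_neg,
      ← Finset.sum_neg_distrib]
    congr 1
    refine Finset.sum_congr rfl fun l _ => ?_
    have := sum_tele_eq_zero hq0 hq α β z h c b₀ b₁ b₂ l
    rw [Fintype.sum_option] at this
    linear_combination this
  rw [sum_degreeLT]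
  induction K with
  | zero =>
    rw [Finset.sum_range_one]
    refine Finset.sum_congr rfl fun m hm => ?_
    have hm : ∀ i, m i = 0 := by
      have := (Finset.mem_piAntidiag.1 hm).1
      simpa [Finset.sum_eq_zero_iff] using this
    simp [teleSum, hm]
  | succ K ih => rw [Finset.sum_range_succ, ih, hstep]; ring

/-- Summation by total degree turns the combination into the boundary term of degree K, which tends
to zero. -/
theorem threeTerm_tsum_serTerm (hq0 : q ≠ 0) (hq : ‖q‖ < 1) {α β : ℂ} (hα : α ≠ 0)
    (hβ : β ≠ 0) {z : ℂ} (hz : z ≠ 0) {N : ℕ} {x : Fin (N + 1) → ℂ} (h : Generic q a x)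
    {c : Fin N → ℂ} (hc : ∀ j, c j ≠ 0) {b₀ b₁ b₂ : ℂ} (hb0 : b₀ ≠ 0) (hb1 : b₁ ≠ 0)
    (hb2 : b₂ ≠ 0) (hbal : (∏ j, c j) / (∏ i, x i) * (q ^ 3 * b₀ * b₁ * b₂) = z * α * β)
    (hsum : ∀ b₀ b₁ b₂ : ℂ, b₀ ≠ 0 → b₁ ≠ 0 → b₂ ≠ 0 →
      Summable fun m => serTerm q a α β z x c b₀ b₁ b₂ m)
    (hsum' : Summable fun m => tele q a α β z x c b₀ b₁ b₂ m none) :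
    threeTerm q α β (fun b₀ b₁ b₂ => ∑' m, serTerm q a α β z x c b₀ b₁ b₂ m) b₀ b₁ b₂ = 0 := by
  have h0 := (hsum (q * b₀) b₁ b₂ (mul_ne_zero hq0 hb0) hb1 hb2).hasSum
  have h1 := (hsum b₀ (q * b₁) b₂ hb0 (mul_ne_zero hq0 hb1) hb2).hasSum
  have h2 := (hsum b₀ b₁ (q * b₂) hb0 hb1 (mul_ne_zero hq0 hb2)).hasSum
  have hS : HasSum (fun m => threeTerm q α β (fun b₀ b₁ b₂ => serTerm q a α β z x c b₀ b₁ b₂ m)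
      b₀ b₁ b₂) (threeTerm q α β (fun b₀ b₁ b₂ => ∑' m, serTerm q a α β z x c b₀ b₁ b₂ m)
      b₀ b₁ b₂) :=
    ((h0.mul_left _).add (h1.mul_left _)).add (h2.mul_left _)
  have hT := (hS.mul_left (z * a * α * β)).comp (tendsto_degreeLT _)
  simp only [threeTerm_serTerm_eq_teleSum hq0 hq hα hβ h hc hb0 hb1 hb2 hbal] at hT
  -- The slice of degree K of a summable family is a difference of two partial sums with the same
  -- limit.
  have hβ0 : Tendsto (fun K => ∑ m ∈ Finset.piAntidiag Finset.univ K,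
      tele q a α β z x c b₀ b₁ b₂ m none) atTop (𝓝 0) := by
    have t1 := hsum'.hasSum.comp (tendsto_degreeLT _)
    have t2 := (tendsto_add_atTop_iff_nat 1).2 t1
    have t3 := t2.sub t1
    rw [sub_self] at t3
    refine t3.congr fun K => ?_
    simp only [Function.comp]
    rw [sum_degreeLT, sum_degreeLT, Finset.sum_range_succ]
    ring
  have t4 := (tendsto_add_atTop_iff_nat 1).2 hT
  have t5 := hβ0.const_mul ((-1) ^ N * q ^ 2 * ((b₀ - b₁) * (b₁ - b₂) * (b₀ - b₂)))
  rw [mul_zero] at t5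
  have t6 := tendsto_nhds_unique t4 (t5.congr fun K => by
    simp only [Function.comp]
    rw [← Finset.mul_sum, sum_degreeLT_teleSum hq0 hq α β z h c])
  have := h.a_ne
  exact (mul_eq_zero.1 t6).resolve_left (by positivity)

end QRP

namespace QRP

open Filter Topology

/-! ### Bounds and summability -/

/-- A uniformly bounded family of complex numbers. -/
def UBdd {ι : Type*} (f : ι → ℂ) : Prop := ∃ C : ℝ, ∀ i, ‖f i‖ ≤ C

namespace UBdd

variable {ι : Type*} {f g : ι → ℂ}

lemma const (c : ℂ) : UBdd fun _ : ι => c := ⟨‖c‖, fun _ => le_rfl⟩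

lemma mul (hf : UBdd f) (hg : UBdd g) : UBdd fun i => f i * g i := by
  obtain ⟨C, hC⟩ := hf
  obtain ⟨D, hD⟩ := hg
  refine ⟨C * D, fun i => ?_⟩
  rw [norm_mul]
  exact mul_le_mul (hC i) (hD i) (norm_nonneg _) ((norm_nonneg _).trans (hC i))

lemma add (hf : UBdd f) (hg : UBdd g) : UBdd fun i => f i + g i := by
  obtain ⟨C, hC⟩ := hf
  obtain ⟨D, hD⟩ := hg
  exact ⟨C + D, fun i => (norm_add_le _ _).trans (add_le_add (hC i) (hD i))⟩

lemma neg (hf : UBdd f) : UBdd fun i => -f i := by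
  obtain ⟨C, hC⟩ := hf
  exact ⟨C, fun i => by rw [norm_neg]; exact hC i⟩

lemma sub (hf : UBdd f) (hg : UBdd g) : UBdd fun i => f i - g i := by
  simpa only [sub_eq_add_neg] using hf.add hg.neg

lemma prod {κ : Type*} (s : Finset κ) {F : κ → ι → ℂ} (h : ∀ k ∈ s, UBdd (F k)) :
    UBdd fun i => ∏ k ∈ s, F k i := by
  classical
  induction s using Finset.induction_on with
  | empty => simpa using const 1
  | insert k s hk ih =>
    simp only [Finset.prod_insert hk]
    exact (h k (Finset.mem_insert_self _ _)).mul
      (ih fun j hj => h j (Finset.mem_insert_of_mem hj))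

lemma comp {κ : Type*} (hf : UBdd f) (e : κ → ι) : UBdd fun k => f (e k) := by
  obtain ⟨C, hC⟩ := hf
  exact ⟨C, fun k => hC _⟩

end UBdd

variable {q a : ℂ}

lemma ubdd_pow (hq : ‖q‖ < 1) {ι : Type*} (e : ι → ℕ) : UBdd fun i => q ^ e i :=
  ⟨1, fun i => by rw [norm_pow]; exact pow_le_one₀ (norm_nonneg _) hq.le⟩

lemma ubdd_poch (hq : ‖q‖ < 1) {ι : Type*} {f : ι → ℂ} (hf : UBdd f) (e : ι → ℕ) :
    UBdd fun i => poch q (f i) (e i) := by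
  obtain ⟨C, hC⟩ := hf
  exact ⟨pochBound q C, fun i => norm_poch_le hq (hC i) _⟩

lemma ubdd_pochInf (hq : ‖q‖ < 1) {ι : Type*} {f : ι → ℂ} (hf : UBdd f) :
    UBdd fun i => pochInf q (f i) := by
  obtain ⟨C, hC⟩ := hf
  exact ⟨pochBound q C, fun i => norm_pochInf_le hq (hC i)⟩

lemma ubdd_inv_poch (hq : ‖q‖ < 1) {ι : Type*} {w : ℂ} (hw : pochInf q w ≠ 0) (e : ι → ℕ) :
    UBdd fun i => (poch q w (e i))⁻¹ := ⟨_, fun i => norm_inv_poch_le hq hw (e i)⟩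

lemma ubdd_inv_pochInf (hq : ‖q‖ < 1) {ι : Type*} {w : ℂ} (hw : pochInf q w ≠ 0) (e : ι → ℕ) :
    UBdd fun i => (pochInf q (w * q ^ e i))⁻¹ :=
  ⟨_, fun i => norm_inv_pochInf_mul_pow_le hq hw (e i)⟩

lemma ubdd_inv_one_sub (hq : ‖q‖ < 1) {ι : Type*} {w : ℂ} (hw : pochInf q w ≠ 0) (e : ι → ℕ) :
    UBdd fun i => (1 - w * q ^ e i)⁻¹ := by
  have h : ∀ n, (1 - w * q ^ n)⁻¹ = pochInf q (q * (w * q ^ n)) * (pochInf q (w * q ^ n))⁻¹ := by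
    intro n
    have h1 := pochInf_mul_pow_ne_zero hq hw n
    rw [pochInf_eq_one_sub_mul hq (w * q ^ n)] at h1 ⊢
    rw [mul_inv, mul_left_comm, mul_inv_cancel₀ (right_ne_zero_of_mul h1), mul_one]
  simp only [h]
  exact (ubdd_pochInf hq ((UBdd.const q).mul ((UBdd.const w).mul (ubdd_pow hq e)))).mul
    (ubdd_inv_pochInf hq hw e)

lemma summable_pow_sum {ρ : ℝ} (h0 : 0 ≤ ρ) (h1 : ρ < 1) (M : ℕ) :
    Summable fun l : Fin M → ℕ => ρ ^ (∑ i, l i) := by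
  induction M with
  | zero => exact (hasSum_fintype _).summable
  | succ M ih =>
    rw [← (Fin.consEquiv fun _ => ℕ).summable_iff]
    have := (summable_geometric_of_lt_one h0 h1).mul_of_nonneg ih (fun n => pow_nonneg h0 n)
      (fun l => pow_nonneg h0 _)
    refine this.congr fun p => ?_
    simp [Fin.consEquiv, Fin.sum_univ_succ, pow_add]

lemma core_eq_pow_mul (q a α β z : ℂ) {M : ℕ} (x : Fin M → ℂ) (l : Fin M → ℕ) (Λ : ℕ) :
    core q a α β z x l Λ = z ^ Λ * core q a α β 1 x l Λ := by
  simp only [core, one_pow]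
  ring

/-- Only nonnegative powers of q occur, and the denominators are bounded away from zero since the
corresponding infinite products do not vanish. The bound is uniform in l and Λ separately, so it
applies at Λ = |l| and at Λ = |l| + 1. -/
lemma ubdd_core (hq : ‖q‖ < 1) (α β : ℂ) {M : ℕ} {x : Fin M → ℂ} (h : Generic q a x) :
    UBdd fun p : (Fin M → ℕ) × ℕ => core q a α β 1 x p.1 p.2 := by
  have hr : ∀ i j, pochInf q (q * x i / x j) ≠ 0 := fun i j =>
    pochInf_ne_zero hq fun n => sub_ne_zero.2 (h.ratio_ne i j n).symm
  have hx : ∀ i, UBdd fun p : (Fin M → ℕ) × ℕ => x i * q ^ p.1 i :=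
    fun i => (UBdd.const _).mul (ubdd_pow hq _)
  simp only [core, one_pow, one_mul, div_eq_mul_inv, vandermonde, mul_inv, ← Finset.prod_inv_distrib]
  refine (UBdd.mul ?_ (UBdd.const _)).mul ?_ |>.mul
    ((ubdd_poch hq (UBdd.const _) _).mul (ubdd_poch hq (UBdd.const _) _))
  · exact UBdd.prod _ fun i _ => UBdd.prod _ fun j _ => (hx i).sub (hx j)
  · refine UBdd.prod _ fun i _ => ?_
    refine UBdd.mul (UBdd.mul ?_ ?_) (UBdd.mul ?_ ?_)
    · exact (UBdd.const _).sub ((UBdd.const _).mul (ubdd_pow hq _))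
    · exact (ubdd_pochInf hq ((UBdd.const _).mul (ubdd_pow hq _))).mul
        (ubdd_pochInf hq ((UBdd.const _).mul (ubdd_pow hq _)))
    · exact ubdd_inv_pochInf hq (h.ax_ne i) _
    · exact UBdd.prod _ fun j _ => ubdd_inv_poch hq (hr i j) _

lemma ubdd_bfac (hq : ‖q‖ < 1) (a : ℂ) {M : ℕ} (x : Fin M → ℂ) {ι : Type*} {f : ι → ℂ}
    (hf : UBdd f) (hx : ∀ i, UBdd fun k => x i / f k) :
    UBdd fun p : ι × (Fin M → ℕ) × ℕ => bfac q a x (f p.1) p.2.1 p.2.2 := by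
  unfold bfac
  refine (ubdd_pochInf hq (((UBdd.const _).mul (hf.comp _)).mul (ubdd_pow hq _))).mul ?_
  exact UBdd.prod _ fun i _ => ubdd_poch hq ((hx i).comp _) _

lemma ubdd_bfac_const (hq : ‖q‖ < 1) (a : ℂ) {M : ℕ} (x : Fin M → ℂ) (b : ℂ) :
    UBdd fun p : (Fin M → ℕ) × ℕ => bfac q a x b p.1 p.2 :=
  (ubdd_bfac hq a x (UBdd.const b) fun i => UBdd.const _).comp fun p => ((), p)

lemma summable_pow_mul_ubdd {z : ℂ} (hz : ‖z‖ < 1) {M : ℕ} {f : (Fin M → ℕ) → ℂ} (hf : UBdd f) :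
    Summable fun l => z ^ (∑ i, l i) * f l := by
  obtain ⟨C, hC⟩ := hf
  refine ((summable_pow_sum (norm_nonneg z) hz M).mul_right C).of_norm_bounded fun l => ?_
  rw [norm_mul, norm_pow]
  exact mul_le_mul_of_nonneg_left (hC l) (by positivity)

/-- The summand of the normalized series. -/
noncomputable def kTerm (q a α β z : ℂ) {M : ℕ} (x b : Fin M → ℂ) (d e : ℂ) (l : Fin M → ℕ) : ℂ :=
  core q a α β z x l (∑ i, l i) * (∏ j, bfac q a x (b j) l (∑ i, l i)) *
    (bfac q a x d l (∑ i, l i) * bfac q a x e l (∑ i, l i))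

lemma summable_kTerm (hq : ‖q‖ < 1) (α β : ℂ) {z : ℂ} (hz : ‖z‖ < 1) {M : ℕ} {x : Fin M → ℂ}
    (h : Generic q a x) (b : Fin M → ℂ) (d e : ℂ) : Summable (kTerm q a α β z x b d e) := by
  have h1 : UBdd fun l : Fin M → ℕ => core q a α β 1 x l (∑ i, l i) *
      ((∏ j, bfac q a x (b j) l (∑ i, l i)) *
      (bfac q a x d l (∑ i, l i) * bfac q a x e l (∑ i, l i))) := by
    have hb : ∀ w, UBdd fun l : Fin M → ℕ => bfac q a x w l (∑ i, l i) := fun w =>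
      (ubdd_bfac_const hq a x w).comp fun l => (l, ∑ i, l i)
    exact ((ubdd_core hq α β h).comp fun l => (l, ∑ i, l i)).mul
      ((UBdd.prod _ fun j _ => hb _).mul ((hb _).mul (hb _)))
  refine (summable_pow_mul_ubdd hz h1).congr fun l => ?_
  rw [kTerm, core_eq_pow_mul q a α β z]
  ring

lemma serTerm_eq_kTerm (q a α β z : ℂ) {N : ℕ} (x : Fin (N + 1) → ℂ) (c : Fin N → ℂ)
    (b₀ b₁ b₂ : ℂ) (l : Fin (N + 1) → ℕ) :
    serTerm q a α β z x c b₀ b₁ b₂ l = kTerm q a α β z x (Fin.cons b₀ c) b₁ b₂ l := by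
  simp only [serTerm, kTerm, Fin.prod_univ_succ, Fin.cons_zero, Fin.cons_succ]
  ring

/-- In this form the negative powers of q have cancelled, so that the terms are visibly z^|m| times
a bounded factor. -/
lemma tele_none_eq (hq0 : q ≠ 0) (hq : ‖q‖ < 1) (α β z : ℂ) {N : ℕ} {x : Fin (N + 1) → ℂ}
    (h : Generic q a x) (c : Fin N → ℂ) (b₀ b₁ b₂ : ℂ) (m : Fin (N + 1) → ℕ) :
    tele q a α β z x c b₀ b₁ b₂ m none = (-1) ^ N * a * (core q a α β z x m (∑ i, m i + 1) *
      (∏ j, bfac q a x (c j) m (∑ i, m i + 1)) *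
      (bfac q a x b₀ m (∑ i, m i + 1) * bfac q a x b₁ m (∑ i, m i + 1) *
      bfac q a x b₂ m (∑ i, m i + 1))) * ((∏ j, (1 - a * c j * q ^ (∑ i, m i + 1))) *
      ∏ i, (1 - a * x i * q ^ (∑ i, m i + 1 + m i))⁻¹) := by
  have ha := h.a_ne
  simp only [tele]
  set L := ∑ i, m i + 1 with hL
  have hQ : q ^ L ≠ 0 := pow_ne_zero _ hq0
  have ht : (a * q ^ L)⁻¹ ≠ 0 := by positivity
  have hW1 : ∏ i, (1 - a * x i * q ^ (L + m i)) ≠ 0 :=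
    Finset.prod_ne_zero_iff.2 fun i _ => h.one_sub_ne hq i _
  have e1 : ∏ o' ∈ Finset.univ.erase none, (node q a x m L none - node q a x m L o') =
      (a * q ^ L)⁻¹ ^ (N + 1) * ∏ i, (1 - a * x i * q ^ (L + m i)) := by
    rw [prod_erase_eq_prod_ite, Fintype.prod_option]
    simp only [node, if_true, one_mul, reduceCtorEq, if_false]
    rw [prod_sub_eq_pow_mul ht, Fintype.card_fin]
    congr 1
    exact Finset.prod_congr rfl fun i _ => by rw [inv_inv, pow_add]; ring
  have e5 : ∏ j, (c j - node q a x m L none) =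
      (-1) ^ N * (a * q ^ L)⁻¹ ^ N * ∏ j, (1 - a * c j * q ^ L) := by
    have : ∀ j, c j - (a * q ^ L)⁻¹ = (-1) * ((a * q ^ L)⁻¹ - c j) := fun j => by ring
    simp only [node]
    rw [Finset.prod_congr rfl fun j _ => this j, Finset.prod_mul_distrib,
      prod_sub_eq_pow_mul ht, Fintype.card_fin, Finset.prod_const, Finset.card_univ,
      Fintype.card_fin, mul_assoc]
    congr 2
    exact Finset.prod_congr rfl fun i _ => by rw [inv_inv]; ring
  rw [e1, e5, Finset.prod_inv_distrib]
  generalize ∏ i, (1 - a * x i * q ^ (L + m i)) = W at *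
  have : (-1) ^ N * (a * q ^ L)⁻¹ ^ N * (∏ j, (1 - a * c j * q ^ L)) /
      ((a * q ^ L)⁻¹ ^ (N + 1) * W) = (-1) ^ N * (∏ j, (1 - a * c j * q ^ L)) * (a * q ^ L) * W⁻¹ := by
    rw [pow_succ (a * q ^ L)⁻¹ N]
    have := pow_ne_zero N ht
    have h2 : (a * q ^ L)⁻¹ * (a * q ^ L) = 1 := inv_mul_cancel₀ (mul_ne_zero ha hQ)
    generalize (a * q ^ L)⁻¹ ^ N = T at *
    rw [div_eq_iff (mul_ne_zero (mul_ne_zero this ht) ‹_›)]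
    field_simp
    exact Finset.prod_congr rfl fun i _ => by ring
  rw [this]
  field_simp

lemma summable_tele_none (hq0 : q ≠ 0) (hq : ‖q‖ < 1) (α β : ℂ) {z : ℂ} (hz : ‖z‖ < 1) {N : ℕ}
    {x : Fin (N + 1) → ℂ} (h : Generic q a x) (c : Fin N → ℂ) (b₀ b₁ b₂ : ℂ) :
    Summable fun m => tele q a α β z x c b₀ b₁ b₂ m none := by
  have hb : ∀ w, UBdd fun l : Fin (N + 1) → ℕ => bfac q a x w l (∑ i, l i + 1) := fun w =>
    (ubdd_bfac_const hq a x w).comp fun l => (l, ∑ i, l i + 1)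
  have h1 : UBdd fun m : Fin (N + 1) → ℕ => (-1) ^ N * a * z *
      ((core q a α β 1 x m (∑ i, m i + 1) *
      (∏ j, bfac q a x (c j) m (∑ i, m i + 1)) *
      (bfac q a x b₀ m (∑ i, m i + 1) * bfac q a x b₁ m (∑ i, m i + 1) *
      bfac q a x b₂ m (∑ i, m i + 1))) * ((∏ j, (1 - a * c j * q ^ (∑ i, m i + 1))) *
      ∏ i, (1 - a * x i * q ^ (∑ i, m i + 1 + m i))⁻¹)) := by
    refine (UBdd.const _).mul (UBdd.mul (UBdd.mul (UBdd.mul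
      ((ubdd_core hq α β h).comp fun l => (l, ∑ i, l i + 1)) (UBdd.prod _ fun j _ => hb _))
      (((hb _).mul (hb _)).mul (hb _))) (UBdd.mul (UBdd.prod _ fun j _ => ?_)
      (UBdd.prod _ fun i _ => ?_)))
    · exact (UBdd.const _).sub ((UBdd.const _).mul (ubdd_pow hq _))
    · exact ubdd_inv_one_sub hq (h.ax_ne i) _
  refine (summable_pow_mul_ubdd hz h1).congr fun m => ?_
  rw [tele_none_eq hq0 hq α β z h, core_eq_pow_mul q a α β z]
  ring

theorem threeTerm_tsum_kTerm (hq0 : q ≠ 0) (hq : ‖q‖ < 1) {α β : ℂ} (hα : α ≠ 0)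
    (hβ : β ≠ 0) {z : ℂ} (hz0 : z ≠ 0) (hz : ‖z‖ < 1) {N : ℕ} {x : Fin (N + 1) → ℂ}
    (h : Generic q a x) {c : Fin N → ℂ} (hc : ∀ j, c j ≠ 0) {b₀ b₁ b₂ : ℂ} (hb0 : b₀ ≠ 0)
    (hb1 : b₁ ≠ 0) (hb2 : b₂ ≠ 0)
    (hbal : (∏ j, c j) / (∏ i, x i) * (q ^ 3 * b₀ * b₁ * b₂) = z * α * β) :
    threeTerm q α β (fun b₀ b₁ b₂ => ∑' m, kTerm q a α β z x (Fin.cons b₀ c) b₁ b₂ m) b₀ b₁ b₂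
      = 0 := by
  have := threeTerm_tsum_serTerm hq0 hq hα hβ hz0 h hc hb0 hb1 hb2 hbal (fun b₀ b₁ b₂ _ _ _ => by
    simp only [serTerm_eq_kTerm]
    exact summable_kTerm hq α β hz h _ _ _) (summable_tele_none hq0 hq α β hz h c b₀ b₁ b₂)
  simpa only [serTerm_eq_kTerm] using this

end QRP

namespace QRP

open Filter Topology

/-! ### The regularized Jackson integral -/

/-- The regularization of `1 / (b t)_∞` at `t = q^(m+1) / β`. -/
noncomputable def jb (q α β b : ℂ) (m : ℕ) : ℂ := poch q (q * b / β) m * pochInf q (q * b / α)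

/-- The summand of the regularized Jackson integral. -/
noncomputable def jTerm (q α β : ℂ) {M : ℕ} (x : Fin M → ℂ) (c : ℂ) (b : Fin M → ℂ) (d e f : ℂ)
    (m : ℕ) : ℂ :=
  q ^ (m + 1) / β * (∏ i, pochInf q (x i * q ^ (m + 1) / β)) * pochInf q (c * q ^ (m + 1) / β) *
    pochInf q (α * q ^ (m + 1) / β) * pochInf q (q ^ (m + 1)) *
    (∏ j, jb q α β (b j) m) * (jb q α β d m * jb q α β e m * jb q α β f m)

/-- The regularized Jackson integral with base point `1 / β`. -/
noncomputable def jHalf (q α β : ℂ) {M : ℕ} (x : Fin M → ℂ) (c : ℂ) (b : Fin M → ℂ)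
    (d e f : ℂ) : ℂ := ∑' m, jTerm q α β x c b d e f m

/-- The regularized Jackson integral between `1 / α` and `1 / β`. -/
noncomputable def jFull (q α β : ℂ) {M : ℕ} (x : Fin M → ℂ) (c : ℂ) (b : Fin M → ℂ)
    (d e f : ℂ) : ℂ := jHalf q α β x c b d e f - jHalf q β α x c b d e f

variable {q : ℂ}

/-- At t = q^(m+1) / β, `jb` is (q b / α)_∞ (q b / β)_∞ / (b t)_∞ wherever this makes sense. The
shift b ↦ q b therefore brings out 1 - b t. -/
lemma jb_mul_left (hq : ‖q‖ < 1) (α β b : ℂ) (m : ℕ) :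
    jb q α β (q * b) m * ((1 - q * b / α) * (1 - q * b / β)) =
      jb q α β b m * (1 - b * q ^ (m + 1) / β) := by
  have h1 : (1 - q * b / β) * poch q (q * (q * b) / β) m =
      poch q (q * b / β) m * (1 - b * q ^ (m + 1) / β) := by
    have : q * (q * b) / β = q * b / β * q := by ring
    rw [this, ← poch_succ', poch_succ]
    congr 2
    ring
  have h2 := pochInf_eq_one_sub_mul hq (q * b / α)
  have h3 : q * (q * b) / α = q * (q * b / α) := by ring
  rw [jb, jb, h2, h3]
  linear_combination pochInf q (q * (q * b / α)) * (1 - q * b / α) * h1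

lemma jb_succ (q α β b : ℂ) (m : ℕ) :
    jb q α β b (m + 1) = jb q α β b m * (1 - b * q ^ (m + 1) / β) := by
  rw [jb, jb, poch_succ]
  ring

lemma ubdd_jb (hq : ‖q‖ < 1) (α β : ℂ) {ι : Type*} {b : ι → ℂ} (hb : UBdd b) :
    UBdd fun p : ι × ℕ => jb q α β (b p.1) p.2 := by
  simp only [jb, div_eq_mul_inv]
  exact (ubdd_poch hq (((UBdd.const q).mul (hb.comp _)).mul (UBdd.const _)) _).mul
    (ubdd_pochInf hq (((UBdd.const q).mul (hb.comp _)).mul (UBdd.const _)))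

lemma norm_jTerm_le (hq : ‖q‖ < 1) (α β : ℂ) {M : ℕ} {ι : Type*} {x : ι → Fin M → ℂ} {c : ι → ℂ}
    {b : ι → Fin M → ℂ} {d e f : ι → ℂ} (hx : ∀ i, UBdd fun k => x k i) (hc : UBdd c)
    (hb : ∀ i, UBdd fun k => b k i) (hd : UBdd d) (he : UBdd e) (hf : UBdd f) :
    ∃ C : ℝ, ∀ k m, ‖jTerm q α β (x k) (c k) (b k) (d k) (e k) (f k) m‖ ≤ ‖q‖ ^ m * C := by
  have hp : ∀ {y : ι → ℂ}, UBdd y →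
      UBdd fun p : ι × ℕ => pochInf q (y p.1 * q ^ (p.2 + 1) / β) := fun hy => by
    simp only [div_eq_mul_inv]
    exact ubdd_pochInf hq (((hy.comp _).mul (ubdd_pow hq _)).mul (UBdd.const _))
  have h : UBdd fun p : ι × ℕ => q / β * (∏ i, pochInf q (x p.1 i * q ^ (p.2 + 1) / β)) *
      pochInf q (c p.1 * q ^ (p.2 + 1) / β) *
      pochInf q (α * q ^ (p.2 + 1) / β) * pochInf q (q ^ (p.2 + 1)) *
      (∏ j, jb q α β (b p.1 j) p.2) *
      (jb q α β (d p.1) p.2 * jb q α β (e p.1) p.2 * jb q α β (f p.1) p.2) := by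
    exact (((((UBdd.const _).mul (UBdd.prod _ fun i _ => hp (hx i))).mul (hp hc)).mul
      (hp (UBdd.const α))).mul (ubdd_pochInf hq (ubdd_pow hq _))).mul
      (UBdd.prod _ fun j _ => ubdd_jb hq α β (hb j)) |>.mul
      (((ubdd_jb hq α β hd).mul (ubdd_jb hq α β he)).mul (ubdd_jb hq α β hf))
  obtain ⟨C, hC⟩ := h
  refine ⟨C, fun k m => ?_⟩
  rw [← norm_pow]
  refine le_trans (le_of_eq ?_) (mul_le_mul_of_nonneg_left (hC (k, m)) (norm_nonneg (q ^ m)))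
  rw [← norm_mul, jTerm]
  congr 1
  ring

lemma summable_jTerm (hq : ‖q‖ < 1) (α β : ℂ) {M : ℕ} (x : Fin M → ℂ) (c : ℂ) (b : Fin M → ℂ)
    (d e f : ℂ) : Summable (jTerm q α β x c b d e f) := by
  obtain ⟨C, hC⟩ := norm_jTerm_le hq α β (ι := Unit) (x := fun _ => x) (c := fun _ => c)
    (b := fun _ => b) (fun _ => UBdd.const _) (UBdd.const _) (fun _ => UBdd.const _)
    (UBdd.const d) (UBdd.const e) (UBdd.const f)
  exact ((summable_geometric_of_lt_one (norm_nonneg q) hq).mul_right C).of_norm_bounded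
    (hC ())

/-- By `jb_mul_left` each summand carries the factor (b_1 - b_2)(1 - b_0 t) + (b_2 - b_0)(1 - b_1 t)
+ (b_0 - b_1)(1 - b_2 t) = 0. No balancing is needed here. -/
lemma threeTerm_jHalf (hq : ‖q‖ < 1) (α β : ℂ) {N : ℕ} (x : Fin (N + 1) → ℂ) (k : ℂ)
    (c : Fin N → ℂ) (b₀ b₁ b₂ f : ℂ) :
    threeTerm q α β (fun b₀ b₁ b₂ => jHalf q α β x k (Fin.cons b₀ c) b₁ b₂ f) b₀ b₁ b₂ = 0 := by
  have hs := fun b₀ b₁ b₂ => summable_jTerm hq α β x k (Fin.cons b₀ c) b₁ b₂ f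
  simp only [threeTerm, jHalf]
  rw [← tsum_mul_left, ← tsum_mul_left, ← tsum_mul_left,
    ← ((hs _ _ _).mul_left _).tsum_add ((hs _ _ _).mul_left _),
    ← (((hs _ _ _).mul_left _).add ((hs _ _ _).mul_left _)).tsum_add ((hs _ _ _).mul_left _)]
  refine (tsum_congr fun m => ?_).trans tsum_zero
  simp only [jTerm, Fin.prod_univ_succ, Fin.cons_zero, Fin.cons_succ]
  have h0 := jb_mul_left hq α β b₀ m
  have h1 := jb_mul_left hq α β b₁ m
  have h2 := jb_mul_left hq α β b₂ m
  generalize (∏ j, jb q α β (c j) m) = A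
  generalize q ^ (m + 1) / β * _ * pochInf q (k * q ^ (m + 1) / β) *
    pochInf q (α * q ^ (m + 1) / β) * pochInf q (q ^ (m + 1)) = B
  linear_combination (b₁ - b₂) * (B * A * jb q α β b₁ m * jb q α β b₂ m * jb q α β f m) * h0 +
    (b₂ - b₀) * (B * A * jb q α β b₀ m * jb q α β b₂ m * jb q α β f m) * h1 +
    (b₀ - b₁) * (B * A * jb q α β b₀ m * jb q α β b₁ m * jb q α β f m) * h2

lemma threeTerm_swap (q α β : ℂ) (V : ℂ → ℂ → ℂ → ℂ) (b₀ b₁ b₂ : ℂ) :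
    threeTerm q β α V b₀ b₁ b₂ = threeTerm q α β V b₀ b₁ b₂ := by
  simp only [threeTerm]
  ring

lemma threeTerm_jFull (hq : ‖q‖ < 1) (α β : ℂ) {N : ℕ} (x : Fin (N + 1) → ℂ) (k : ℂ)
    (c : Fin N → ℂ) (b₀ b₁ b₂ f : ℂ) :
    threeTerm q α β (fun b₀ b₁ b₂ => jFull q α β x k (Fin.cons b₀ c) b₁ b₂ f) b₀ b₁ b₂ = 0 := by
  have h1 := threeTerm_jHalf hq α β x k c b₀ b₁ b₂ f
  have h2 := threeTerm_jHalf hq β α x k c b₀ b₁ b₂ f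
  rw [threeTerm_swap] at h2
  simp only [threeTerm, jFull] at *
  linear_combination h1 - h2

/-- The factors (w t)_∞ of numerator and denominator cancel; only the regularizing constants of `jb`
survive. -/
lemma jHalf_cons_cons (hq : ‖q‖ < 1) (α β w : ℂ) {N : ℕ} (x : Fin N → ℂ) (c : ℂ) (b : Fin N → ℂ)
    (d e f : ℂ) :
    jHalf q α β (Fin.cons w x) c (Fin.cons w b) d e f =
      pochInf q (q * w / α) * pochInf q (q * w / β) * jHalf q α β x c b d e f := by
  simp only [jHalf]
  rw [← tsum_mul_left]
  refine tsum_congr fun m => ?_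
  simp only [jTerm, Fin.prod_univ_succ, Fin.cons_zero, Fin.cons_succ]
  have h := pochInf_eq_poch_mul hq (q * w / β) m
  have h1 : q * w / β * q ^ m = w * q ^ (m + 1) / β := by ring
  rw [h1] at h
  rw [h, jb]
  ring

lemma jFull_cons_cons (hq : ‖q‖ < 1) (α β w : ℂ) {N : ℕ} (x : Fin N → ℂ) (c : ℂ) (b : Fin N → ℂ)
    (d e f : ℂ) :
    jFull q α β (Fin.cons w x) c (Fin.cons w b) d e f =
      pochInf q (q * w / α) * pochInf q (q * w / β) * jFull q α β x c b d e f := by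
  rw [jFull, jFull, jHalf_cons_cons hq, jHalf_cons_cons hq]
  ring

/-! ### Evaluation of the integral without `x`-parameters -/

section eval

variable (x b : Fin 0 → ℂ)

/-- The primitive of the contiguity relation for the integral without `x`-parameters. -/
noncomputable def jPrim (q α β c b₁ b₂ b₃ : ℂ) : ℕ → ℂ
  | 0 => 0
  | m + 1 => pochInf q (c * q ^ (m + 2) / β) * pochInf q (α * q ^ (m + 1) / β) *
      pochInf q (q ^ (m + 1)) * (poch q (q ^ 2 * b₁ / β) m * pochInf q (q ^ 2 * b₁ / α)) *
      (jb q α β b₂ (m + 1) * jb q α β b₃ (m + 1))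

/-- Under the balancing condition the contiguity relation has an explicit q-primitive, so its
failure for one half of the integral is a boundary term. -/
lemma jTerm_sub_eq (hq0 : q ≠ 0) (hq : ‖q‖ < 1) {α β : ℂ} (hα : α ≠ 0) (hβ : β ≠ 0) {b₂ b₃ : ℂ}
    (h2 : b₂ ≠ 0) (h3 : b₃ ≠ 0) {c b₁ : ℂ} (hc : c = q ^ 2 * b₁ * b₂ * b₃ / (α * β)) (m : ℕ) :
    jTerm q α β x c b b₁ b₂ b₃ m -
      (1 - c / b₂) * (1 - c / b₃) * jTerm q α β x (q * c) b (q * b₁) b₂ b₃ m =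
    c / (b₂ * b₃) *
      (jPrim q α β c b₁ b₂ b₃ m - jPrim q α β c b₁ b₂ b₃ (m + 1)) := by
  have e1 : pochInf q (c * q ^ (m + 1) / β) =
      (1 - c * q ^ (m + 1) / β) * pochInf q (c * q ^ (m + 2) / β) := by
    rw [pochInf_eq_one_sub_mul hq (c * q ^ (m + 1) / β)]
    congr 2
    ring
  have e2 : q * c * q ^ (m + 1) / β = c * q ^ (m + 2) / β := by ring
  have e3 : pochInf q (q * b₁ / α) = (1 - q * b₁ / α) * pochInf q (q ^ 2 * b₁ / α) := by
    rw [pochInf_eq_one_sub_mul hq (q * b₁ / α)]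
    congr 2
    ring
  have e4 : q * (q * b₁) / α = q ^ 2 * b₁ / α := by ring
  have e5 : q * (q * b₁) / β = q ^ 2 * b₁ / β := by ring
  simp only [jTerm, Finset.univ_eq_empty, Finset.prod_empty, mul_one]
  rcases m with _ | m
  -- At t = q / β the lower boundary value is zero, since it would contain (1)_∞. What remains is
  -- the identity of the general case at β t / q = 1, divided by 1 - b₁ t = 1 - q b₁ / β.
  · simp only [jPrim, jb_succ]
    have e8 : jb q α β b₁ 0 = (1 - q * b₁ / α) * pochInf q (q ^ 2 * b₁ / α) := by
      rw [jb, poch_zero, one_mul, e3]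
    have e9 : jb q α β (q * b₁) 0 = pochInf q (q ^ 2 * b₁ / α) := by
      rw [jb, poch_zero, one_mul, e4]
    rw [e1, e2, e8, e9]
    generalize pochInf q (c * q ^ (0 + 2) / β) = C0
    generalize pochInf q (α * q ^ (0 + 1) / β) = C1
    generalize pochInf q (q ^ (0 + 1)) = C2
    generalize pochInf q (q ^ 2 * b₁ / α) = C3
    generalize jb q α β b₂ 0 = C4
    generalize jb q α β b₃ 0 = C5
    simp only [poch_zero]
    have key : q / β * ((1 - c * q / β) * (1 - q * b₁ / α) - (1 - c / b₂) * (1 - c / b₃)) =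
        -(c / (b₂ * b₃)) * ((1 - b₂ * q / β) * (1 - b₃ * q / β)) := by
      rw [hc]
      field_simp
      ring
    linear_combination C0 * C1 * C2 * C3 * C4 * C5 * key
  · simp only [jPrim]
    have e6 : pochInf q (α * q ^ (m + 1) / β) =
        (1 - α * q ^ (m + 1) / β) * pochInf q (α * q ^ (m + 1 + 1) / β) := by
      rw [pochInf_eq_one_sub_mul hq (α * q ^ (m + 1) / β)]
      congr 2
      ring
    have e7 : pochInf q (q ^ (m + 1)) = (1 - q ^ (m + 1)) * pochInf q (q ^ (m + 1 + 1)) := by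
      rw [pochInf_eq_one_sub_mul hq (q ^ (m + 1))]
      congr 2
      ring
    have e8 : jb q α β b₁ (m + 1) = (1 - q * b₁ / β) * poch q (q ^ 2 * b₁ / β) m *
        ((1 - q * b₁ / α) * pochInf q (q ^ 2 * b₁ / α)) := by
      rw [jb, poch_succ', e3, show q * b₁ / β * q = q ^ 2 * b₁ / β by ring]
    have e9 : jb q α β (q * b₁) (m + 1) = poch q (q ^ 2 * b₁ / β) m *
        (1 - b₁ * q ^ (m + 2) / β) * pochInf q (q ^ 2 * b₁ / α) := by
      rw [jb, poch_succ, e4, e5]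
      congr 3
      ring
    have e10 : poch q (q ^ 2 * b₁ / β) (m + 1) = poch q (q ^ 2 * b₁ / β) m *
        (1 - b₁ * q ^ (m + 2) / β) := by
      rw [poch_succ]
      congr 2
      ring
    rw [e1, e2, e6, e7, e8, e9, e10, jb_succ q α β b₂ (m + 1), jb_succ q α β b₃ (m + 1)]
    generalize pochInf q (c * q ^ (m + 1 + 2) / β) = C0
    generalize pochInf q (α * q ^ (m + 1 + 1) / β) = C1
    generalize pochInf q (q ^ (m + 1 + 1)) = C2
    generalize pochInf q (q ^ 2 * b₁ / α) = C3
    generalize jb q α β b₂ (m + 1) = C4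
    generalize jb q α β b₃ (m + 1) = C5
    generalize poch q (q ^ 2 * b₁ / β) m = C6
    -- The whole relation reduces to this polynomial identity in t, used at t = q^(m+2) / β; the
    -- value of c enters only here.
    have key : ∀ t : ℂ, t * ((1 - c * t) * (1 - q * b₁ / α) * (1 - q * b₁ / β) -
        (1 - c / b₂) * (1 - c / b₃) * (1 - b₁ * t)) =
        c / (b₂ * b₃) * ((1 - c * t) * (1 - α * t / q) * (1 - β * t / q) -
        (1 - b₁ * t) * (1 - b₂ * t) * (1 - b₃ * t)) := by
      intro t
      rw [hc]
      field_simp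
      ring
    have key := key (q ^ (m + 2) / β)
    have k1 : α * (q ^ (m + 2) / β) / q = α * q ^ (m + 1) / β := by field_simp; ring
    have k2 : β * (q ^ (m + 2) / β) / q = q ^ (m + 1) := by field_simp; ring
    rw [k1, k2] at key
    linear_combination C0 * C1 * C2 * C3 * C4 * C5 * C6 * key

end eval

end QRP

/-! ### The Al-Salam–Verma integral, the case without x-parameters. -/

namespace QRP

open Filter Topology

variable {q : ℂ}

section eval

variable (x b : Fin 0 → ℂ)

lemma tendsto_mul_pow_div (hq : ‖q‖ < 1) (c β : ℂ) (k : ℕ) :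
    Tendsto (fun m : ℕ => c * q ^ (m + k) / β) atTop (𝓝 0) := by
  have h := ((tendsto_add_atTop_iff_nat k).2
    (tendsto_pow_atTop_nhds_zero_of_norm_lt_one hq)).const_mul (c / β)
  rw [mul_zero] at h
  exact h.congr fun m => by ring

lemma tendsto_pochInf_mul_pow_div (hq : ‖q‖ < 1) (c β : ℂ) (k : ℕ) :
    Tendsto (fun m : ℕ => pochInf q (c * q ^ (m + k) / β)) atTop (𝓝 1) := by
  have h := ((continuous_pochInf hq).tendsto 0).comp (tendsto_mul_pow_div hq c β k)
  rw [pochInf_zero] at h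
  exact h

lemma tendsto_jPrim (hq : ‖q‖ < 1) (α β c b₁ b₂ b₃ : ℂ) :
    Tendsto (jPrim q α β c b₁ b₂ b₃) atTop (𝓝 (
      pochInf q (q ^ 2 * b₁ / β) * pochInf q (q ^ 2 * b₁ / α) *
      ((pochInf q (q * b₂ / β) * pochInf q (q * b₂ / α)) *
      (pochInf q (q * b₃ / β) * pochInf q (q * b₃ / α))))) := by
  rw [← tendsto_add_atTop_iff_nat 1]
  have hj : ∀ b, Tendsto (fun m => jb q α β b (m + 1)) atTop
      (𝓝 (pochInf q (q * b / β) * pochInf q (q * b / α))) := fun b =>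
    ((tendsto_add_atTop_iff_nat 1).2 (tendsto_poch hq _)).mul_const _
  have h := ((((tendsto_pochInf_mul_pow_div hq c β 2).mul
    (tendsto_pochInf_mul_pow_div hq α β 1)).mul (tendsto_pochInf_mul_pow_div hq 1 1 1)).mul
    ((tendsto_poch hq (q ^ 2 * b₁ / β)).mul_const (pochInf q (q ^ 2 * b₁ / α)))).mul
    ((hj b₂).mul (hj b₃))
  simp only [one_mul, div_one] at h
  exact h

lemma tsum_sub_succ {f : ℕ → ℂ} {L : ℂ} (hf : Tendsto f atTop (𝓝 L))
    (hs : Summable fun m => f m - f (m + 1)) : ∑' m, (f m - f (m + 1)) = f 0 - L := by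
  refine tendsto_nhds_unique hs.hasSum.tendsto_sum_nat ?_
  simp only [Finset.sum_range_sub']
  exact hf.const_sub _

/-- The right-hand side is symmetric in α and β. It therefore drops out of the difference of the two
halves. -/
lemma jHalf_sub_eq (hq0 : q ≠ 0) (hq : ‖q‖ < 1) {α β : ℂ} (hα : α ≠ 0) (hβ : β ≠ 0) {b₁ b₂ b₃ : ℂ}
    (h1 : b₁ ≠ 0) (h2 : b₂ ≠ 0) (h3 : b₃ ≠ 0) {c : ℂ} (hc : c = q ^ 2 * b₁ * b₂ * b₃ / (α * β)) :
    jHalf q α β x c b b₁ b₂ b₃ -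
      (1 - c / b₂) * (1 - c / b₃) * jHalf q α β x (q * c) b (q * b₁) b₂ b₃ =
    -(c / (b₂ * b₃) * (pochInf q (q ^ 2 * b₁ / β) * pochInf q (q ^ 2 * b₁ / α) *
      ((pochInf q (q * b₂ / β) * pochInf q (q * b₂ / α)) *
      (pochInf q (q * b₃ / β) * pochInf q (q * b₃ / α))))) := by
  have hs1 := summable_jTerm hq α β x c b b₁ b₂ b₃
  have hs2 := (summable_jTerm hq α β x (q * c) b (q * b₁) b₂ b₃).mul_left
    ((1 - c / b₂) * (1 - c / b₃))
  have hc0 : c / (b₂ * b₃) ≠ 0 := by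
    rw [hc]
    positivity
  have hs := hs1.sub hs2
  rw [jHalf, jHalf, ← tsum_mul_left, ← hs1.tsum_sub hs2]
  simp only [jTerm_sub_eq x b hq0 hq hα hβ h2 h3 hc] at hs ⊢
  rw [summable_mul_left_iff hc0] at hs
  rw [tsum_mul_left, tsum_sub_succ (tendsto_jPrim hq α β c b₁ b₂ b₃) hs]
  simp only [jPrim]
  ring

lemma jFull_eq (hq0 : q ≠ 0) (hq : ‖q‖ < 1) {α β : ℂ} (hα : α ≠ 0) (hβ : β ≠ 0) {b₁ b₂ b₃ : ℂ}
    (h1 : b₁ ≠ 0) (h2 : b₂ ≠ 0) (h3 : b₃ ≠ 0) {c : ℂ} (hc : c = q ^ 2 * b₁ * b₂ * b₃ / (α * β)) :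
    jFull q α β x c b b₁ b₂ b₃ =
      (1 - c / b₂) * (1 - c / b₃) * jFull q α β x (q * c) b (q * b₁) b₂ b₃ := by
  have e1 := jHalf_sub_eq x b hq0 hq hα hβ h1 h2 h3 hc
  have e2 := jHalf_sub_eq x b hq0 hq hβ hα h1 h2 h3 (c := c) (by rw [hc, mul_comm α])
  rw [jFull, jFull]
  linear_combination e1 - e2

lemma jFull_rotate (α β c b₁ b₂ b₃ : ℂ) :
    jFull q α β x c b b₁ b₂ b₃ = jFull q α β x c b b₂ b₃ b₁ := by
  simp only [jFull, jHalf, jTerm]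
  congr 1 <;> exact tsum_congr fun m => by ring

/-- Each of the three contiguity steps multiplies c and one b by q and keeps the balance. Going once
around produces two factors for each quotient c / b_i, which itself becomes q² c / b_i. -/
lemma jFull_eq_shift_all (hq0 : q ≠ 0) (hq : ‖q‖ < 1) {α β : ℂ} (hα : α ≠ 0) (hβ : β ≠ 0)
    {b₁ b₂ b₃ : ℂ} (h1 : b₁ ≠ 0) (h2 : b₂ ≠ 0) (h3 : b₃ ≠ 0) {c : ℂ}
    (hc : c = q ^ 2 * b₁ * b₂ * b₃ / (α * β)) :
    jFull q α β x c b b₁ b₂ b₃ =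
      (poch q (c / b₁) 2 * poch q (c / b₂) 2 * poch q (c / b₃) 2) *
        jFull q α β x (q ^ 3 * c) b (q * b₁) (q * b₂) (q * b₃) := by
  have g1 := mul_ne_zero hq0 h1
  have g2 := mul_ne_zero hq0 h2
  rw [jFull_eq x b hq0 hq hα hβ h1 h2 h3 hc, jFull_rotate,
    jFull_eq x b hq0 hq hα hβ h2 h3 g1 (by rw [hc]; ring), jFull_rotate,
    jFull_eq x b hq0 hq hα hβ h3 g1 g2 (by rw [hc]; ring), jFull_rotate]
  simp only [poch, Finset.prod_range_succ, Finset.prod_range_zero]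
  have k1 : q * c / (q * b₁) = c / b₁ := by field_simp
  have k2 : q * (q * c) / (q * b₁) = c / b₁ * q := by field_simp
  have k3 : q * (q * c) / (q * b₂) = c / b₂ * q := by field_simp
  have k4 : q * (q * (q * c)) = q ^ 3 * c := by ring
  rw [k1, k2, k3, k4]
  ring

lemma jFull_eq_shift_pow (hq0 : q ≠ 0) (hq : ‖q‖ < 1) {α β : ℂ} (hα : α ≠ 0) (hβ : β ≠ 0)
    {b₁ b₂ b₃ : ℂ} (h1 : b₁ ≠ 0) (h2 : b₂ ≠ 0) (h3 : b₃ ≠ 0) {c : ℂ}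
    (hc : c = q ^ 2 * b₁ * b₂ * b₃ / (α * β)) (n : ℕ) :
    jFull q α β x c b b₁ b₂ b₃ =
      (poch q (c / b₁) (2 * n) * poch q (c / b₂) (2 * n) * poch q (c / b₃) (2 * n)) *
        jFull q α β x (q ^ (3 * n) * c) b (q ^ n * b₁) (q ^ n * b₂) (q ^ n * b₃) := by
  induction n with
  | zero => simp
  | succ n ih =>
    have hQ := pow_ne_zero n hq0
    rw [ih, jFull_eq_shift_all x b hq0 hq hα hβ (mul_ne_zero hQ h1) (mul_ne_zero hQ h2)
      (mul_ne_zero hQ h3) (by rw [hc]; ring)]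
    have k : ∀ {w : ℂ}, w ≠ 0 → poch q (c / w) (2 * (n + 1)) =
        poch q (c / w) (2 * n) * poch q (q ^ (3 * n) * c / (q ^ n * w)) 2 := by
      intro w hw
      rw [show 2 * (n + 1) = 2 * n + 2 by ring, poch_add]
      congr 2
      field_simp
      ring
    rw [k h1, k h2, k h3]
    have k2 : q ^ 3 * (q ^ (3 * n) * c) = q ^ (3 * (n + 1)) * c := by ring
    have k3 : ∀ w, q * (q ^ n * w) = q ^ (n + 1) * w := fun w => by ring
    rw [k2, k3, k3, k3]
    ring

lemma tendsto_jHalf (hq : ‖q‖ < 1) (α β : ℂ) {c b₁ b₂ b₃ : ℕ → ℂ}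
    (hc : Tendsto c atTop (𝓝 0)) (h1 : Tendsto b₁ atTop (𝓝 0)) (h2 : Tendsto b₂ atTop (𝓝 0))
    (h3 : Tendsto b₃ atTop (𝓝 0)) :
    Tendsto (fun n => jHalf q α β x (c n) b (b₁ n) (b₂ n) (b₃ n)) atTop
      (𝓝 (jHalf q α β x 0 b 0 0 0)) := by
  have hu : ∀ {f : ℕ → ℂ}, Tendsto f atTop (𝓝 0) → UBdd f := fun {f} hf => by
    obtain ⟨C, hC⟩ := (Metric.isBounded_range_of_tendsto f hf).exists_norm_le
    exact ⟨C, fun i => hC _ ⟨i, rfl⟩⟩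
  obtain ⟨C, hC⟩ := norm_jTerm_le hq α β (x := fun _ => x) (b := fun _ => b)
    (fun _ => UBdd.const _) (hu hc) (fun _ => UBdd.const _) (hu h1) (hu h2) (hu h3)
  refine tendsto_tsum_of_dominated_convergence
    ((summable_geometric_of_lt_one (norm_nonneg q) hq).mul_right C) (fun m => ?_)
    (Eventually.of_forall fun n m => hC n m)
  have hj : ∀ {f : ℕ → ℂ}, Tendsto f atTop (𝓝 0) →
      Tendsto (fun n => jb q α β (f n) m) atTop (𝓝 (jb q α β 0 m)) := fun {f} hf => by
    have hcont : Continuous fun w => jb q α β w m := by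
      unfold jb
      exact ((continuous_poch q m).comp (by fun_prop)).mul
        ((continuous_pochInf hq).comp (by fun_prop))
    exact (hcont.tendsto 0).comp hf
  have hp : Tendsto (fun n => pochInf q (c n * q ^ (m + 1) / β)) atTop
      (𝓝 (pochInf q (0 * q ^ (m + 1) / β))) := by
    have hcont : Continuous fun w => pochInf q (w * q ^ (m + 1) / β) :=
      (continuous_pochInf hq).comp (by fun_prop)
    exact (hcont.tendsto 0).comp hc
  simp only [jTerm]
  exact ((((hp.const_mul _).mul_const _).mul_const _).mul_const _).mul
    (((hj h1).mul (hj h2)).mul (hj h3))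

/-- Iterating the shift sends c and all b's to zero, and dominated convergence identifies the limit.
-/
lemma jFull_eq_const_mul (hq0 : q ≠ 0) (hq : ‖q‖ < 1) {α β : ℂ} (hα : α ≠ 0) (hβ : β ≠ 0)
    {b₁ b₂ b₃ : ℂ} (h1 : b₁ ≠ 0) (h2 : b₂ ≠ 0) (h3 : b₃ ≠ 0) {c : ℂ}
    (hc : c = q ^ 2 * b₁ * b₂ * b₃ / (α * β)) :
    jFull q α β x c b b₁ b₂ b₃ =
      pochInf q (c / b₁) * pochInf q (c / b₂) * pochInf q (c / b₃) *
        jFull q α β x 0 b 0 0 0 := by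
  have hp := tendsto_pow_atTop_nhds_zero_of_norm_lt_one hq
  have hb : ∀ w : ℂ, Tendsto (fun n : ℕ => q ^ n * w) atTop (𝓝 0) := fun w => by
    simpa using hp.mul_const w
  have h3n : Tendsto (fun n : ℕ => 3 * n) atTop atTop :=
    tendsto_id.const_mul_atTop' (by norm_num)
  have h2n : Tendsto (fun n : ℕ => 2 * n) atTop atTop :=
    tendsto_id.const_mul_atTop' (by norm_num)
  have hcc : Tendsto (fun n : ℕ => q ^ (3 * n) * c) atTop (𝓝 0) := by
    simpa using (hp.comp h3n).mul_const c
  have hk : ∀ w, Tendsto (fun n => poch q w (2 * n)) atTop (𝓝 (pochInf q w)) := fun w =>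
    (tendsto_poch hq w).comp h2n
  have hlim := (((hk (c / b₁)).mul (hk (c / b₂))).mul (hk (c / b₃))).mul
    ((tendsto_jHalf x b hq α β hcc (hb b₁) (hb b₂) (hb b₃)).sub
    (tendsto_jHalf x b hq β α hcc (hb b₁) (hb b₂) (hb b₃)))
  refine tendsto_nhds_unique ?_ hlim
  refine tendsto_const_nhds.congr fun n => ?_
  exact jFull_eq_shift_pow x b hq0 hq hα hβ h1 h2 h3 hc n

/-- For b₁ = β / q one has (q b₁ / β)_m = (1)_m, which kills all terms but m = 0 in one half, and
the factor (1)_∞ kills the other half. -/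
lemma jFull_of_eq_div (hq0 : q ≠ 0) (hq : ‖q‖ < 1) {α β : ℂ} (hα : α ≠ 0) (hβ : β ≠ 0)
    (c b₂ b₃ : ℂ) :
    jFull q α β x c b (β / q) b₂ b₃ = q / β * pochInf q (c * q / β) * pochInf q (α * q / β) *
      pochInf q q * (pochInf q (β / α) * pochInf q (q * b₂ / α) * pochInf q (q * b₃ / α)) := by
  have k1 : q * (β / q) / β = 1 := by field_simp
  have k2 : q * (β / q) / α = β / α := by field_simp
  have h1 : pochInf q (1 : ℂ) = 0 := pochInf_eq_zero hq (i := 0) (by simp)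
  have e1 : jHalf q β α x c b (β / q) b₂ b₃ = 0 := by
    rw [jHalf]
    refine (tsum_congr fun m => ?_).trans tsum_zero
    simp only [jTerm]
    rw [jb, k1, h1]
    ring
  rw [jFull, e1, sub_zero, jHalf, tsum_eq_single 0]
  · simp only [jTerm, jb, k2, poch_zero, Finset.univ_eq_empty, Finset.prod_empty, zero_add, pow_one]
    ring
  · intro m hm
    obtain ⟨m, rfl⟩ := Nat.exists_eq_succ_of_ne_zero hm
    simp only [jTerm]
    rw [jb, k1, poch_succ']
    ring

/-- The constant does not depend on the b's, so it is read off from the special case b₁ = β / q, b₂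
= α q^n, b₃ = α, where the integral is a single term. -/
lemma jFull_zero (hq0 : q ≠ 0) (hq : ‖q‖ < 1) {α β : ℂ} (hα : α ≠ 0) (hβ : β ≠ 0) :
    jFull q α β x 0 b 0 0 0 =
      q / β * pochInf q (α * q / β) * pochInf q q * pochInf q (β / α) := by
  have hlim := tendsto_pochInf_mul_pow hq (q ^ 2 * α / β)
  -- The factor (c / b₁)_∞ = (q² α q^n / β)_∞ may vanish for small n; it tends to 1, so some n
  -- allows the division.
  obtain ⟨n, hn⟩ := (hlim.eventually_ne one_ne_zero).exists
  have hQ := pow_ne_zero n hq0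
  have hqq : pochInf q q ≠ 0 := pochInf_ne_zero hq fun i h => by
    have h1 : ‖q * q ^ i‖ < 1 := by
      rw [← pow_succ', norm_pow]
      exact pow_lt_one₀ (norm_nonneg _) hq (by omega)
    rw [← sub_eq_zero.1 h, norm_one] at h1
    exact lt_irrefl _ h1
  have hc : q * (α * q ^ n) = q ^ 2 * (β / q) * (α * q ^ n) * α / (α * β) := by field_simp
  have e1 := jFull_eq_const_mul x b hq0 hq hα hβ (div_ne_zero hβ hq0) (mul_ne_zero hα hQ) hα hc
  rw [jFull_of_eq_div x b hq0 hq hα hβ] at e1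
  have k1 : q * (α * q ^ n) / (β / q) = q ^ 2 * α / β * q ^ n := by field_simp
  have k2 : q * (α * q ^ n) / (α * q ^ n) = q := by field_simp
  have k3 : q * (α * q ^ n) / α = q * q ^ n := by field_simp
  have k4 : q * (α * q ^ n) * q / β = q ^ 2 * α / β * q ^ n := by field_simp
  have k5 : q * α / α = q := by field_simp
  rw [k1, k2, k3, k4, k5] at e1
  have h3 := pochInf_mul_pow_ne_zero hq hqq n
  have := mul_ne_zero (mul_ne_zero hn hqq) h3
  refine mul_left_cancel₀ this ?_
  rw [← e1]
  ring

/-- The multiple series is one term here, with a q d = c / e and a q e = c / d for a = q f / (α β).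
-/
lemma jFull_zero_eval (hq0 : q ≠ 0) (hq : ‖q‖ < 1) {α β : ℂ} (hα : α ≠ 0) (hβ : β ≠ 0)
    (hαβ : α ≠ β) {c d e f : ℂ} (hd : d ≠ 0) (he : e ≠ 0) (hf : f ≠ 0)
    (hbal : c * α * β = q ^ 2 * (d * e * f)) :
    jFull q α β x c b d e f = q * pochInf q q * pochInf q (c / f) *
      (pochInf q (α / β) * pochInf q (β / α) / (β - α)) *
      ∑' l, kTerm q (q * f / (α * β)) α β (c / f) x b d e l := by
  have hc : c = q ^ 2 * d * e * f / (α * β) := by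
    rw [eq_div_iff (mul_ne_zero hα hβ)]
    linear_combination hbal
  have hs : β - α ≠ 0 := sub_ne_zero.2 hαβ.symm
  rw [jFull_eq_const_mul x b hq0 hq hα hβ hd he hf hc, jFull_zero x b hq0 hq hα hβ,
    tsum_eq_single default fun l hl => (hl (Subsingleton.elim _ _)).elim]
  simp only [kTerm, core, bfac, vandermonde, Finset.univ_eq_empty, Finset.prod_empty,
    Finset.sum_empty, pow_zero, poch_zero, mul_one, one_mul, div_one]
  have k1 : q * f / (α * β) * q * d = c / e := by rw [hc]; field_simp
  have k2 : q * f / (α * β) * q * e = c / d := by rw [hc]; field_simp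
  rw [k1, k2, pochInf_eq_one_sub_mul hq (α / β)]
  have k3 : q * (α / β) = α * q / β := by ring
  have k4 : 1 - α / β = (β - α) / β := by field_simp
  rw [k3, k4]
  field_simp

end eval

end QRP

namespace QRP

open Filter Topology

variable {q a : ℂ}

/-! ### Reduction of the number of variables -/

lemma vandermonde_cons {M : ℕ} (w : ℂ) (x : Fin M → ℂ) :
    vandermonde (Fin.cons w x : Fin (M + 1) → ℂ) = (∏ j, (w - x j)) * vandermonde x := by
  simp only [vandermonde, Fin.prod_univ_succ, Fin.prod_Ioi_zero, Fin.prod_Ioi_succ, Fin.cons_zero,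
    Fin.cons_succ]

lemma Generic.tail {M : ℕ} {w : ℂ} {x : Fin M → ℂ}
    (h : Generic q a (Fin.cons w x : Fin (M + 1) → ℂ)) : Generic q a x where
  a_ne := h.a_ne
  x_ne i := by simpa using h.x_ne i.succ
  ax_ne i := by simpa using h.ax_ne i.succ
  ratio_ne i j n := by simpa using h.ratio_ne i.succ j.succ n
  inj i j hij := by simpa using h.inj i.succ j.succ (by simpa using hij)

/-- For l_1 = 0 the extra factors of the Vandermonde quotient, of (x_i / w)_{l_i} and of (q x_i /
w)_{l_i} cancel, as do those containing a w. -/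
lemma kTerm_cons_cons (hq : ‖q‖ < 1) (α β z : ℂ) {M : ℕ} {w : ℂ} {x : Fin M → ℂ}
    (h : Generic q a (Fin.cons w x : Fin (M + 1) → ℂ)) (b : Fin M → ℂ) (d e : ℂ)
    (l : Fin M → ℕ) :
    kTerm q a α β z (Fin.cons w x) (Fin.cons w b) d e (Fin.cons 0 l) =
      pochInf q (q * w / α) * pochInf q (q * w / β) * kTerm q a α β z x b d e l := by
  have hw : w ≠ 0 := by simpa using h.x_ne 0
  have h1 : ∏ i, (w - x i) ≠ 0 := Finset.prod_ne_zero_iff.2 fun i _ =>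
    sub_ne_zero.2 (by simpa using h.inj 0 i.succ (Fin.succ_ne_zero i).symm)
  have h2 : ∏ i, poch q (q * x i / w) (l i) ≠ 0 := Finset.prod_ne_zero_iff.2 fun i _ =>
    poch_ne_zero fun n _ => sub_ne_zero.2 (by simpa using (h.ratio_ne i.succ 0 n).symm)
  have h3 : (∏ i, (w - x i * q ^ l i)) * ∏ i, poch q (x i / w) (l i) =
      (∏ i, (w - x i)) * ∏ i, poch q (q * x i / w) (l i) := by
    rw [← Finset.prod_mul_distrib, ← Finset.prod_mul_distrib]
    refine Finset.prod_congr rfl fun i _ => ?_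
    have e1 := poch_succ q (x i / w) (l i)
    rw [poch_succ', show x i / w * q = q * x i / w by ring] at e1
    have e2 : w - x i * q ^ l i = w * (1 - x i / w * q ^ l i) := by field_simp
    have e3 : w - x i = w * (1 - x i / w) := by field_simp
    rw [e2, e3]
    linear_combination -w * e1
  set Λ := ∑ i, l i with hΛ
  have h4 : pochInf q (a * w * q ^ Λ) ≠ 0 := by
    simpa using pochInf_mul_pow_ne_zero hq (h.ax_ne 0) Λ
  have h5 : pochInf q (a * w * q ^ Λ) = (1 - a * w * q ^ Λ) * pochInf q (a * q * w * q ^ Λ) := by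
    rw [pochInf_eq_one_sub_mul hq]
    congr 2
    ring
  have hvd : (fun i => (Fin.cons w x : Fin (M + 1) → ℂ) i *
      q ^ (Fin.cons 0 l : Fin (M + 1) → ℕ) i) = Fin.cons w fun i => x i * q ^ l i := by
    funext i
    refine Fin.cases ?_ (fun i => ?_) i <;> simp
  simp only [kTerm, core, bfac]
  rw [hvd, vandermonde_cons, vandermonde_cons]
  simp only [Fin.prod_univ_succ, Fin.cons_zero, Fin.cons_succ, Fin.sum_univ_succ, zero_add, ← hΛ,
    poch_zero, one_mul, mul_one, pow_zero, Finset.prod_const_one, add_zero]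
  have h6 : ∏ i, ((1 - a * x i * q ^ (Λ + l i)) *
      (pochInf q (q * x i / α * q ^ l i) * pochInf q (q * x i / β * q ^ l i)) /
      (pochInf q (a * x i * q ^ Λ) *
        (poch q (q * x i / w) (l i) * ∏ j, poch q (q * x i / x j) (l i)))) =
      (∏ i, ((1 - a * x i * q ^ (Λ + l i)) *
      (pochInf q (q * x i / α * q ^ l i) * pochInf q (q * x i / β * q ^ l i)) /
      (pochInf q (a * x i * q ^ Λ) * ∏ j, poch q (q * x i / x j) (l i)))) *
        (∏ i, poch q (q * x i / w) (l i))⁻¹ := by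
    rw [← Finset.prod_inv_distrib, ← Finset.prod_mul_distrib]
    refine Finset.prod_congr rfl fun i _ => ?_
    simp only [div_eq_mul_inv, mul_inv]
    ring
  rw [h6]
  generalize (∏ i, ((1 - a * x i * q ^ (Λ + l i)) *
      (pochInf q (q * x i / α * q ^ l i) * pochInf q (q * x i / β * q ^ l i)) /
      (pochInf q (a * x i * q ^ Λ) * ∏ j, poch q (q * x i / x j) (l i)))) = A
  generalize (∏ j, (pochInf q (a * q * b j * q ^ Λ) * ∏ i, poch q (x i / b j) (l i))) = B
  rw [h5] at h4 ⊢
  have h7 := left_ne_zero_of_mul h4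
  have h8 := right_ne_zero_of_mul h4
  generalize pochInf q (a * q * w * q ^ Λ) = C1 at *
  generalize 1 - a * w * q ^ Λ = C2 at *
  generalize (∏ i, (w - x i * q ^ l i)) = D1 at *
  generalize (∏ i, poch q (x i / w) (l i)) = D2 at *
  generalize (∏ i, (w - x i)) = D3 at *
  generalize (∏ i, poch q (q * x i / w) (l i)) = D4 at *
  have h9 : D1 * D2 / (D3 * D4) = 1 := by
    rw [h3, div_self (mul_ne_zero h1 h2)]
  have h10 : D1 * vandermonde (fun i => x i * q ^ l i) / (D3 * vandermonde x) =
      D1 / D3 * (vandermonde (fun i => x i * q ^ l i) / vandermonde x) := by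
    rw [mul_div_mul_comm]
  rw [h10]
  generalize vandermonde (fun i => x i * q ^ l i) / vandermonde x = V
  have h11 : D1 / D3 * D4⁻¹ * D2 = 1 := by
    rw [← h9]; field_simp
  have h12 : C2 / (C2 * C1) * C1 = 1 := by field_simp
  have h13 : C2 * (pochInf q (q * w / α) * pochInf q (q * w / β)) / (C2 * C1) =
      C2 / (C2 * C1) * (pochInf q (q * w / α) * pochInf q (q * w / β)) := by ring
  rw [h13]
  generalize pochInf q (a * q * d * q ^ Λ) * ∏ i, poch q (x i / d) (l i) = E1
  generalize pochInf q (a * q * e * q ^ Λ) * ∏ i, poch q (x i / e) (l i) = E2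
  generalize pochInf q (q * w / α) * pochInf q (q * w / β) = E3
  generalize poch q (a * β) Λ * poch q (a * α) Λ = E4
  calc _ = (D1 / D3 * D4⁻¹ * D2) * (C2 / (C2 * C1) * C1) *
        (E3 * (z ^ Λ * V * A * E4 * B * (E1 * E2))) := by ring
    _ = _ := by rw [h11, h12, one_mul, one_mul]

/-- The factor (w / w)_{l_1} vanishes unless l_1 = 0, so the series lives on a face of the lattice.
-/
lemma tsum_kTerm_cons_cons (hq : ‖q‖ < 1) (α β z : ℂ) {M : ℕ} {w : ℂ} {x : Fin M → ℂ}
    (h : Generic q a (Fin.cons w x : Fin (M + 1) → ℂ)) (b : Fin M → ℂ) (d e : ℂ) :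
    ∑' l, kTerm q a α β z (Fin.cons w x) (Fin.cons w b) d e l =
      pochInf q (q * w / α) * pochInf q (q * w / β) * ∑' l, kTerm q a α β z x b d e l := by
  have hw : w ≠ 0 := by simpa using h.x_ne 0
  have hinj : Function.Injective fun l : Fin M → ℕ => (Fin.cons 0 l : Fin (M + 1) → ℕ) :=
    Fin.cons_right_injective (α := fun _ => ℕ) 0
  rw [← tsum_mul_left, ← hinj.tsum_eq]
  · exact tsum_congr fun l => kTerm_cons_cons hq α β z h b d e l
  · intro l hl
    refine ⟨Fin.tail l, ?_⟩
    suffices h0 : l 0 = 0 by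
      show Fin.cons 0 (Fin.tail l) = l
      rw [← h0, Fin.cons_self_tail]
    by_contra h0
    obtain ⟨n, hn⟩ := Nat.exists_eq_succ_of_ne_zero h0
    refine hl ?_
    have h1 : poch q (w / w) (l 0) = 0 := by
      rw [hn, poch_succ', div_self hw, sub_self, zero_mul]
    simp only [kTerm, Fin.prod_univ_succ, Fin.cons_zero, bfac, h1]
    ring

/-- The expansion of the regularized Jackson integral as a multiple series. -/
def HasExpansion (q α β : ℂ) {M : ℕ} (x : Fin M → ℂ) (c : ℂ) (b : Fin M → ℂ) (d e f : ℂ) : Prop :=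
  jFull q α β x c b d e f = q * pochInf q q * pochInf q (c / f) *
    (pochInf q (α / β) * pochInf q (β / α) / (β - α)) *
    ∑' l, kTerm q (q * f / (α * β)) α β (c / f) x b d e l

lemma HasExpansion.cons {α β : ℂ} (hq : ‖q‖ < 1) {M : ℕ} {w : ℂ} {x : Fin M → ℂ} {c d e f : ℂ}
    {b : Fin M → ℂ} (h : HasExpansion q α β x c b d e f)
    (hx : Generic q (q * f / (α * β)) (Fin.cons w x : Fin (M + 1) → ℂ)) :
    HasExpansion q α β (Fin.cons w x : Fin (M + 1) → ℂ) c (Fin.cons w b) d e f := by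
  rw [HasExpansion] at *
  rw [jFull_cons_cons hq, h, tsum_kTerm_cons_cons hq α β _ hx]
  ring

/-- Both sides satisfy the same three-term relation in (w, d, e). The expansions with d or e shifted
therefore give the one with w shifted, provided that its coefficient (d - e)(1 - q w / α)(1 - q w /
β) is not zero. -/
lemma HasExpansion.shift (hq0 : q ≠ 0) (hq : ‖q‖ < 1) {α β : ℂ} (hα : α ≠ 0) (hβ : β ≠ 0)
    {N : ℕ} {x : Fin (N + 1) → ℂ} {c f : ℂ} (hc : c ≠ 0) (hf : f ≠ 0) (hcf : ‖c / f‖ < 1)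
    (hx : Generic q (q * f / (α * β)) x) {b : Fin N → ℂ} (hb : ∀ j, b j ≠ 0) {w d e : ℂ}
    (hw : w ≠ 0) (hd : d ≠ 0) (he : e ≠ 0) (hde : d ≠ e) (hwα : 1 - q * w / α ≠ 0)
    (hwβ : 1 - q * w / β ≠ 0)
    (hbal : (∏ i, x i) * (c * α * β) = q ^ 2 * (∏ j, b j) * (q * w * d * e * f))
    (h1 : HasExpansion q α β x c (Fin.cons w b) (q * d) e f)
    (h2 : HasExpansion q α β x c (Fin.cons w b) d (q * e) f) :
    HasExpansion q α β x c (Fin.cons (q * w) b) d e f := by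
  have hX : ∏ i, x i ≠ 0 := Finset.prod_ne_zero_iff.2 fun i _ => hx.x_ne i
  have t1 := threeTerm_jFull hq α β x c b w d e f
  have t2 := threeTerm_tsum_kTerm hq0 hq hα hβ (div_ne_zero hc hf) hcf hx hb hw hd he (by
    field_simp
    linear_combination -hbal)
  simp only [threeTerm] at t1 t2
  rw [HasExpansion] at *
  rw [h1, h2] at t1
  have hco := mul_ne_zero (sub_ne_zero.2 hde) (mul_ne_zero hwα hwβ)
  refine mul_left_cancel₀ hco ?_
  linear_combination t1 - q * pochInf q q * pochInf q (c / f) *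
    (pochInf q (α / β) * pochInf q (β / α) / (β - α)) * t2

/-- Each shift of b_1 is traded for one of d or e, down to b_1 = x_1 = w, where the pair cancels.
Excluding d ∈ e q^ℤ keeps all the coefficients d - e on the way nonzero. -/
lemma hasExpansion_of_eq_mul_pow (hq0 : q ≠ 0) (hq : ‖q‖ < 1) {α β : ℂ} (hα : α ≠ 0) (hβ : β ≠ 0)
    {N : ℕ} {w : ℂ} {x : Fin N → ℂ} {c f : ℂ} (hc : c ≠ 0) (hf : f ≠ 0) (hcf : ‖c / f‖ < 1)
    (hx : Generic q (q * f / (α * β)) (Fin.cons w x : Fin (N + 1) → ℂ))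
    (hwα : pochInf q (q * w / α) ≠ 0) (hwβ : pochInf q (q * w / β) ≠ 0)
    {b : Fin N → ℂ} (hb : ∀ j, b j ≠ 0)
    (ih : ∀ {d e : ℂ}, d ≠ 0 → e ≠ 0 →
      (∏ i, x i) * (c * α * β) = q ^ 2 * (∏ j, b j) * (d * e * f) →
      HasExpansion q α β x c b d e f) (n : ℕ) {d e : ℂ} (hd : d ≠ 0) (he : e ≠ 0)
    (hde : ∀ k : ℤ, d ≠ e * q ^ k)
    (hbal : (∏ i, x i) * (c * α * β) = q ^ 2 * (∏ j, b j) * (q ^ n * d * e * f)) :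
    HasExpansion q α β (Fin.cons w x : Fin (N + 1) → ℂ) c (Fin.cons (q ^ n * w) b) d e f := by
  have hw : w ≠ 0 := by simpa using hx.x_ne 0
  induction n generalizing d e with
  | zero =>
    rw [pow_zero, one_mul]
    exact (ih hd he (by rw [hbal]; ring)).cons hq hx
  | succ n IH =>
    have h1 : ∀ {γ : ℂ}, pochInf q (q * w / γ) ≠ 0 → 1 - q * (q ^ n * w) / γ ≠ 0 := fun {γ} h => by
      have := one_sub_ne_zero_of_pochInf hq h n
      rwa [show q * w / γ * q ^ n = q * (q ^ n * w) / γ by ring] at this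
    rw [pow_succ', mul_assoc]
    refine HasExpansion.shift hq0 hq hα hβ hc hf hcf hx hb (mul_ne_zero (pow_ne_zero _ hq0) hw) hd
      he (by simpa using hde 0) (h1 hwα) (h1 hwβ) ?_ (IH (mul_ne_zero hq0 hd) he (fun k hk => ?_) ?_)
      (IH hd (mul_ne_zero hq0 he) (fun k hk => ?_) ?_)
    · rw [Fin.prod_univ_succ]
      simp only [Fin.cons_zero, Fin.cons_succ]
      rw [mul_assoc w, hbal]
      ring
    · refine hde (k - 1) (mul_left_cancel₀ hq0 ?_)
      rw [hk, zpow_sub_one₀ hq0]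
      field_simp
    · rw [hbal]; ring
    · refine hde (k + 1) ?_
      rw [hk, zpow_add_one₀ hq0]
      ring
    · rw [hbal]; ring

end QRP

namespace QRP

open Filter Topology Metric

variable {q a : ℂ}

/-! ### Analytic continuation in one parameter -/

lemma differentiableOn_pochInf_comp (hq : ‖q‖ < 1) {U : Set ℂ} {f : ℂ → ℂ}
    (hf : DifferentiableOn ℂ f U) : DifferentiableOn ℂ (fun s => pochInf q (f s)) U :=
  (differentiable_pochInf hq).comp_differentiableOn hf

lemma differentiableOn_poch_comp (q : ℂ) {U : Set ℂ} {f : ℂ → ℂ}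
    (hf : DifferentiableOn ℂ f U) (n : ℕ) : DifferentiableOn ℂ (fun s => poch q (f s) n) U :=
  (differentiable_poch q n).comp_differentiableOn hf

lemma differentiableOn_jb_comp (hq : ‖q‖ < 1) (α β : ℂ) {U : Set ℂ} {f : ℂ → ℂ}
    (hf : DifferentiableOn ℂ f U) (n : ℕ) : DifferentiableOn ℂ (fun s => jb q α β (f s) n) U := by
  unfold jb
  exact (differentiableOn_poch_comp q (by fun_prop) n).mul
    (differentiableOn_pochInf_comp hq (by fun_prop))

lemma differentiableOn_jHalf (hq : ‖q‖ < 1) (α β : ℂ) {N : ℕ} (x : Fin (N + 1) → ℂ)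
    (b : Fin N → ℂ) (d f : ℂ) {U : Set ℂ} (hU : IsOpen U) {s c e : ℂ → ℂ}
    (hs : DifferentiableOn ℂ s U) (hc : DifferentiableOn ℂ c U) (he : DifferentiableOn ℂ e U)
    (bs : UBdd fun p : U => s p) (bc : UBdd fun p : U => c p) (be : UBdd fun p : U => e p) :
    DifferentiableOn ℂ (fun p => jHalf q α β x (c p) (Fin.cons (s p) b) d (e p) f) U := by
  obtain ⟨C, hC⟩ := norm_jTerm_le hq α β (ι := U) (x := fun _ => x) (c := fun p => c p)
    (b := fun p => Fin.cons (s p) b) (d := fun _ => d) (e := fun p => e p) (f := fun _ => f)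
    (fun _ => UBdd.const _) bc (fun i => by
      refine Fin.cases ?_ (fun i => ?_) i
      · simpa using bs
      · simpa using UBdd.const _) (UBdd.const _) be (UBdd.const _)
  refine Complex.differentiableOn_tsum_of_summable_norm
    ((summable_geometric_of_lt_one (norm_nonneg q) hq).mul_right C) (fun m => ?_) hU
    (fun m p hp => hC ⟨p, hp⟩ m)
  simp only [jTerm, Fin.prod_univ_succ, Fin.cons_zero, Fin.cons_succ]
  refine DifferentiableOn.mul (DifferentiableOn.mul (DifferentiableOn.mul_const
    (DifferentiableOn.mul_const (DifferentiableOn.const_mul ?_ _) _) _) ?_) ?_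
  · exact differentiableOn_pochInf_comp hq (by fun_prop)
  · exact (differentiableOn_jb_comp hq α β hs m).mul_const _
  · exact ((differentiableOn_jb_comp hq α β he m).const_mul _).mul_const _

/-- The summand of the series after the change of variables that removes the singularity at
`b₀ = 0`. -/
noncomputable def kTermReg (q a α β : ℂ) {N : ℕ} (x : Fin (N + 1) → ℂ) (b : Fin N → ℂ)
    (d e s ζ : ℂ) (l : Fin (N + 1) → ℕ) : ℂ :=
  (∏ i, hpoch q (ζ * s) (ζ * x i) (l i)) * (core q a α β 1 x l (∑ i, l i) *
    pochInf q (a * q * s * q ^ (∑ i, l i)) * (∏ j, bfac q a x (b j) l (∑ i, l i)) *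
    (bfac q a x d l (∑ i, l i) * bfac q a x e l (∑ i, l i)))

/-- The argument of the series is ζ s, and (ζ s)^l (x / s)_l is the polynomial ∏ (ζ s - ζ x q^i). So
the pole of each (x / s)_l at s = 0 is absorbed by the power of the argument. -/
lemma kTermReg_eq (q a α β : ℂ) {N : ℕ} (x : Fin (N + 1) → ℂ) (b : Fin N → ℂ)
    (d e : ℂ) {s : ℂ} (hs : s ≠ 0) (ζ : ℂ) (l : Fin (N + 1) → ℕ) :
    kTermReg q a α β x b d e s ζ l = kTerm q a α β (ζ * s) x (Fin.cons s b) d e l := by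
  have h : ∏ i, hpoch q (ζ * s) (ζ * x i) (l i) =
      (ζ * s) ^ (∑ i, l i) * ∏ i, poch q (x i / s) (l i) := by
    rw [← Finset.prod_pow_eq_pow_sum, ← Finset.prod_mul_distrib]
    refine Finset.prod_congr rfl fun i _ => ?_
    rw [← hpoch_mul]
    congr 1
    field_simp
  rw [kTermReg, kTerm, core_eq_pow_mul q a α β (ζ * s), h]
  rw [Fin.prod_univ_succ (fun j => bfac q a x ((Fin.cons s b : Fin (N + 1) → ℂ) j) l _)]
  simp only [Fin.cons_zero, Fin.cons_succ]
  rw [bfac.eq_1 q a x s]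
  ring

lemma differentiableOn_bfac_comp (hq : ‖q‖ < 1) (a : ℂ) {M : ℕ} (x : Fin M → ℂ) {U : Set ℂ}
    {e : ℂ → ℂ} (he : DifferentiableOn ℂ e U) (he0 : ∀ p ∈ U, e p ≠ 0) (l : Fin M → ℕ) (Λ : ℕ) :
    DifferentiableOn ℂ (fun p => bfac q a x (e p) l Λ) U := by
  unfold bfac
  refine (differentiableOn_pochInf_comp hq (by fun_prop)).mul
    (DifferentiableOn.fun_finsetProd fun i _ => differentiableOn_poch_comp q ?_ _)
  exact (differentiableOn_const _).div he he0

/-- Weierstrass' criterion with the majorant C r^|l|, where r bounds the argument of the series;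
`norm_hpoch_le` supplies it also at s = 0. -/
lemma differentiableOn_tsum_kTermReg (hq : ‖q‖ < 1) (α β : ℂ) {N : ℕ} {x : Fin (N + 1) → ℂ}
    (hx : Generic q a x) (b : Fin N → ℂ) (d : ℂ) {U : Set ℂ} (hU : IsOpen U) {s ζ e : ℂ → ℂ}
    (hs : DifferentiableOn ℂ s U) (hζ : DifferentiableOn ℂ ζ U) (he : DifferentiableOn ℂ e U)
    (he0 : ∀ p ∈ U, e p ≠ 0) (bs : UBdd fun p : U => s p) (bζ : UBdd fun p : U => ζ p)
    (be : UBdd fun p : U => e p) (bi : UBdd fun p : U => (e p)⁻¹) {r : ℝ} (hr0 : 0 < r)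
    (hr1 : r < 1) (hr : ∀ p ∈ U, ‖ζ p * s p‖ ≤ r) :
    DifferentiableOn ℂ (fun p => ∑' l, kTermReg q a α β x b d (e p) (s p) (ζ p) l) U := by
  have hbc : ∀ w, UBdd fun p : U × (Fin (N + 1) → ℕ) => bfac q a x w p.2 (∑ i, p.2 i) := fun w =>
    (ubdd_bfac_const hq a x w).comp fun p : U × (Fin (N + 1) → ℕ) => (p.2, ∑ i, p.2 i)
  have h1 : UBdd fun p : U × (Fin (N + 1) → ℕ) => core q a α β 1 x p.2 (∑ i, p.2 i) *
      pochInf q (a * q * s p.1 * q ^ (∑ i, p.2 i)) * (∏ j, bfac q a x (b j) p.2 (∑ i, p.2 i)) *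
      (bfac q a x d p.2 (∑ i, p.2 i) * bfac q a x (e p.1) p.2 (∑ i, p.2 i)) := by
    refine ((UBdd.mul ?_ ?_).mul (UBdd.prod _ fun j _ => hbc _)).mul ((hbc _).mul ?_)
    · exact (ubdd_core hq α β hx).comp fun p : U × (Fin (N + 1) → ℕ) => (p.2, ∑ i, p.2 i)
    · exact ubdd_pochInf hq (((UBdd.const _).mul (bs.comp _)).mul (ubdd_pow hq _))
    · have := ubdd_bfac hq a x be (fun i => by
        simpa only [div_eq_mul_inv] using (UBdd.const (x i)).mul bi)
      exact this.comp fun p : U × (Fin (N + 1) → ℕ) => (p.1, p.2, ∑ i, p.2 i)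
  obtain ⟨C, hC⟩ := h1
  obtain ⟨Z, hZ⟩ := bζ
  have hsum : Summable fun l : Fin (N + 1) → ℕ =>
      r ^ (∑ i, l i) * ((∏ i, pochBound q (Z * ‖x i‖ / r)) * C) :=
    (summable_pow_sum hr0.le hr1 (N + 1)).mul_right _
  refine Complex.differentiableOn_tsum_of_summable_norm hsum (fun l => ?_) hU (fun l p hp => ?_)
  · unfold kTermReg
    refine DifferentiableOn.mul ?_ (DifferentiableOn.mul (DifferentiableOn.mul_const
      (DifferentiableOn.const_mul ?_ _) _) (DifferentiableOn.const_mul ?_ _))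
    · refine DifferentiableOn.fun_finsetProd fun i _ => ?_
      unfold hpoch
      exact DifferentiableOn.fun_finsetProd fun n _ => by fun_prop
    · exact differentiableOn_pochInf_comp hq (by fun_prop)
    · exact differentiableOn_bfac_comp hq a x he he0 l _
  · have h0 : r ^ (∑ i, l i) * ((∏ i, pochBound q (Z * ‖x i‖ / r)) * C) =
        (∏ i, (r ^ l i * pochBound q (Z * ‖x i‖ / r))) * C := by
      rw [← mul_assoc, ← Finset.prod_pow_eq_pow_sum, ← Finset.prod_mul_distrib]
    rw [kTermReg, norm_mul, norm_prod, h0]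
    refine mul_le_mul (Finset.prod_le_prod (fun _ _ => norm_nonneg _) fun i _ => ?_)
      (hC (⟨p, hp⟩, l)) (norm_nonneg _) (Finset.prod_nonneg fun i _ =>
      mul_nonneg (pow_nonneg hr0.le _) (pochBound_pos _ _).le)
    refine (norm_hpoch_le hq hr0 (hr p hp) _).trans ?_
    refine mul_le_mul_of_nonneg_left (pochBound_mono hq ?_) (pow_nonneg hr0.le _)
    rw [norm_mul]
    have := hZ ⟨p, hp⟩
    gcongr

/-- The forbidden γ lie on circles whose radii form a geometric progression of ratio |q|. At most
one circle meets 1 < |γ| < 1 / |q|, and η stops short of it. -/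
lemma exists_annulus_ne_mul_zpow (hq0 : q ≠ 0) (hq : ‖q‖ < 1) (d : ℂ) {e : ℂ} (he : e ≠ 0) :
    ∃ η : ℝ, 0 < η ∧ ∀ γ : ℂ, 1 < ‖γ‖ → ‖γ‖ < 1 + η → ∀ k : ℤ, d ≠ e * γ * q ^ k := by
  have hQ : 0 < ‖q‖ := norm_pos_iff.2 hq0
  have hQ1 : 1 < ‖q‖⁻¹ := (one_lt_inv₀ hQ).2 hq
  by_cases h : ∃ γ : ℂ, (1 < ‖γ‖ ∧ ‖γ‖ < ‖q‖⁻¹) ∧ ∃ k : ℤ, d = e * γ * q ^ k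
  · obtain ⟨γ, ⟨h1, h2⟩, k, hk⟩ := h
    refine ⟨‖γ‖ - 1, by linarith, fun δ h3 h4 j hj => ?_⟩
    have h5 : γ * q ^ k = δ * q ^ j := by
      refine mul_left_cancel₀ he ?_
      rw [← mul_assoc, ← hk, hj, mul_assoc]
    have h6 : ‖γ‖ = ‖δ‖ * ‖q‖ ^ (j - k) := by
      rw [zpow_sub₀ hQ.ne']
      have := congrArg norm h5
      simp only [norm_mul, norm_zpow] at this
      field_simp
      exact this
    have h7 : ‖γ‖ < ‖δ‖ * ‖q‖⁻¹ := by nlinarith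
    have hδ : 0 < ‖δ‖ := by linarith
    rcases le_or_gt 0 (j - k) with h8 | h8
    · have : ‖q‖ ^ (j - k) ≤ 1 := by
        simpa using zpow_le_zpow_right_of_le_one₀ hQ hq.le h8
      nlinarith
    · have h9 : ‖q‖⁻¹ ≤ ‖q‖ ^ (j - k) := by
        rw [← zpow_neg_one]
        exact zpow_le_zpow_right_of_le_one₀ hQ hq.le (by omega)
      nlinarith
  · push Not at h
    refine ⟨‖q‖⁻¹ - 1, by linarith, fun γ h1 h2 k hk => ?_⟩
    exact h γ ⟨h1, by linarith⟩ k hk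

/-- Analytic continuation in b_1 = p from the points q^n w near 0 to p = s. The parameters c and e
move with p so that c / (p e), hence the balance, is constant. -/
lemma HasExpansion.of_frequently (hq0 : q ≠ 0) (hq : ‖q‖ < 1) {α β : ℂ} {N : ℕ}
    {x : Fin (N + 1) → ℂ} {c f : ℂ} (hc : c ≠ 0) (hf : f ≠ 0) (hcf : ‖c / f‖ < 1)
    (hx : Generic q (q * f / (α * β)) x) {b : Fin N → ℂ} {s d e : ℂ} (hs : s ≠ 0) (he : e ≠ 0)
    (w : ℂ) (hw : w ≠ 0)
    (h : ∀ {c₁ e₁ : ℂ} (n : ℕ), c₁ ≠ 0 → e₁ ≠ 0 → ‖c₁ / f‖ < 1 → (∀ k : ℤ, d ≠ e₁ * q ^ k) →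
      c₁ * (s * e) = c * (q ^ n * w * e₁) →
      HasExpansion q α β x c₁ (Fin.cons (q ^ n * w) b) d e₁ f) :
    HasExpansion q α β x c (Fin.cons s b) d e f := by
  obtain ⟨η, hη0, hη⟩ := exists_annulus_ne_mul_zpow hq0 hq d he
  have hz0 : 0 < ‖c / f‖ := norm_pos_iff.2 (div_ne_zero hc hf)
  set z₀ := ‖c / f‖ with hz₀
  -- The disc of radius ρ |s| must contain s, so ρ > 1, while |c / f| ρ < 1 leaves room for
  -- convergence.
  set ρ := 2 / (1 + z₀) with hρ
  have hρ1 : 1 < ρ := by rw [hρ, lt_div_iff₀ (by linarith)]; linarith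
  have hρ2 : ρ ≤ 2 := by rw [hρ, div_le_iff₀ (by linarith)]; linarith
  set t := z₀ * ρ with ht
  have ht0 : 0 < t := by positivity
  have ht1 : t < 1 := by rw [ht, hρ, mul_div_assoc', div_lt_one (by linarith)]; linarith
  -- On the disc |1 - p / s| ≤ 3, so 3 ε ≤ 1 - t gives |γ - 1| ≤ 1 - t and the argument is at most t
  -- (2 - t) < 1 in modulus; ε < η keeps γ(0) = 1 + ε in the good annulus.
  set ε := min ((1 - t) / 3) (η / 2) with hε
  have hε0 : 0 < ε := lt_min (by linarith) (by linarith)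
  have hε1 : 3 * ε ≤ 1 - t := by linarith [min_le_left ((1 - t) / 3) (η / 2)]
  have hε2 : ε < η := by linarith [min_le_right ((1 - t) / 3) (η / 2)]
  have hs0 : 0 < ‖s‖ := norm_pos_iff.2 hs
  set U : Set ℂ := ball 0 (‖s‖ * ρ) with hU
  -- An affine function with γ(s) = 1, so the curve passes through the given parameters, and γ(0) =
  -- 1 + ε, so that e γ(p) avoids d q^ℤ when |γ(p)| is in the annulus, as it is for p near 0.
  set γ : ℂ → ℂ := fun p => 1 + (ε : ℂ) * (1 - p / s) with hγ
  have hγd : Differentiable ℂ γ := by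
    rw [hγ]
    fun_prop
  have hps : ∀ p ∈ U, ‖p / s‖ ≤ ρ := fun p hp => by
    rw [norm_div, div_le_iff₀ hs0, mul_comm]
    exact (mem_ball_zero_iff.1 hp).le
  have hγ1 : ∀ p ∈ U, ‖γ p - 1‖ ≤ 1 - t := fun p hp => by
    have h1 : γ p - 1 = (ε : ℂ) * (1 - p / s) := by rw [hγ]; ring
    have h2 : ‖1 - p / s‖ ≤ 3 := (norm_sub_le _ _).trans (by
      rw [norm_one]; linarith [hps p hp])
    rw [h1, norm_mul, Complex.norm_real, Real.norm_of_nonneg hε0.le]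
    nlinarith
  have hγlow : ∀ p ∈ U, t ≤ ‖γ p‖ := fun p hp => by
    have h1 := norm_sub_norm_le (1 : ℂ) (γ p)
    rw [norm_one, norm_sub_rev] at h1
    linarith [hγ1 p hp]
  have hγup : ∀ p ∈ U, ‖γ p‖ ≤ 2 - t := fun p hp => by
    have h1 := norm_sub_norm_le (γ p) 1
    rw [norm_one] at h1
    linarith [hγ1 p hp]
  have hγ0 : ∀ p ∈ U, γ p ≠ 0 := fun p hp => norm_pos_iff.1 (ht0.trans_le (hγlow p hp))
  have hγb : UBdd fun p : U => γ p := ⟨2 - t, fun p => hγup p p.2⟩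
  have hidb : UBdd fun p : U => (p : ℂ) := ⟨‖s‖ * ρ, fun p => (mem_ball_zero_iff.1 p.2).le⟩
  have hγib : UBdd fun p : U => (γ p)⁻¹ := ⟨t⁻¹, fun p => by
    rw [norm_inv]
    exact inv_anti₀ ht0 (hγlow p p.2)⟩
  have hznorm : ∀ p ∈ U, ‖c / s / f * γ p * p‖ ≤ t * (2 - t) := fun p hp => by
    have h1 : c / s / f * γ p * p = c / f * (p / s) * γ p := by ring
    rw [h1, norm_mul, norm_mul, ← hz₀]
    exact mul_le_mul (mul_le_mul_of_nonneg_left (hps p hp) hz0.le) (hγup p hp) (norm_nonneg _)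
      ht0.le
  have hr1 : t * (2 - t) < 1 := by nlinarith [sq_pos_of_pos (sub_pos.2 ht1)]
  have hr0 : 0 < t * (2 - t) := mul_pos ht0 (by linarith)
  have hUo : IsOpen U := isOpen_ball
  set cf : ℂ → ℂ := fun p => c / s * p * γ p with hcf'
  have hcfd : DifferentiableOn ℂ cf U := by rw [hcf']; fun_prop
  have hcfb : UBdd fun p : U => cf p := ((UBdd.const _).mul hidb).mul hγb
  have hed : DifferentiableOn ℂ (fun p => e * γ p) U := by fun_prop
  have heb : UBdd fun p : U => e * γ p := (UBdd.const _).mul hγb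
  set F : ℂ → ℂ := fun p => jFull q α β x (cf p) (Fin.cons p b) d (e * γ p) f with hF
  set G : ℂ → ℂ := fun p => q * pochInf q q * pochInf q (cf p / f) *
    (pochInf q (α / β) * pochInf q (β / α) / (β - α)) *
    ∑' l, kTermReg q (q * f / (α * β)) α β x b d (e * γ p) p (c / s / f * γ p) l with hG
  have hFd : DifferentiableOn ℂ F U :=
    (differentiableOn_jHalf hq α β x b d f hUo differentiableOn_id hcfd hed hidb hcfb heb).sub
      (differentiableOn_jHalf hq β α x b d f hUo differentiableOn_id hcfd hed hidb hcfb heb)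
  have hGd : DifferentiableOn ℂ G U := by
    refine DifferentiableOn.mul (DifferentiableOn.mul_const (DifferentiableOn.const_mul
      (differentiableOn_pochInf_comp hq (by fun_prop)) _) _) ?_
    exact differentiableOn_tsum_kTermReg hq α β hx b d hUo differentiableOn_id (by fun_prop) hed
      (fun p hp => mul_ne_zero he (hγ0 p hp)) hidb ((UBdd.const _).mul hγb) heb
      (by simpa only [mul_inv] using (UBdd.const _).mul hγib) hr0 hr1 hznorm
  have hiff : ∀ p ≠ 0, HasExpansion q α β x (cf p) (Fin.cons p b) d (e * γ p) f ↔ F p = G p := by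
    intro p hp
    rw [HasExpansion, hF, hG]
    have : cf p / f = c / s / f * γ p * p := by rw [hcf']; ring
    simp only [kTermReg_eq _ _ _ _ _ _ _ _ hp, this]
  have h0U : (0 : ℂ) ∈ U := mem_ball_self (by positivity)
  have hlim : Tendsto (fun n : ℕ => q ^ n * w) atTop (𝓝[≠] 0) := by
    refine tendsto_nhdsWithin_iff.2 ⟨?_, Eventually.of_forall fun n =>
      mul_ne_zero (pow_ne_zero n hq0) hw⟩
    simpa using (tendsto_pow_atTop_nhds_zero_of_norm_lt_one hq).mul_const w
  have hlimU : ∀ᶠ n : ℕ in atTop, q ^ n * w ∈ U :=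
    (hlim.mono_right nhdsWithin_le_nhds).eventually (hUo.mem_nhds h0U)
  have hlimγ : ∀ᶠ n : ℕ in atTop, 1 < ‖γ (q ^ n * w)‖ ∧ ‖γ (q ^ n * w)‖ < 1 + η := by
    have h1 := ((hγd.continuous.tendsto 0).comp (hlim.mono_right nhdsWithin_le_nhds)).norm
    have h2 : ‖γ 0‖ = 1 + ε := by
      have : γ 0 = ((1 + ε : ℝ) : ℂ) := by rw [hγ]; push_cast; ring
      rw [this, Complex.norm_real, Real.norm_of_nonneg (by linarith)]
    rw [h2] at h1
    exact (h1.eventually_const_lt (by linarith)).and (h1.eventually_lt_const (by linarith))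
  -- The points q^n w are nonzero and tend to 0, so agreement there suffices for the identity
  -- theorem; it is for this that the regularized series had to be analytic at 0.
  have hfreq : ∃ᶠ p in 𝓝[≠] (0 : ℂ), F p = G p := by
    refine hlim.frequently (Eventually.frequently ?_)
    filter_upwards [hlimU, hlimγ] with n hn1 hn2
    have hp0 : q ^ n * w ≠ 0 := mul_ne_zero (pow_ne_zero n hq0) hw
    refine (hiff _ hp0).1 (h n ?_ (mul_ne_zero he (hγ0 _ hn1)) ?_ (fun k => hη _ hn2.1 hn2.2 k) ?_)
    · exact mul_ne_zero (mul_ne_zero (div_ne_zero hc hs) hp0) (hγ0 _ hn1)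
    · refine lt_of_le_of_lt (le_of_eq ?_) ((hznorm _ hn1).trans_lt hr1)
      congr 1
      rw [hcf']
      ring
    · rw [hcf']
      field_simp
  have hEq := (hFd.analyticOnNhd hUo).eqOn_of_preconnected_of_frequently_eq
    (hGd.analyticOnNhd hUo) (convex_ball _ _).isPreconnected h0U hfreq
  have hsU : s ∈ U := mem_ball_zero_iff.2 (by nlinarith)
  have hfin := (hiff s hs).2 (hEq hsU)
  have hγs : γ s = 1 := by
    rw [hγ]
    simp [hs]
  have hcs : cf s = c := by
    rw [hcf']
    simp only [hγs]
    field_simp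
  rwa [hγs, hcs, mul_one] at hfin

/-- Induction on M: the claim for M - 1 gives b_1 ∈ {q^n x_1}, and continuation in b_1 gives the
rest. -/
theorem hasExpansion (hq0 : q ≠ 0) (hq : ‖q‖ < 1) {α β : ℂ} (hα : α ≠ 0) (hβ : β ≠ 0)
    (hαβ : α ≠ β) {f : ℂ} (hf : f ≠ 0) {M : ℕ} {x b : Fin M → ℂ} {c d e : ℂ}
    (hc : c ≠ 0) (hd : d ≠ 0) (he : e ≠ 0) (hb : ∀ j, b j ≠ 0) (hcf : ‖c / f‖ < 1)
    (hx : Generic q (q * f / (α * β)) x) (hxα : ∀ i, pochInf q (q * x i / α) ≠ 0)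
    (hxβ : ∀ i, pochInf q (q * x i / β) ≠ 0)
    (hbal : (∏ i, x i) * (c * α * β) = q ^ 2 * (∏ j, b j) * (d * e * f)) :
    HasExpansion q α β x c b d e f := by
  induction M generalizing c d e with
  | zero =>
    exact jFull_zero_eval x b hq0 hq hα hβ hαβ hd he hf (by simpa using hbal)
  | succ N ih =>
    obtain ⟨w, x, rfl⟩ : ∃ w y, x = Fin.cons w y := ⟨x 0, Fin.tail x, (Fin.cons_self_tail x).symm⟩
    obtain ⟨s, b, rfl⟩ : ∃ w y, b = Fin.cons w y := ⟨b 0, Fin.tail b, (Fin.cons_self_tail b).symm⟩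
    have hs : s ≠ 0 := by simpa using hb 0
    have hw : w ≠ 0 := by simpa using hx.x_ne 0
    have hb' : ∀ j, b j ≠ 0 := fun j => by simpa using hb j.succ
    simp only [Fin.prod_univ_succ, Fin.cons_zero, Fin.cons_succ] at hbal
    refine HasExpansion.of_frequently hq0 hq hc hf hcf hx hs he w hw ?_
    intro c₁ e₁ n hc₁ he₁ hcf₁ hde h1
    refine hasExpansion_of_eq_mul_pow hq0 hq hα hβ hc₁ hf hcf₁ hx (by simpa using hxα 0)
      (by simpa using hxβ 0) hb' (fun hd he hbal => ih hc₁ hd he hb' hcf₁ hx.tail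
      (fun i => by simpa using hxα i.succ) (fun i => by simpa using hxβ i.succ) hbal) n hd he₁ hde ?_
    have h2 := mul_ne_zero (mul_ne_zero hw hs) (mul_ne_zero hc he)
    refine mul_left_cancel₀ h2 ?_
    linear_combination w * c * (∏ i, x i) * α * β * h1 + q ^ n * w * c * e₁ * hbal

end QRP

namespace QRP

open Filter Topology

variable {q : ℂ} {M : ℕ}

/-! ### The Jackson integral -/

/-- The function `∏ (a_i t)_∞ / ∏ (b_i t)_∞`. -/
noncomputable def jackE (q t : ℂ) (p : Param M) : ℂ :=
  (∏ i, pochInf q (p.1 i * t)) / ∏ i, pochInf q (p.2 i * t)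

/-- The bilateral Jackson integral of `jackE` along `q^ℤ / a_i`. -/
noncomputable def jackS (q : ℂ) (i : Fin (M + 3)) (p : Param M) : ℂ :=
  ∑' m : ℤ, q ^ m / p.1 i * jackE q (q ^ m / p.1 i) p

/-- The poles of `jackE` avoid the relevant part of `q^ℤ / a_i`. -/
structure Admissible (q : ℂ) (i : Fin (M + 3)) (p : Param M) : Prop where
  a_ne : p.1 i ≠ 0
  reg : ∀ j, pochInf q (q * p.2 j / p.1 i) ≠ 0

lemma pochInf_zpow_eq_zero (hq0 : q ≠ 0) (hq : ‖q‖ < 1) {m : ℤ} (hm : m ≤ 0) :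
    pochInf q (q ^ m) = 0 := by
  obtain ⟨n, hn⟩ := Int.eq_ofNat_of_zero_le (neg_nonneg.2 hm)
  refine pochInf_eq_zero hq (i := n) ?_
  rw [← zpow_natCast, ← hn, ← zpow_add₀ hq0, add_neg_cancel, zpow_zero]

lemma jackE_eq_zero {t : ℂ} {p : Param M} {i : Fin (M + 3)} (h : pochInf q (p.1 i * t) = 0) :
    jackE q t p = 0 := by
  rw [jackE, Finset.prod_eq_zero (Finset.mem_univ i) h, zero_div]

namespace Admissible

variable {i : Fin (M + 3)} {p : Param M}

/-- On the lattice a_i t ∈ q^ℤ, (a_i t)_∞ ≠ 0 forces a_i t = q^(n+1) with n ≥ 0, and there b_j t =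
(q b_j / a_i) q^n. So E has a zero numerator wherever its denominator might vanish. -/
lemma ne_zero (hq0 : q ≠ 0) (hq : ‖q‖ < 1) (h : Admissible q i p) {t : ℂ}
    (ht : ∃ m : ℤ, p.1 i * t = q ^ m) (h0 : pochInf q (p.1 i * t) ≠ 0) (j : Fin (M + 3)) :
    pochInf q (p.2 j * t) ≠ 0 := by
  obtain ⟨m, hm⟩ := ht
  rw [hm] at h0
  have hm0 : 0 < m := by
    by_contra hm0
    exact h0 (pochInf_zpow_eq_zero hq0 hq (not_lt.1 hm0))
  obtain ⟨n, rfl⟩ : ∃ n : ℕ, m = n + 1 := ⟨(m - 1).toNat, by omega⟩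
  have ha := h.a_ne
  have : p.2 j * t = q * p.2 j / p.1 i * q ^ n := by
    rw [zpow_add_one₀ hq0, zpow_natCast] at hm
    field_simp
    linear_combination p.2 j * hm
  rw [this]
  exact pochInf_mul_pow_ne_zero hq (h.reg j) n

lemma jackE_eq_zero_of_nonpos (hq0 : q ≠ 0) (hq : ‖q‖ < 1) (h : Admissible q i p) {m : ℤ}
    (hm : m ≤ 0) : jackE q (q ^ m / p.1 i) p = 0 := by
  refine jackE_eq_zero (i := i) ?_
  rw [mul_div_cancel₀ _ h.a_ne]
  exact pochInf_zpow_eq_zero hq0 hq hm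

lemma summable_nat (hq : ‖q‖ < 1) (h : Admissible q i p) :
    Summable fun n : ℕ => q ^ (n + 1) / p.1 i * jackE q (q ^ (n + 1) / p.1 i) p := by
  have h1 : UBdd fun n : ℕ => q / p.1 i * ((∏ j, pochInf q (q * p.1 j / p.1 i * q ^ n)) *
      ∏ j, (pochInf q (q * p.2 j / p.1 i * q ^ n))⁻¹) :=
    (UBdd.const _).mul ((UBdd.prod _ fun j _ => ubdd_pochInf hq
      ((UBdd.const _).mul (ubdd_pow hq _))).mul
      (UBdd.prod _ fun j _ => ubdd_inv_pochInf hq (h.reg j) _))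
  obtain ⟨C, hC⟩ := h1
  refine ((summable_geometric_of_lt_one (norm_nonneg q) hq).mul_right C).of_norm_bounded
    fun n => ?_
  rw [← norm_pow]
  refine le_trans (le_of_eq ?_) (mul_le_mul_of_nonneg_left (hC n) (norm_nonneg (q ^ n)))
  have e : ∀ w : ℂ, w * (q ^ (n + 1) / p.1 i) = q * w / p.1 i * q ^ n := fun w => by ring
  rw [← norm_mul, jackE]
  simp only [e, Finset.prod_inv_distrib]
  congr 1
  ring

lemma hasSum_nat (hq0 : q ≠ 0) (hq : ‖q‖ < 1) (h : Admissible q i p) :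
    HasSum (fun m : ℤ => q ^ m / p.1 i * jackE q (q ^ m / p.1 i) p)
      (∑' n : ℕ, q ^ (n + 1) / p.1 i * jackE q (q ^ (n + 1) / p.1 i) p) := by
  have hinj : Function.Injective fun n : ℕ => (n : ℤ) + 1 := fun a b hab => by
    simpa using hab
  rw [← hinj.hasSum_iff]
  · have e : ∀ n : ℕ, q ^ ((n : ℤ) + 1) = q ^ (n + 1) := fun n => by norm_cast
    simp only [Function.comp_def, e]
    exact (h.summable_nat hq).hasSum
  · intro m hm
    have hm0 : m ≤ 0 := by
      by_contra hm0
      exact hm ⟨(m - 1).toNat, by simp only; omega⟩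
    rw [h.jackE_eq_zero_of_nonpos hq0 hq hm0, mul_zero]

lemma jackS_eq (hq0 : q ≠ 0) (hq : ‖q‖ < 1) (h : Admissible q i p) :
    jackS q i p = ∑' n : ℕ, q ^ (n + 1) / p.1 i * jackE q (q ^ (n + 1) / p.1 i) p :=
  (h.hasSum_nat hq0 hq).tsum_eq

/-- A bilateral sum depends only on the lattice, so the base point may be any t with a_i t ∈ q^ℤ.
Shifts of a_i itself thus leave the lattice of summation unchanged. -/
lemma hasSum (hq0 : q ≠ 0) (hq : ‖q‖ < 1) (h : Admissible q i p) {t : ℂ}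
    (ht : ∃ k : ℤ, p.1 i * t = q ^ k) :
    HasSum (fun m : ℤ => q ^ m * t * jackE q (q ^ m * t) p) (jackS q i p) := by
  obtain ⟨k, hk⟩ := ht
  have ha := h.a_ne
  rw [h.jackS_eq hq0 hq]
  have h1 := (Equiv.addRight k).hasSum_iff.2 (h.hasSum_nat hq0 hq)
  have e : ∀ m : ℤ, q ^ m * t = q ^ (m + k) / p.1 i := fun m => by
    rw [zpow_add₀ hq0, ← hk]
    field_simp
  simp only [e]
  exact h1

end Admissible

/-! ### Contiguity relations -/

lemma prod_update_mul {n : ℕ} (hq : ‖q‖ < 1) (a : Fin n → ℂ) (k : Fin n) (t : ℂ) :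
    (∏ i, pochInf q (Function.update a k (q * a k) i * t)) * (1 - a k * t) =
      ∏ i, pochInf q (a i * t) := by
  rw [← Finset.mul_prod_erase _ _ (Finset.mem_univ k),
    ← Finset.mul_prod_erase _ (fun i => pochInf q (a i * t)) (Finset.mem_univ k),
    Function.update_self, pochInf_eq_one_sub_mul hq (a k * t), mul_assoc q,
    Finset.prod_congr rfl fun i hi => by rw [Function.update_of_ne (Finset.ne_of_mem_erase hi)]]
  ring

lemma shA_one_neg (hq0 : q ≠ 0) (k : Fin (M + 3)) (p : Param M) :
    shA q k 1 (shA q k (-1) p) = p := by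
  simp [shA, mul_inv_cancel_left₀ hq0]

lemma shB_one_neg (hq0 : q ≠ 0) (k : Fin (M + 3)) (p : Param M) :
    shB q k 1 (shB q k (-1) p) = p := by
  simp [shB, mul_inv_cancel_left₀ hq0]

lemma shA_comm (q : ℂ) {k l : Fin (M + 3)} (h : k ≠ l) (e f : ℤ) (p : Param M) :
    shA q k e (shA q l f p) = shA q l f (shA q k e p) := by
  simp only [shA, Function.update_of_ne h, Function.update_of_ne h.symm]
  rw [Function.update_comm h]

lemma shA_shB_comm (q : ℂ) (k l : Fin (M + 3)) (e f : ℤ) (p : Param M) :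
    shA q k e (shB q l f p) = shB q l f (shA q k e p) := rfl

lemma shA_snd (q : ℂ) (k : Fin (M + 3)) (e : ℤ) (p : Param M) : (shA q k e p).2 = p.2 := rfl

lemma shB_fst (q : ℂ) (k : Fin (M + 3)) (e : ℤ) (p : Param M) : (shB q k e p).1 = p.1 := rfl

lemma shA_fst_self (q : ℂ) (k : Fin (M + 3)) (e : ℤ) (p : Param M) :
    (shA q k e p).1 k = q ^ e * p.1 k := Function.update_self ..

lemma shA_fst_of_ne (q : ℂ) {k i : Fin (M + 3)} (h : i ≠ k) (e : ℤ) (p : Param M) :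
    (shA q k e p).1 i = p.1 i := Function.update_of_ne h ..

lemma shB_snd_self (q : ℂ) (k : Fin (M + 3)) (e : ℤ) (p : Param M) :
    (shB q k e p).2 k = q ^ e * p.2 k := Function.update_self ..

lemma shB_snd_of_ne (q : ℂ) {k i : Fin (M + 3)} (h : i ≠ k) (e : ℤ) (p : Param M) :
    (shB q k e p).2 i = p.2 i := Function.update_of_ne h ..

lemma jackE_shA_one (hq : ‖q‖ < 1) (k : Fin (M + 3)) (p : Param M) (t : ℂ) :
    jackE q t p = (1 - p.1 k * t) * jackE q t (shA q k 1 p) := by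
  simp only [jackE, shA, zpow_one]
  rw [← prod_update_mul hq p.1 k t]
  ring

lemma jackE_shA_neg (hq0 : q ≠ 0) (hq : ‖q‖ < 1) (k : Fin (M + 3)) (p : Param M) (t : ℂ) :
    jackE q t (shA q k (-1) p) = (1 - q⁻¹ * p.1 k * t) * jackE q t p := by
  rw [jackE_shA_one hq k, shA_one_neg hq0, shA_fst_self, zpow_neg_one]

/-- The extra hypothesis handles the zeros of (b_k t)_∞: there the numerator is zero too, and both
sides vanish. -/
lemma jackE_shB_one (hq : ‖q‖ < 1) (k i : Fin (M + 3)) (p : Param M) (t : ℂ)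
    (h : pochInf q (p.1 i * t) ≠ 0 → pochInf q (p.2 k * t) ≠ 0) :
    jackE q t (shB q k 1 p) = (1 - p.2 k * t) * jackE q t p := by
  by_cases h0 : pochInf q (p.1 i * t) = 0
  · rw [jackE_eq_zero h0, jackE_eq_zero (p := shB q k 1 p) h0, mul_zero]
  · have h1 := one_sub_ne_zero_of_pochInf hq (h h0) 0
    rw [pow_zero, mul_one] at h1
    simp only [jackE, shB, zpow_one]
    rw [← prod_update_mul hq p.2 k t, mul_comm (1 - p.2 k * t), div_mul_eq_mul_div,
      mul_div_mul_right _ _ h1]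

/-- Two parameter points whose `i`-th `a`-parameters agree up to a power of `q`. -/
def SameLattice (q : ℂ) (i : Fin (M + 3)) (p p' : Param M) : Prop :=
  ∃ k : ℤ, p'.1 i = q ^ k * p.1 i

namespace SameLattice

variable {i : Fin (M + 3)} {p p' : Param M}

lemma rfl' : SameLattice q i p p := ⟨0, by simp⟩

lemma shA (hq0 : q ≠ 0) (h : SameLattice q i p p') (k : Fin (M + 3)) (e : ℤ) :
    SameLattice q i p (shA q k e p') := by
  obtain ⟨j, hj⟩ := h
  by_cases hi : i = k
  · subst hi
    exact ⟨e + j, by rw [shA_fst_self, hj, zpow_add₀ hq0, mul_assoc]⟩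
  · exact ⟨j, by rw [shA_fst_of_ne q hi, hj]⟩

lemma shB (h : SameLattice q i p p') (k : Fin (M + 3)) (e : ℤ) :
    SameLattice q i p (shB q k e p') := h

lemma exists_mul_eq (hq0 : q ≠ 0) (h : SameLattice q i p p') (hp : p.1 i ≠ 0) (m : ℤ) :
    ∃ k : ℤ, p'.1 i * (q ^ m * (p.1 i)⁻¹) = q ^ k := by
  obtain ⟨j, hj⟩ := h
  exact ⟨j + m, by rw [hj, zpow_add₀ hq0]; field_simp⟩

end SameLattice

variable {i k l : Fin (M + 3)} {p p₁ p₂ p₃ : Param M}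

/-- All three integrals run over the same lattice, so a linear relation between the integrands sums
to one between the integrals. -/
lemma jackS_relation (hq0 : q ≠ 0) (hq : ‖q‖ < 1)
    (h1 : Admissible q i p₁) (h2 : Admissible q i p₂) (h3 : Admissible q i p₃)
    (hp : p.1 i ≠ 0) (l1 : SameLattice q i p p₁) (l2 : SameLattice q i p p₂)
    (l3 : SameLattice q i p p₃) (c₁ c₂ c₃ : ℂ)
    (h : ∀ t : ℂ, (∃ m : ℤ, t = q ^ m * (p.1 i)⁻¹) →
      c₁ * jackE q t p₁ - c₂ * jackE q t p₂ + c₃ * jackE q t p₃ = 0) :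
    c₁ * jackS q i p₁ - c₂ * jackS q i p₂ + c₃ * jackS q i p₃ = 0 := by
  have hs : ∀ {p' : Param M}, Admissible q i p' → SameLattice q i p p' →
      HasSum (fun m : ℤ => q ^ m * (p.1 i)⁻¹ * jackE q (q ^ m * (p.1 i)⁻¹) p') (jackS q i p') :=
    fun h' l' => h'.hasSum hq0 hq (by simpa using l'.exists_mul_eq hq0 hp 0)
  refine ((((hs h1 l1).mul_left c₁).sub ((hs h2 l2).mul_left c₂)).add
    ((hs h3 l3).mul_left c₃)).unique ?_
  have h0 : ∀ m : ℤ, c₁ * (q ^ m * (p.1 i)⁻¹ * jackE q (q ^ m * (p.1 i)⁻¹) p₁) -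
      c₂ * (q ^ m * (p.1 i)⁻¹ * jackE q (q ^ m * (p.1 i)⁻¹) p₂) +
      c₃ * (q ^ m * (p.1 i)⁻¹ * jackE q (q ^ m * (p.1 i)⁻¹) p₃) = 0 := fun m => by
    linear_combination q ^ m * (p.1 i)⁻¹ * h _ ⟨m, rfl⟩
  simp only [h0]
  exact hasSum_zero

/-- With a_k shifted up, the three integrands are a common function times 1 - a_l t / q, 1 - a_1 t /
q and 1 - a_k t. The coefficients are those of the linear relation between these; the other
equations arise in the same way. -/
lemma jackS_eqAA (hq0 : q ≠ 0) (hq : ‖q‖ < 1) (hkl : k ≠ l) (hk : k ≠ 0) (hp : Admissible q i p)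
    (h1 : Admissible q i (shA q k 1 (shA q l (-1) p)))
    (h2 : Admissible q i (shA q k 1 (shA q 0 (-1) p))) :
    (p.1 0 - p.1 k * q) * jackS q i (shA q k 1 (shA q l (-1) p))
      - (p.1 l - p.1 k * q) * jackS q i (shA q k 1 (shA q 0 (-1) p))
      + (p.1 l - p.1 0) * jackS q i p = 0 := by
  refine jackS_relation hq0 hq h1 h2 hp hp.a_ne ((SameLattice.rfl'.shA hq0 _ _).shA hq0 _ _)
    ((SameLattice.rfl'.shA hq0 _ _).shA hq0 _ _) SameLattice.rfl' _ _ _ fun t _ => ?_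
  rw [shA_comm q hkl, shA_comm q hk, jackE_shA_neg hq0 hq, jackE_shA_neg hq0 hq,
    shA_fst_of_ne q hkl.symm, shA_fst_of_ne q hk.symm, jackE_shA_one hq k p]
  field_simp
  ring

lemma jackS_eqA (hq0 : q ≠ 0) (hq : ‖q‖ < 1) (hk : k ≠ 0) (hi : i ≠ 0) (hp : Admissible q i p)
    (h1 : Admissible q i (shA q 0 1 (shA q k (-1) p)))
    (h2 : Admissible q i (shA q 0 1 (shB q 0 1 p))) :
    (p.2 0 - p.1 0) * jackS q i (shA q 0 1 (shA q k (-1) p))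
      - (q⁻¹ * p.1 k - p.1 0) * jackS q i (shA q 0 1 (shB q 0 1 p))
      + (q⁻¹ * p.1 k - p.2 0) * jackS q i p = 0 := by
  refine jackS_relation hq0 hq h1 h2 hp hp.a_ne ((SameLattice.rfl'.shA hq0 _ _).shA hq0 _ _)
    ((SameLattice.rfl'.shB _ _).shA hq0 _ _) SameLattice.rfl' _ _ _ ?_
  rintro t ⟨m, rfl⟩
  have hr := hp.ne_zero hq0 hq (SameLattice.rfl'.exists_mul_eq hq0 hp.a_ne m)
  rw [shA_comm q hk.symm, shA_shB_comm, jackE_shA_neg hq0 hq,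
    jackE_shB_one hq 0 i _ _ (by rw [shA_fst_of_ne q hi]; exact fun h => hr h 0),
    shA_fst_of_ne q hk, shA_snd, jackE_shA_one hq 0 p]
  ring

lemma jackS_eqBB (hq0 : q ≠ 0) (hq : ‖q‖ < 1) (hkl : k ≠ l) (hl : l ≠ 0) (hp : Admissible q i p)
    (h1 : Admissible q i (shB q k 1 (shB q l (-1) p)))
    (h2 : Admissible q i (shB q 0 1 (shB q l (-1) p))) :
    (p.2 0 - q⁻¹ * p.2 l) * jackS q i (shB q k 1 (shB q l (-1) p))
      - (p.2 k - q⁻¹ * p.2 l) * jackS q i (shB q 0 1 (shB q l (-1) p))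
      + (p.2 k - p.2 0) * jackS q i p = 0 := by
  refine jackS_relation hq0 hq h1 h2 hp hp.a_ne ((SameLattice.rfl'.shB _ _).shB _ _)
    ((SameLattice.rfl'.shB _ _).shB _ _) SameLattice.rfl' _ _ _ ?_
  rintro t ⟨m, rfl⟩
  have ht := SameLattice.rfl'.exists_mul_eq hq0 hp.a_ne m
  have hr := hp.ne_zero hq0 hq ht
  have hr1 := h1.ne_zero hq0 hq ht
  -- Lowering b_l needs (q⁻¹ b_l t)_∞ ≠ 0. Admissibility of the first shifted point gives it, since
  -- k ≠ l leaves q⁻¹ b_l untouched there.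
  have hl1 : (shB q k 1 (shB q l (-1) p)).2 l = (shB q l (-1) p).2 l := shB_snd_of_ne q hkl.symm ..
  have e := jackE_shB_one hq l i (shB q l (-1) p) (q ^ m * (p.1 i)⁻¹)
    (fun h => by rw [← hl1]; exact hr1 h l)
  rw [shB_one_neg hq0, shB_snd_self, zpow_neg_one] at e
  rw [jackE_shB_one hq k i _ _ (by rw [shB_snd_of_ne q hkl]; exact fun h => hr h k),
    jackE_shB_one hq 0 i _ _ (by rw [shB_snd_of_ne q hl.symm]; exact fun h => hr h 0), e,
    shB_snd_of_ne q hkl, shB_snd_of_ne q hl.symm]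
  ring

lemma jackS_eqB (hq0 : q ≠ 0) (hq : ‖q‖ < 1) (hk : k ≠ 0) (hp : Admissible q i p)
    (h1 : Admissible q i (shB q k 1 (shB q 0 (-1) p)))
    (h2 : Admissible q i (shA q 0 (-1) (shB q 0 (-1) p))) :
    (p.1 0 - p.2 0) * jackS q i (shB q k 1 (shB q 0 (-1) p))
      - (p.2 k * q - p.2 0) * jackS q i (shA q 0 (-1) (shB q 0 (-1) p))
      + (p.2 k * q - p.1 0) * jackS q i p = 0 := by
  refine jackS_relation hq0 hq h1 h2 hp hp.a_ne ((SameLattice.rfl'.shB _ _).shB _ _)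
    ((SameLattice.rfl'.shB _ _).shA hq0 _ _) SameLattice.rfl' _ _ _ ?_
  rintro t ⟨m, rfl⟩
  have ht := SameLattice.rfl'.exists_mul_eq hq0 hp.a_ne m
  have hr := hp.ne_zero hq0 hq ht
  have hr1 := h1.ne_zero hq0 hq ht
  have hl1 : (shB q k 1 (shB q 0 (-1) p)).2 0 = (shB q 0 (-1) p).2 0 := shB_snd_of_ne q hk.symm ..
  have e := jackE_shB_one hq 0 i (shB q 0 (-1) p) (q ^ m * (p.1 i)⁻¹)
    (fun h => by rw [← hl1]; exact hr1 h 0)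
  rw [shB_one_neg hq0, shB_snd_self, zpow_neg_one] at e
  rw [jackE_shB_one hq k i _ _ (by rw [shB_snd_of_ne q hk]; exact fun h => hr h k),
    jackE_shA_neg hq0 hq, e, shB_snd_of_ne q hk, shB_fst]
  field_simp
  ring

lemma jackS_eqAB (hq0 : q ≠ 0) (hq : ‖q‖ < 1) (hl : l ≠ 0) (hp : Admissible q i p)
    (h1 : Admissible q i (shA q k 1 (shB q l 1 p)))
    (h2 : Admissible q i (shA q k 1 (shB q 0 1 p))) :
    (p.2 0 - p.1 k) * jackS q i (shA q k 1 (shB q l 1 p))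
      - (p.2 l - p.1 k) * jackS q i (shA q k 1 (shB q 0 1 p))
      + (p.2 l - p.2 0) * jackS q i p = 0 := by
  have L1 : SameLattice q i p (shA q k 1 (shB q l 1 p)) :=
    (SameLattice.rfl'.shB _ _).shA hq0 _ _
  refine jackS_relation hq0 hq h1 h2 hp hp.a_ne L1
    ((SameLattice.rfl'.shB _ _).shA hq0 _ _) SameLattice.rfl' _ _ _ ?_
  rintro t ⟨m, rfl⟩
  have ht := L1.exists_mul_eq hq0 hp.a_ne m
  -- For i = k the shifted a_k has more lattice points with nonzero numerator than a_k. Regularity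
  -- of each unshifted b is therefore taken from the shifted point in which that b is not shifted.
  have hr1 := h1.ne_zero hq0 hq ht
  have hr2 := h2.ne_zero hq0 hq ht
  have e1 : (shA q k 1 (shB q l 1 p)).2 0 = p.2 0 := shB_snd_of_ne q hl.symm ..
  have e2 : (shA q k 1 (shB q 0 1 p)).2 l = p.2 l := shB_snd_of_ne q hl ..
  rw [shA_shB_comm, shA_shB_comm, jackE_shB_one hq l i _ _ (fun h => e2 ▸ hr2 h l),
    jackE_shB_one hq 0 i _ _ (fun h => e1 ▸ hr1 h 0), shA_snd, jackE_shA_one hq k p]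
  ring

lemma jackS_eqABinv (hq0 : q ≠ 0) (hq : ‖q‖ < 1) (hi : i ≠ 0) (hp : Admissible q i p)
    (h1 : Admissible q i (shA q k (-1) (shB q l (-1) p)))
    (h2 : Admissible q i (shA q 0 (-1) (shB q l (-1) p))) :
    (p.2 l - p.1 0) * jackS q i (shA q k (-1) (shB q l (-1) p))
      - (p.2 l - p.1 k) * jackS q i (shA q 0 (-1) (shB q l (-1) p))
      + (p.1 0 - p.1 k) * jackS q i p = 0 := by
  refine jackS_relation hq0 hq h1 h2 hp hp.a_ne ((SameLattice.rfl'.shB _ _).shA hq0 _ _)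
    ((SameLattice.rfl'.shB _ _).shA hq0 _ _) SameLattice.rfl' _ _ _ ?_
  rintro t ⟨m, rfl⟩
  have hi0 : (shA q 0 (-1) (shB q l (-1) p)).1 i = p.1 i := shA_fst_of_ne q hi ..
  have ht := SameLattice.rfl'.exists_mul_eq hq0 hp.a_ne m
  -- The second shifted point is used because its a_i is unshifted; in the first one i = k is
  -- possible, and then fewer lattice points are covered.
  have hr2 := h2.ne_zero hq0 hq (t := q ^ m * (p.1 i)⁻¹) (by rw [hi0]; exact ht)
  have e := jackE_shB_one hq l i (shB q l (-1) p) (q ^ m * (p.1 i)⁻¹)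
    (fun h => hr2 (by rw [hi0]; exact h) l)
  rw [shB_one_neg hq0, shB_snd_self, zpow_neg_one] at e
  rw [jackE_shA_neg hq0 hq, jackE_shA_neg hq0 hq, e, shB_fst]
  ring

lemma jackS_smul (hq0 : q ≠ 0) (p : Param M) (i : Fin (M + 3)) :
    q * jackS q i (q • p) = jackS q i p := by
  simp only [jackS]
  rw [← tsum_mul_left]
  refine tsum_congr fun m => ?_
  have e : ∀ w : ℂ, q * w * (q ^ m / (q * p.1 i)) = w * (q ^ m / p.1 i) := fun w => by
    rw [mul_right_comm, ← mul_div_assoc, mul_div_mul_left _ _ hq0]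
    ring
  simp only [jackE, Prod.smul_fst, Prod.smul_snd, Pi.smul_apply, smul_eq_mul, e]
  have e2 : q * (q ^ m / (q * p.1 i)) = q ^ m / p.1 i := by simpa using e 1
  rw [← mul_assoc q, e2]

end QRP

namespace QRP

open Filter Topology

variable {q : ℂ} {M : ℕ}

/-! ### The operator `Ê_M` -/

/-- The point `T^n p`, where `T = T_{a_1} T_{b_1}`. -/
noncomputable def shT (q : ℂ) (n : ℤ) (p : Param M) : Param M := shA q 0 n (shB q 0 n p)

lemma shT_shT (hq0 : q ≠ 0) (m n : ℤ) (p : Param M) : shT q m (shT q n p) = shT q (m + n) p := by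
  simp [shT, shA, shB, zpow_add₀ hq0, mul_assoc]

lemma shT_zero (q : ℂ) (p : Param M) : shT q 0 p = p := by simp [shT, shA, shB]

lemma shT_fst_zero (q : ℂ) (n : ℤ) (p : Param M) : (shT q n p).1 0 = q ^ n * p.1 0 :=
  shA_fst_self ..

lemma shT_snd_zero (q : ℂ) (n : ℤ) (p : Param M) : (shT q n p).2 0 = q ^ n * p.2 0 :=
  shB_snd_self q 0 n p

lemma shT_fst_of_ne (q : ℂ) (n : ℤ) (p : Param M) {i : Fin (M + 3)} (h : i ≠ 0) :
    (shT q n p).1 i = p.1 i := shA_fst_of_ne q h ..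

lemma shT_snd_of_ne (q : ℂ) (n : ℤ) (p : Param M) {i : Fin (M + 3)} (h : i ≠ 0) :
    (shT q n p).2 i = p.2 i := shB_snd_of_ne q h ..

/-- In `prodQ` the ascription `(i : ℤ)` makes the bound variable an integer and the list a monadic
coercion; here the index is a natural number again. -/
lemma prodQ_eq (q : ℂ) (n : ℕ) :
    prodQ q M n = ((List.range n).map fun i : ℕ => 1 - (q ^ (-(i : ℤ))) • opT q M 1).prod := by
  have : ∀ l : List ℕ, (do let a ← l; pure (a : ℤ)) = List.map (Nat.cast : ℕ → ℤ) l := fun l => by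
    induction l with
    | nil => rfl
    | cons a l ih => simpa using ih
  rw [prodQ, this, List.map_map]
  rfl

/-- The span of the evaluations at `T^n p`, `lo ≤ n ≤ hi`. -/
def evalSpan (q : ℂ) (lo hi : ℤ) (p : Param M) : Submodule ℂ (Module.Dual ℂ (Param M → ℂ)) :=
  Submodule.span ℂ {φ | ∃ n, lo ≤ n ∧ n ≤ hi ∧ φ = LinearMap.proj (shT q n p)}

/-- An operator whose value at `p` only involves the points `T^n p`, `lo ≤ n ≤ hi`. -/
def InShiftRange (q : ℂ) (lo hi : ℤ) (A : Op M) : Prop :=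
  ∀ p, (LinearMap.proj p : Module.Dual ℂ (Param M → ℂ)).comp A ∈ evalSpan q lo hi p

namespace InShiftRange

variable {lo hi lo' hi' : ℤ} {A B : Op M}

lemma mono (h : InShiftRange q lo hi A) (h1 : lo' ≤ lo) (h2 : hi ≤ hi') :
    InShiftRange q lo' hi' A := fun p => by
  refine Submodule.span_mono ?_ (h p)
  rintro _ ⟨n, hn1, hn2, rfl⟩
  exact ⟨n, h1.trans hn1, hn2.trans h2, rfl⟩

lemma opT (q : ℂ) (n : ℤ) : InShiftRange q n n (opT q M n) := fun p =>
  Submodule.subset_span ⟨n, le_rfl, le_rfl, rfl⟩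

lemma one (q : ℂ) : InShiftRange q 0 0 (1 : Op M) := fun p =>
  Submodule.subset_span ⟨0, le_rfl, le_rfl, by rw [shT_zero]; rfl⟩

lemma add (hA : InShiftRange q lo hi A) (hB : InShiftRange q lo hi B) :
    InShiftRange q lo hi (A + B) := fun p => by
  rw [LinearMap.comp_add]
  exact add_mem (hA p) (hB p)

lemma sub (hA : InShiftRange q lo hi A) (hB : InShiftRange q lo hi B) :
    InShiftRange q lo hi (A - B) := fun p => by
  rw [LinearMap.comp_sub]
  exact sub_mem (hA p) (hB p)

lemma smul (c : ℂ) (hA : InShiftRange q lo hi A) : InShiftRange q lo hi (c • A) := fun p => by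
  rw [LinearMap.comp_smul]
  exact Submodule.smul_mem _ _ (hA p)

lemma mulOp_mul (c : Param M → ℂ) (hA : InShiftRange q lo hi A) :
    InShiftRange q lo hi (mulOp c * A) := fun p => by
  have : (LinearMap.proj p : Module.Dual ℂ (Param M → ℂ)).comp (mulOp c * A) =
      c p • (LinearMap.proj p : Module.Dual ℂ (Param M → ℂ)).comp A := rfl
  rw [this]
  exact Submodule.smul_mem _ _ (hA p)

lemma mulOp (q : ℂ) (c : Param M → ℂ) : InShiftRange q 0 0 (mulOp c) := by
  simpa using (one q).mulOp_mul c

lemma sum {ι : Type*} (s : Finset ι) {F : ι → Op M} (h : ∀ i ∈ s, InShiftRange q lo hi (F i)) :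
    InShiftRange q lo hi (∑ i ∈ s, F i) := fun p => by
  have : (LinearMap.proj p : Module.Dual ℂ (Param M → ℂ)).comp (∑ i ∈ s, F i) =
      ∑ i ∈ s, (LinearMap.proj p : Module.Dual ℂ (Param M → ℂ)).comp (F i) := by
    ext y
    simp
  rw [this]
  exact sum_mem fun i hi => h i hi p

/-- The functional of the left factor is a combination of evaluations at T^n p, and at each of these
the right factor reads a further range of shifts. -/
lemma mul (hq0 : q ≠ 0) (hA : InShiftRange q lo hi A) (hB : InShiftRange q lo' hi' B) :
    InShiftRange q (lo + lo') (hi + hi') (A * B) := fun p => by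
  have key : ∀ φ ∈ evalSpan q lo hi p, φ.comp B ∈ evalSpan q (lo + lo') (hi + hi') p := by
    intro φ hφ
    induction hφ using Submodule.span_induction with
    | mem φ h =>
      obtain ⟨n, h1, h2, rfl⟩ := h
      refine Submodule.span_mono ?_ (hB (shT q n p))
      rintro _ ⟨m, h3, h4, rfl⟩
      exact ⟨m + n, by omega, by omega, by rw [shT_shT hq0]⟩
    | zero => rw [LinearMap.zero_comp]; exact zero_mem _
    | add φ ψ _ _ h1 h2 => rw [LinearMap.add_comp]; exact add_mem h1 h2
    | smul c φ _ h => rw [LinearMap.smul_comp]; exact Submodule.smul_mem _ _ h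
  exact key _ (hA p)

lemma prodAB (hq0 : q ≠ 0) (n : ℕ) : InShiftRange q 0 n (prodAB q M n) := by
  induction n with
  | zero => exact one q
  | succ n ih =>
    rw [QRP.prodAB, List.range_succ, List.map_append, List.prod_append, List.map_singleton,
      List.prod_singleton]
    have h1 : InShiftRange q 0 1 (1 - QRP.mulOp (fun p : Param M => p.1 0 * q ^ n / p.2 0) *
        QRP.opT q M 1) :=
      ((one q).mono le_rfl zero_le_one).sub (((opT q 1).mulOp_mul _).mono zero_le_one le_rfl)
    exact (ih.mul hq0 h1).mono (by simp) (by push_cast; exact le_rfl)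

lemma prodQ (hq0 : q ≠ 0) (n : ℕ) : InShiftRange q 0 n (prodQ q M n) := by
  induction n with
  | zero => exact one q
  | succ n ih =>
    rw [prodQ_eq, List.range_succ, List.map_append, List.prod_append, List.map_singleton,
      List.prod_singleton]
    have h1 : InShiftRange q 0 1 (1 - (q ^ (-(n : ℤ))) • QRP.opT q M 1) :=
      ((one q).mono le_rfl zero_le_one).sub (((opT q 1).smul _).mono zero_le_one le_rfl)
    rw [prodQ_eq] at ih
    exact (ih.mul hq0 h1).mono (by simp) (by push_cast; exact le_rfl)

lemma opE (hq0 : q ≠ 0) : InShiftRange q (-1) M (opE q M) := by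
  refine ((InShiftRange.mul hq0 ((opT q (-1)).mulOp_mul _) (prodAB hq0 (M + 1))).mono (by simp)
    (by push_cast; omega) |>.add (sum _ fun k hk => ?_)).add
    ((InShiftRange.mul hq0 ((opT q (-1)).mulOp_mul _) (prodQ hq0 (M + 1))).mono (by simp)
    (by push_cast; omega))
  obtain ⟨h1, h2⟩ := Finset.mem_Icc.1 hk
  have h3 : InShiftRange q (-1) 0 (QRP.mulOp (fun p : Param M => esymmTail k p.1) *
      QRP.opT q M (-1) - QRP.mulOp (fun p : Param M => q * esymmTail k p.2)) :=
    (((opT q (-1)).mulOp_mul _).mono le_rfl (by norm_num)).sub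
      ((mulOp q _).mono (by norm_num) le_rfl)
  exact (((h3.mulOp_mul _).mul hq0 (prodAB hq0 _)).mul hq0 (prodQ hq0 _)).mono (by simp)
    (by omega)

end InShiftRange

/-- All factors are polynomials in the one operator S and commute, so the last may be moved to the
front for induction. -/
lemma list_prod_range_succ' (S : Op M) (c : ℕ → ℂ) (n : ℕ) :
    ((List.range (n + 1)).map fun i => 1 - c i • S).prod =
      (1 - c n • S) * ((List.range n).map fun i => 1 - c i • S).prod := by
  rw [List.range_succ, List.map_append, List.prod_append, List.map_singleton, List.prod_singleton]
  refine (Commute.list_prod_left _ _ fun A hA => ?_).eq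
  obtain ⟨i, _, rfl⟩ := List.mem_map.1 hA
  exact ((Commute.one_right _).sub_right ((Commute.one_left _).sub_left
    (((Commute.refl S).smul_left _).smul_right _)))

lemma prodQ_succ (q : ℂ) (n : ℕ) :
    prodQ q M (n + 1) = (1 - (q ^ (-(n : ℤ))) • opT q M 1) * prodQ q M n := by
  rw [prodQ_eq, prodQ_eq]
  exact list_prod_range_succ' _ (fun i => q ^ (-(i : ℤ))) n

lemma prodAB_succ (q : ℂ) (n : ℕ) :
    prodAB q M (n + 1) =
      (1 - mulOp (fun p : Param M => p.1 0 * q ^ n / p.2 0) * opT q M 1) * prodAB q M n := by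
  have h : ∀ i : ℕ, mulOp (fun p : Param M => p.1 0 * q ^ i / p.2 0) * opT q M 1 =
      q ^ i • (mulOp (fun p : Param M => p.1 0 / p.2 0) * opT q M 1) := fun i => by
    refine LinearMap.ext fun y => funext fun p => ?_
    show p.1 0 * q ^ i / p.2 0 * _ = q ^ i * (p.1 0 / p.2 0 * _)
    ring
  simp only [prodAB, h]
  exact list_prod_range_succ' _ (fun i => q ^ i) n

section eval

variable {t : ℂ} {R : Param M → ℂ}

/-- With T : (a, b) ↦ (qa, qb), each factor 1 - q^(-k) T raises the power of q in the numerator,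
because (1 - q^k a t) - q^(-k) q^k (1 - b t) = b t (1 - (a / b) q^k). The lemma after it continues
with factors 1 - (a q^n / b) T, which change the shifted factorial but no power of t. -/
lemma prodQ_apply (hq0 : q ≠ 0) (hq : ‖q‖ < 1) (hR : ∀ n p, R (shT q n p) = R p) (k : ℕ)
    {p : Param M} (hb : p.2 0 ≠ 0) (hbt : pochInf q (p.2 0 * t) ≠ 0) :
    prodQ q M k (fun p => R p * (pochInf q (p.1 0 * t) / pochInf q (p.2 0 * t))) p =
      R p * (p.2 0 ^ k * t ^ k * poch q (p.1 0 / p.2 0) k *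
        (pochInf q (q ^ k * p.1 0 * t) / pochInf q (p.2 0 * t))) := by
  induction k generalizing p with
  | zero => simp [prodQ]
  | succ k ih =>
    have e1 := pochInf_eq_one_sub_mul hq (p.2 0 * t)
    have hbt' := hbt
    rw [e1] at hbt'
    have h2 := left_ne_zero_of_mul hbt'
    have h3 : pochInf q ((shT q 1 p).2 0 * t) ≠ 0 := by
      rw [shT_snd_zero, zpow_one, mul_assoc]
      exact right_ne_zero_of_mul hbt'
    rw [prodQ_succ]
    show prodQ q M k _ p - q ^ (-(k : ℤ)) * prodQ q M k _ (shT q 1 p) = _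
    rw [ih hb hbt, ih (by rw [shT_snd_zero, zpow_one]; exact mul_ne_zero hq0 hb) h3, hR,
      shT_fst_zero, shT_snd_zero, zpow_one, mul_div_mul_left _ _ hq0]
    rw [shT_snd_zero, zpow_one] at h3
    rw [poch_succ]
    have e2 := pochInf_eq_one_sub_mul hq (q ^ k * p.1 0 * t)
    have e3 : q * (q ^ k * p.1 0 * t) = q ^ (k + 1) * p.1 0 * t := by ring
    have e4 : q ^ k * (q * p.1 0) * t = q ^ (k + 1) * p.1 0 * t := by ring
    have e5 : q * (p.2 0 * t) = q * p.2 0 * t := by ring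
    rw [e3] at e2
    rw [e5] at e1
    rw [e4, e2, e1, zpow_neg, zpow_natCast]
    generalize pochInf q (q ^ (k + 1) * p.1 0 * t) = X
    generalize pochInf q (q * p.2 0 * t) = Y at *
    have := pow_ne_zero k hq0
    field_simp
    ring

lemma prodAB_prodQ_apply (hq0 : q ≠ 0) (hq : ‖q‖ < 1) (hR : ∀ n p, R (shT q n p) = R p) (n k : ℕ)
    {p : Param M} (hb : p.2 0 ≠ 0) (hbt : pochInf q (p.2 0 * t) ≠ 0) :
    prodAB q M n (prodQ q M k
      (fun p => R p * (pochInf q (p.1 0 * t) / pochInf q (p.2 0 * t)))) p =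
      R p * (p.2 0 ^ k * t ^ k * poch q (p.1 0 / p.2 0) (n + k) *
        (pochInf q (q ^ (n + k) * p.1 0 * t) / pochInf q (p.2 0 * t))) := by
  induction n generalizing p with
  | zero =>
    rw [zero_add, ← prodQ_apply hq0 hq hR k hb hbt]
    rfl
  | succ n ih =>
    have e1 := pochInf_eq_one_sub_mul hq (p.2 0 * t)
    have hbt' := hbt
    rw [e1] at hbt'
    have h2 := left_ne_zero_of_mul hbt'
    have h3 : pochInf q ((shT q 1 p).2 0 * t) ≠ 0 := by
      rw [shT_snd_zero, zpow_one, mul_assoc]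
      exact right_ne_zero_of_mul hbt'
    rw [prodAB_succ]
    show prodAB q M n _ p - p.1 0 * q ^ n / p.2 0 * prodAB q M n _ (shT q 1 p) = _
    rw [ih hb hbt, ih (by rw [shT_snd_zero, zpow_one]; exact mul_ne_zero hq0 hb) h3, hR,
      shT_fst_zero, shT_snd_zero, zpow_one, mul_div_mul_left _ _ hq0]
    rw [shT_snd_zero, zpow_one] at h3
    rw [show n + 1 + k = n + k + 1 by ring, poch_succ]
    have e2 := pochInf_eq_one_sub_mul hq (q ^ (n + k) * p.1 0 * t)
    have e3 : q * (q ^ (n + k) * p.1 0 * t) = q ^ (n + k + 1) * p.1 0 * t := by ring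
    have e4 : q ^ (n + k) * (q * p.1 0) * t = q ^ (n + k + 1) * p.1 0 * t := by ring
    have e5 : q * (p.2 0 * t) = q * p.2 0 * t := by ring
    rw [e3] at e2
    rw [e5] at e1
    rw [e4, e2, e1]
    generalize pochInf q (q ^ (n + k + 1) * p.1 0 * t) = X
    generalize pochInf q (q * p.2 0 * t) = Y at *
    field_simp
    ring

end eval

/-- The generating function of the elementary symmetric functions, with the terms k = 0 and k = M +
2 split off as in Ê_M. -/
lemma sum_esymmTail (c : Fin (M + 3) → ℂ) {s : ℂ} (hs : s ≠ 0) :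
    ∏ i : Fin (M + 2), (1 - c i.succ * s) =
      1 + ∑ k ∈ Finset.Icc 1 (M + 1), (-1) ^ k * esymmTail k c * s ^ k +
        (-1) ^ M * (∏ i : Fin (M + 2), c i.succ) * s ^ (M + 2) := by
  have h := congrArg (Polynomial.eval s⁻¹) (Multiset.prod_X_sub_X_eq_sum_esymm
    ((Finset.univ : Finset (Fin (M + 2))).val.map fun i => c i.succ))
  have hcard : (Multiset.map (fun i => c i.succ) (Finset.univ : Finset (Fin (M + 2))).val).card
      = M + 2 := by simp
  rw [hcard, Multiset.map_map, Polynomial.eval_finsetSum] at h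
  have e1 : (Multiset.map ((fun t => Polynomial.X - Polynomial.C t) ∘ fun i => c i.succ)
      (Finset.univ : Finset (Fin (M + 2))).val).prod =
      ∏ i : Fin (M + 2), (Polynomial.X - Polynomial.C (c i.succ)) := rfl
  rw [e1, Polynomial.eval_prod] at h
  simp only [Polynomial.eval_sub, Polynomial.eval_X, Polynomial.eval_C, Polynomial.eval_mul,
    Polynomial.eval_pow, Polynomial.eval_neg, Polynomial.eval_one] at h
  have e2 : ∏ i : Fin (M + 2), (1 - c i.succ * s) =
      s ^ (M + 2) * ∏ i : Fin (M + 2), (s⁻¹ - c i.succ) := by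
    have : s ^ (M + 2) = ∏ _i : Fin (M + 2), s := by simp
    rw [this, ← Finset.prod_mul_distrib]
    refine Finset.prod_congr rfl fun i _ => ?_
    field_simp
  have e3 : ∀ k ≤ M + 2, s ^ (M + 2) * ((-1) ^ k * (esymmTail k c * s⁻¹ ^ (M + 2 - k))) =
      (-1) ^ k * esymmTail k c * s ^ k := by
    intro k hk
    obtain ⟨j, hj⟩ := Nat.exists_eq_add_of_le hk
    rw [hj, Nat.add_sub_cancel_left, inv_pow, pow_add]
    field_simp
  have e4 : ∀ f : ℕ → ℂ, ∑ k ∈ Finset.range (M + 2 + 1), f k =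
      f 0 + ∑ k ∈ Finset.Icc 1 (M + 1), f k + f (M + 2) := fun f => by
    rw [Finset.sum_range_succ, Finset.range_eq_Ico, Finset.sum_eq_sum_Ico_succ_bot (by omega)]
    rfl
  change _ = ∑ x ∈ Finset.range (M + 2 + 1),
    (-1) ^ x * (esymmTail x c * s⁻¹ ^ (M + 2 - x)) at h
  rw [e2, h, Finset.mul_sum, Finset.sum_congr rfl fun k hk =>
    e3 k (Nat.lt_succ_iff.1 (Finset.mem_range.1 hk)), e4]
  have e5 : esymmTail 0 c = 1 := by
    rw [esymmTail, Multiset.esymm, Multiset.powersetCard_zero_left]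
    simp
  have e6 : esymmTail (M + 2) c = ∏ i : Fin (M + 2), c i.succ := by
    have e7 : ∀ S : Multiset ℂ, S.esymm S.card = S.prod := fun S => by
      rw [Multiset.esymm, Multiset.powersetCard_self]
      simp
    have e8 := e7 (Multiset.map (fun i => c i.succ) (Finset.univ : Finset (Fin (M + 2))).val)
    rw [hcard] at e8
    exact e8
  rw [e5, e6, pow_add]
  ring

end QRP

/-! ### The image of the Jackson integrand under Ê_M. -/

namespace QRP

open Filter Topology

variable {q : ℂ} {M : ℕ}

/-- The primitive of the image of the Jackson integrand under `Ê_M`. -/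
noncomputable def opEPrim (q s : ℂ) (p : Param M) : ℂ :=
  pochInf q (q ^ M * p.1 0 * s) * (∏ i : Fin (M + 2), pochInf q (p.1 i.succ * s)) /
    (pochInf q (p.2 0 * s) * ∏ i : Fin (M + 2), pochInf q (p.2 i.succ * (q * s)))

/-- The middle terms of Ê_M share the factor (a / b)_M and combine to (1 - q^M a s) ∏ (1 - a_i s) -
(1 - b s) ∏ (1 - q b_i s), with products over i ≥ 2. The two outer terms supply the missing ends of
these products. The result is Φ(s) - Φ(qs) up to a factor. -/
lemma opE_jackE (hq0 : q ≠ 0) (hq : ‖q‖ < 1) {p : Param M}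
    (hbal : ∏ i, p.1 i = q ^ 2 * ∏ i, p.2 i) (hb : p.2 0 ≠ 0) {s : ℂ} (hs : s ≠ 0)
    (hbs : pochInf q (p.2 0 * s) ≠ 0)
    (hbt : ∀ i : Fin (M + 2), pochInf q (p.2 i.succ * (q * s)) ≠ 0) :
    s * opE q M (jackE q (q * s)) p = poch q (p.1 0 / p.2 0) M * p.2 0 ^ (M + 1) *
      (opEPrim q s p - opEPrim q (q * s) p) := by
  set R : Param M → ℂ := fun p => (∏ i : Fin (M + 2), pochInf q (p.1 i.succ * (q * s))) /
    ∏ i : Fin (M + 2), pochInf q (p.2 i.succ * (q * s)) with hRdef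
  have hR : ∀ n p, R (shT q n p) = R p := fun n p => by
    simp only [hRdef, shT_fst_of_ne q n p (Fin.succ_ne_zero _),
      shT_snd_of_ne q n p (Fin.succ_ne_zero _)]
  have hE : jackE q (q * s) = fun p : Param M =>
      R p * (pochInf q (p.1 0 * (q * s)) / pochInf q (p.2 0 * (q * s))) := by
    funext p
    simp only [jackE, hRdef]
    rw [Fin.prod_univ_succ, Fin.prod_univ_succ (fun i => pochInf q (p.2 i * (q * s)))]
    rw [mul_comm, mul_comm (pochInf q (p.2 0 * (q * s))), mul_div_mul_comm]
  have e1 := pochInf_eq_one_sub_mul hq (p.2 0 * s)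
  have e2 : q * (p.2 0 * s) = p.2 0 * (q * s) := by ring
  rw [e2] at e1
  have hbt0 : pochInf q (p.2 0 * (q * s)) ≠ 0 := right_ne_zero_of_mul (e1 ▸ hbs)
  have hb1 : (shT q (-1) p).2 0 ≠ 0 := by
    rw [shT_snd_zero]
    exact mul_ne_zero (zpow_ne_zero _ hq0) hb
  have e3 : (shT q (-1) p).2 0 * (q * s) = p.2 0 * s := by
    rw [shT_snd_zero, zpow_neg_one]
    field_simp
  have e4 : ∀ n : ℕ, q ^ n * (shT q (-1) p).1 0 * (q * s) = q ^ n * p.1 0 * s := fun n => by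
    rw [shT_fst_zero, zpow_neg_one]
    field_simp
  have e5 : (shT q (-1) p).1 0 / (shT q (-1) p).2 0 = p.1 0 / p.2 0 := by
    rw [shT_fst_zero, shT_snd_zero, mul_div_mul_left _ _ (zpow_ne_zero _ hq0)]
  have e6 : ∀ n : ℕ, q ^ n * p.1 0 * (q * s) = q ^ (n + 1) * p.1 0 * s := fun n => by ring
  have e7 := pochInf_eq_one_sub_mul hq (q ^ M * p.1 0 * s)
  rw [show q * (q ^ M * p.1 0 * s) = q ^ (M + 1) * p.1 0 * s by ring] at e7
  set G : Param M → ℂ := fun p =>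
      R p * (pochInf q (p.1 0 * (q * s)) / pochInf q (p.2 0 * (q * s))) with hG
  set a := p.1 0 with ha
  set b := p.2 0 with hbdef
  set X := pochInf q (q ^ (M + 1) * a * s) with hX
  set Y := pochInf q (b * (q * s)) with hY
  set A := poch q (a / b) M with hA
  have hY1 : 1 - b * s ≠ 0 := left_ne_zero_of_mul (e1 ▸ hbs)
  have F1 : prodAB q M (M + 1) G (shT q (-1) p) =
      R p * (A * (1 - a / b * q ^ M) * (X / ((1 - b * s) * Y))) := by
    have := prodAB_prodQ_apply hq0 hq hR (M + 1) 0 hb1 (e3.symm ▸ hbs)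
    rw [e3, e4, e5, hR, e1, add_zero, poch_succ] at this
    simpa [prodQ] using this
  have F2 : prodQ q M (M + 1) G (shT q (-1) p) =
      R p * ((b * s) ^ (M + 1) * (A * (1 - a / b * q ^ M)) * (X / ((1 - b * s) * Y))) := by
    have := prodQ_apply hq0 hq hR (M + 1) hb1 (e3.symm ▸ hbs)
    rw [← mul_pow, e3, e4, e5, hR, e1, poch_succ] at this
    exact this
  -- For every k the numbers of factors of the two products add up to (M + 1 - k) + (k - 1) = M, so
  -- the shifted factorial is the same for all k.
  have F3 : ∀ k ∈ Finset.Icc 1 (M + 1),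
      prodAB q M (M + 1 - k) (prodQ q M (k - 1) G) (shT q (-1) p) =
      R p * ((b * s) ^ (k - 1) * A * ((1 - q ^ M * a * s) * X / ((1 - b * s) * Y))) := by
    intro k hk
    obtain ⟨h1, h2⟩ := Finset.mem_Icc.1 hk
    have := prodAB_prodQ_apply hq0 hq hR (M + 1 - k) (k - 1) hb1 (e3.symm ▸ hbs)
    rw [← mul_pow, e3, e4, e5, hR, e1, show M + 1 - k + (k - 1) = M by omega, e7] at this
    exact this
  have F4 : ∀ k ∈ Finset.Icc 1 (M + 1),
      prodAB q M (M + 1 - k) (prodQ q M (k - 1) G) p =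
      R p * (b ^ (k - 1) * (q * s) ^ (k - 1) * A * (X / Y)) := by
    intro k hk
    obtain ⟨h1, h2⟩ := Finset.mem_Icc.1 hk
    have := prodAB_prodQ_apply hq0 hq hR (M + 1 - k) (k - 1) hb hbt0
    rw [show M + 1 - k + (k - 1) = M by omega, e6] at this
    exact this
  have hopE : opE q M G p = b ^ (M + 2) * prodAB q M (M + 1) G (shT q (-1) p) +
      (∑ k ∈ Finset.Icc 1 (M + 1), (-1) ^ k * b ^ (M + 2 - k) *
        (esymmTail k p.1 * prodAB q M (M + 1 - k) (prodQ q M (k - 1) G) (shT q (-1) p) -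
          q * esymmTail k p.2 * prodAB q M (M + 1 - k) (prodQ q M (k - 1) G) p)) +
      (-1) ^ M * (∏ i : Fin (M + 2), p.1 i.succ) * prodQ q M (M + 1) G (shT q (-1) p) := by
    simp only [opE, LinearMap.add_apply, LinearMap.sum_apply, Pi.add_apply, Finset.sum_apply]
    rfl
  rw [hE, hopE, F1, F2]
  have hsum : ∑ k ∈ Finset.Icc 1 (M + 1), (-1) ^ k * b ^ (M + 2 - k) *
        (esymmTail k p.1 * prodAB q M (M + 1 - k) (prodQ q M (k - 1) G) (shT q (-1) p) -
          q * esymmTail k p.2 * prodAB q M (M + 1 - k) (prodQ q M (k - 1) G) p) =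
      R p * A * b ^ (M + 1) * s⁻¹ * (X / ((1 - b * s) * Y)) *
        ((1 - q ^ M * a * s) * (∑ k ∈ Finset.Icc 1 (M + 1), (-1) ^ k * esymmTail k p.1 * s ^ k) -
         (1 - b * s) *
          (∑ k ∈ Finset.Icc 1 (M + 1), (-1) ^ k * esymmTail k p.2 * (q * s) ^ k)) := by
    rw [Finset.mul_sum, Finset.mul_sum, ← Finset.sum_sub_distrib, Finset.mul_sum]
    refine Finset.sum_congr rfl fun k hk => ?_
    rw [F3 k hk, F4 k hk]
    obtain ⟨h1, h2⟩ := Finset.mem_Icc.1 hk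
    obtain ⟨j, rfl⟩ := Nat.exists_eq_add_of_le' h1
    obtain ⟨n, hn⟩ := Nat.exists_eq_add_of_le h2
    rw [show M + 2 - (j + 1) = n + 1 by omega, Nat.add_sub_cancel, show M + 1 = n + 1 + j by omega]
    field_simp
    ring
  rw [hsum]
  have g1 := sum_esymmTail p.1 hs
  have g2 := sum_esymmTail p.2 (mul_ne_zero hq0 hs)
  set S1 := ∑ k ∈ Finset.Icc 1 (M + 1), (-1) ^ k * esymmTail k p.1 * s ^ k
  set S2 := ∑ k ∈ Finset.Icc 1 (M + 1), (-1) ^ k * esymmTail k p.2 * (q * s) ^ k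
  have P1 : opEPrim q s p = R p * (X / ((1 - b * s) * Y)) *
      ((1 - q ^ M * a * s) * ∏ i : Fin (M + 2), (1 - p.1 i.succ * s)) := by
    have h1 : ∏ i : Fin (M + 2), pochInf q (p.1 i.succ * s) =
        (∏ i : Fin (M + 2), (1 - p.1 i.succ * s)) *
          ∏ i : Fin (M + 2), pochInf q (p.1 i.succ * (q * s)) := by
      rw [← Finset.prod_mul_distrib]
      refine Finset.prod_congr rfl fun i _ => ?_
      rw [pochInf_eq_one_sub_mul hq (p.1 i.succ * s)]
      congr 2
      ring
    rw [opEPrim, h1, e7, e1, hRdef]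
    simp only [div_eq_mul_inv, mul_inv]
    ring
  have P2 : opEPrim q (q * s) p = R p * (X / ((1 - b * s) * Y)) *
      ((1 - b * s) * ∏ i : Fin (M + 2), (1 - p.2 i.succ * (q * s))) := by
    have h1 : ∏ i : Fin (M + 2), pochInf q (p.2 i.succ * (q * s)) =
        (∏ i : Fin (M + 2), (1 - p.2 i.succ * (q * s))) *
          ∏ i : Fin (M + 2), pochInf q (p.2 i.succ * (q * (q * s))) := by
      rw [← Finset.prod_mul_distrib]
      refine Finset.prod_congr rfl fun i _ => ?_
      rw [pochInf_eq_one_sub_mul hq (p.2 i.succ * (q * s))]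
      congr 2
      ring
    have h2 : ∏ i : Fin (M + 2), pochInf q (p.2 i.succ * (q * s)) ≠ 0 :=
      Finset.prod_ne_zero_iff.2 fun i _ => hbt i
    have h0 : opEPrim q (q * s) p = X * (∏ i : Fin (M + 2), pochInf q (p.1 i.succ * (q * s))) /
        (Y * ∏ i : Fin (M + 2), pochInf q (p.2 i.succ * (q * (q * s)))) := by
      rw [opEPrim, e6]
    have h3 : R p = (∏ i : Fin (M + 2), pochInf q (p.1 i.succ * (q * s))) /
        ∏ i : Fin (M + 2), pochInf q (p.2 i.succ * (q * s)) := rfl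
    rw [h0, h3]
    rw [h1] at h2 ⊢
    have h3 := left_ne_zero_of_mul h2
    have h4 := right_ne_zero_of_mul h2
    generalize ∏ i : Fin (M + 2), pochInf q (p.1 i.succ * (q * s)) = N1
    generalize ∏ i : Fin (M + 2), pochInf q (p.2 i.succ * (q * (q * s))) = N2 at *
    generalize ∏ i : Fin (M + 2), (1 - p.2 i.succ * (q * s)) = N3 at *
    generalize 1 - b * s = N4 at *
    field_simp
  rw [P1, P2, g1, g2]
  rw [Fin.prod_univ_succ p.1, Fin.prod_univ_succ p.2] at hbal
  set ea := ∏ i : Fin (M + 2), p.1 i.succ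
  set eb := ∏ i : Fin (M + 2), p.2 i.succ
  have hbal' : a * ea = q ^ 2 * (b * eb) := hbal
  generalize R p = r
  have hZ : X / ((1 - b * s) * Y) = X / ((1 - b * s) * Y) := rfl
  generalize X / ((1 - b * s) * Y) = Z
  have k1 : b * (1 - a / b * q ^ M) = b - a * q ^ M := by field_simp
  have k2 : s * (r * A * b ^ (M + 1) * s⁻¹ * Z * ((1 - q ^ M * a * s) * S1 - (1 - b * s) * S2)) =
      r * A * b ^ (M + 1) * Z * ((1 - q ^ M * a * s) * S1 - (1 - b * s) * S2) := by field_simp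
  have k3 : ea * (1 - a / b * q ^ M) = ea - q ^ (M + 2) * eb := by
    field_simp
    linear_combination -q ^ M * hbal'
  have k4 : s * (b ^ (M + 2) * (r * (A * (1 - a / b * q ^ M) * Z))) =
      s * r * A * Z * b ^ (M + 1) * (b * (1 - a / b * q ^ M)) := by ring
  have k5 : s * ((-1) ^ M * ea * (r * ((b * s) ^ (M + 1) * (A * (1 - a / b * q ^ M)) * Z))) =
      (-1) ^ M * r * b ^ (M + 1) * A * Z * s ^ (M + 2) * (ea * (1 - a / b * q ^ M)) := by
    rw [mul_pow]
    ring
  rw [mul_add, mul_add, k2, k4, k5, k1, k3]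
  rw [mul_pow q s (M + 2)]
  -- All that is left is the coefficient of s^(M+3), which is zero by the balancing condition.
  linear_combination r * A * Z * b ^ (M + 1) * (-1) ^ M * s ^ (M + 3) * q ^ M * hbal'

end QRP

/-! ### Ê_M on the Jackson integrals. -/

namespace QRP

open Filter Topology

variable {q : ℂ} {M : ℕ}

/-- An operator acts on functions on the whole parameter space, while the key formula holds only on
D; locality permits the replacement at the points T^n p alone. -/
lemma InShiftRange.congr {lo hi : ℤ} {A : Op M} (hA : InShiftRange q lo hi A) {p : Param M}
    {y y' : Param M → ℂ} (h : ∀ n, lo ≤ n → n ≤ hi → y (shT q n p) = y' (shT q n p)) :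
    A y p = A y' p := by
  have key : ∀ φ ∈ evalSpan q lo hi p, φ y = φ y' := by
    intro φ hφ
    induction hφ using Submodule.span_induction with
    | mem φ hφ =>
      obtain ⟨n, h1, h2, rfl⟩ := hφ
      exact h n h1 h2
    | zero => rfl
    | add φ ψ _ _ h1 h2 => rw [LinearMap.add_apply, LinearMap.add_apply, h1, h2]
    | smul c φ _ h => rw [LinearMap.smul_apply, LinearMap.smul_apply, h]
  exact key _ (hA p)

/-- At p the operator is a finite combination of evaluations at T^n p. T does not touch a_i, so all
these integrals run over one lattice and the sum commutes with the operator. -/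
lemma InShiftRange.hasSum_jackS (hq0 : q ≠ 0) (hq : ‖q‖ < 1) {lo hi : ℤ} {A : Op M}
    (hA : InShiftRange q lo hi A) {p : Param M} {i : Fin (M + 3)} (hi0 : i ≠ 0) (hp : p.1 i ≠ 0)
    (h : ∀ n, lo ≤ n → n ≤ hi → Admissible q i (shT q n p)) :
    HasSum (fun m : ℤ => q ^ m * (p.1 i)⁻¹ * A (jackE q (q ^ m * (p.1 i)⁻¹)) p)
      (A (jackS q i) p) := by
  have key : ∀ φ ∈ evalSpan q lo hi p,
      HasSum (fun m : ℤ => q ^ m * (p.1 i)⁻¹ * φ (jackE q (q ^ m * (p.1 i)⁻¹)))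
        (φ (jackS q i)) := by
    intro φ hφ
    induction hφ using Submodule.span_induction with
    | mem φ hφ =>
      obtain ⟨n, h1, h2, rfl⟩ := hφ
      have ht : ∃ k : ℤ, (shT q n p).1 i * (p.1 i)⁻¹ = q ^ k := ⟨0, by
        rw [shT_fst_of_ne q n p hi0, mul_inv_cancel₀ hp, zpow_zero]⟩
      simp only [LinearMap.proj_apply]
      exact (h n h1 h2).hasSum hq0 hq ht
    | zero =>
      simp only [LinearMap.zero_apply, mul_zero]
      exact hasSum_zero
    | add φ ψ _ _ h1 h2 =>
      simp only [LinearMap.add_apply, mul_add]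
      exact h1.add h2
    | smul c φ _ h =>
      simp only [LinearMap.smul_apply, smul_eq_mul, mul_left_comm _ c]
      exact h.mul_left c
  have := key _ (hA p)
  simp only [LinearMap.comp_apply, LinearMap.proj_apply] at this
  exact this

lemma pochInf_pow_succ_ne_zero (hq : ‖q‖ < 1) (n : ℕ) : pochInf q (q ^ (n + 1)) ≠ 0 :=
  pochInf_ne_zero hq fun i h => by
    have h1 : ‖q ^ (n + 1) * q ^ i‖ < 1 := by
      rw [← pow_add, norm_pow]
      exact pow_lt_one₀ (norm_nonneg _) hq (by omega)
    rw [← sub_eq_zero.1 h, norm_one] at h1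
    exact lt_irrefl _ h1

lemma tendsto_opEPrim (hq : ‖q‖ < 1) (p : Param M) (w : ℂ) :
    Tendsto (fun n : ℕ => opEPrim q (q ^ n * w) p) atTop (𝓝 1) := by
  have h : ∀ (c : ℂ) {f : ℕ → ℂ}, (∀ n, f n = c * q ^ n) →
      Tendsto (fun n => pochInf q (f n)) atTop (𝓝 1) := fun c f hf => by
    simp only [hf]
    exact tendsto_pochInf_mul_pow hq c
  have hn := (h (q ^ M * p.1 0 * w) (f := fun n => q ^ M * p.1 0 * (q ^ n * w))
      (fun n => by ring)).mul
    (tendsto_finsetProd (Finset.univ : Finset (Fin (M + 2))) fun i _ =>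
      h (p.1 i.succ * w) (f := fun n => p.1 i.succ * (q ^ n * w)) fun n => by ring)
  have hd := (h (p.2 0 * w) (f := fun n => p.2 0 * (q ^ n * w)) (fun n => by ring)).mul
    (tendsto_finsetProd (Finset.univ : Finset (Fin (M + 2))) fun i _ =>
      h (p.2 i.succ * (q * w)) (f := fun n => p.2 i.succ * (q * (q ^ n * w))) fun n => by ring)
  simp only [Finset.prod_const_one, mul_one] at hn hd
  have := hn.div hd one_ne_zero
  rw [div_one] at this
  exact this

/-- The sum over the lattice telescopes from Φ(1 / a_i) = 0 to the limit 1. The value is free of i,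
which is all that matters for the difference of two integrals. -/
lemma opE_jackS (hq0 : q ≠ 0) (hq : ‖q‖ < 1) {p : Param M} {i : Fin (M + 3)} (hi0 : i ≠ 0)
    (hbal : ∏ i, p.1 i = q ^ 2 * ∏ i, p.2 i) (hb : p.2 0 ≠ 0)
    (h : ∀ n : ℤ, -1 ≤ n → n ≤ M → Admissible q i (shT q n p)) :
    opE q M (jackS q i) p = -(q * (poch q (p.1 0 / p.2 0) M * p.2 0 ^ (M + 1))) := by
  have hp : Admissible q i p := by simpa only [shT_zero] using h 0 (by norm_num) (by positivity)
  have hα := hp.a_ne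
  obtain ⟨j, rfl⟩ := Fin.exists_succ_eq.2 hi0
  have hsum := (InShiftRange.opE hq0).hasSum_jackS hq0 hq hi0 hα h
  set α := p.1 j.succ with hαdef
  set κ := poch q (p.1 0 / p.2 0) M * p.2 0 ^ (M + 1) with hκ
  have hinj : Function.Injective fun n : ℕ => (n : ℤ) + 1 := fun a b hab => by
    simpa using hab
  rw [← hinj.hasSum_iff] at hsum
  · have hterm : ∀ n : ℕ, q ^ ((n : ℤ) + 1) * α⁻¹ *
        opE q M (jackE q (q ^ ((n : ℤ) + 1) * α⁻¹)) p =
        q * κ * (opEPrim q (q ^ n * α⁻¹) p - opEPrim q (q ^ (n + 1) * α⁻¹) p) := by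
      intro n
      have e1 : q ^ ((n : ℤ) + 1) * α⁻¹ = q * (q ^ n * α⁻¹) := by
        rw [zpow_add_one₀ hq0, zpow_natCast]
        ring
      have hm : ∀ {p' : Param M}, p'.1 j.succ = α →
          p'.1 j.succ * (q * (q ^ n * α⁻¹)) = q ^ (n + 1) := fun h' => by
        rw [h']
        field_simp
        ring
      have hz : ((n + 1 : ℕ) : ℤ) = (n : ℤ) + 1 := by push_cast; ring
      have hgood : ∀ {p' : Param M}, Admissible q j.succ p' → p'.1 j.succ = α → ∀ k,
          pochInf q (p'.2 k * (q * (q ^ n * α⁻¹))) ≠ 0 := fun h' hα' k =>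
        h'.ne_zero hq0 hq ⟨((n + 1 : ℕ) : ℤ), by rw [hm hα', zpow_natCast]⟩
          (by rw [hm hα']; exact pochInf_pow_succ_ne_zero hq n) k
      have hb0 := hgood (h (-1) le_rfl (by omega)) (shT_fst_of_ne q _ p hi0) 0
      rw [shT_snd_zero, zpow_neg_one, show q⁻¹ * p.2 0 * (q * (q ^ n * α⁻¹)) =
        p.2 0 * (q ^ n * α⁻¹) by field_simp] at hb0
      have := opE_jackE hq0 hq hbal hb
        (mul_ne_zero (pow_ne_zero n hq0) (inv_ne_zero hα)) hb0
        (fun k => hgood hp rfl k.succ)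
      rw [e1, mul_assoc, this, show q ^ (n + 1) * α⁻¹ = q * (q ^ n * α⁻¹) by ring]
      ring
    simp only [Function.comp_def, hterm] at hsum
    have h0 : opEPrim q (q ^ 0 * α⁻¹) p = 0 := by
      rw [opEPrim, Finset.prod_eq_zero (Finset.mem_univ j), mul_zero, zero_div]
      rw [pow_zero, one_mul, ← hαdef, mul_inv_cancel₀ hα]
      exact pochInf_eq_zero hq (i := 0) (by simp)
    refine tendsto_nhds_unique hsum.tendsto_sum_nat ?_
    simp only [← Finset.mul_sum]
    simp only [Finset.sum_range_sub' (fun n => opEPrim q (q ^ n * α⁻¹) p)]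
    rw [h0]
    have := ((tendsto_opEPrim hq p α⁻¹).const_sub 0).const_mul (q * κ)
    convert this using 2
    ring
  · intro m hm
    have hm0 : m ≤ 0 := by
      by_contra hm0
      exact hm ⟨(m - 1).toNat, by simp only; omega⟩
    -- For m ≤ 0 the integrand vanishes at every T^n p, since a_i is unchanged by T.
    have : opE q M (jackE q (q ^ m * α⁻¹)) p = opE q M 0 p := by
      refine (InShiftRange.opE hq0).congr fun n _ _ => ?_
      refine jackE_eq_zero (i := j.succ) ?_
      rw [shT_fst_of_ne q _ p hi0, ← hαdef, mul_left_comm, mul_inv_cancel₀ hα, mul_one]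
      exact pochInf_zpow_eq_zero hq0 hq hm0
    rw [this, map_zero]
    simp

end QRP

namespace QRP

open Filter Topology

variable {q : ℂ} {M : ℕ}

/-! ### The normalized series as a Jackson integral -/

lemma prod_fin_add_three (g : Fin (M + 3) → ℂ) :
    ∏ i, g i = (∏ i : Fin M, g (Fin.castAdd 3 i)) *
      (g (Fin.natAdd M 0) * g (Fin.natAdd M 1) * g (Fin.natAdd M 2)) := by
  rw [Fin.prod_univ_add, Fin.prod_univ_three]

lemma prod_fin_add_two (g : Fin (M + 3) → ℂ) :
    ∏ j : Fin (M + 2), g (Fin.castSucc j) = (∏ i : Fin M, g (Fin.castAdd 3 i)) *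
      (g (Fin.natAdd M 0) * g (Fin.natAdd M 1)) := by
  rw [Fin.prod_univ_add, Fin.prod_univ_two]
  rfl

namespace InDomain

variable {p : Param M}

lemma admissible_two (h : InDomain q p) : Admissible q (Fin.natAdd M 1) p := ⟨h.a_ne _, h.bM2_ne⟩

lemma admissible_three (h : InDomain q p) : Admissible q (Fin.natAdd M 2) p := ⟨h.a_ne _, h.bM3_ne⟩

lemma aM2_ne (h : InDomain q p) : p.aM2 ≠ 0 := h.a_ne _

lemma aM3_ne (h : InDomain q p) : p.aM3 ≠ 0 := h.a_ne _

lemma bM3_ne' (h : InDomain q p) : p.bM3 ≠ 0 := h.b_ne _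

lemma generic (h : InDomain q p) (hq0 : q ≠ 0) (hq : ‖q‖ < 1) :
    Generic q (q * p.bM3 / (p.aM2 * p.aM3)) p.aInit where
  a_ne := div_ne_zero (mul_ne_zero hq0 h.bM3_ne') (mul_ne_zero h.aM2_ne h.aM3_ne)
  x_ne i := h.a_ne _
  ax_ne i := by
    rw [pochInf_eq_one_sub_mul hq]
    refine mul_ne_zero (h.series_ne.one_sub_ne i) ?_
    convert h.ab_ne i using 2
    ring
  ratio_ne i j n hn := one_sub_ne_zero_of_poch (h.series_ne.xx_ne i j) n (sub_eq_zero.2 hn.symm)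
  inj i j hij he := by
    have hv := h.series_ne.vandermonde_ne
    simp only [vandermonde, Finset.prod_ne_zero_iff, Finset.mem_univ, Finset.mem_Ioi,
      true_implies, sub_ne_zero] at hv
    rcases lt_or_gt_of_ne hij with h1 | h1
    · exact hv i j h1 he
    · exact hv j i h1 he.symm

lemma a_mul_div_v (h : InDomain q p) (hq0 : q ≠ 0) (w : ℂ) :
    p.kA q * q * w / p.kV q 0 = q * w / p.aM3 ∧ p.kA q * q * w / p.kV q 1 = q * w / p.aM2 := by
  have h1 := h.aM2_ne
  have h2 := h.aM3_ne
  have h3 := h.bM3_ne'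
  simp only [Param.kA, Param.kV, Matrix.cons_val_zero, Matrix.cons_val_one]
  constructor <;> field_simp

lemma x_aM3_ne (h : InDomain q p) (hq0 : q ≠ 0) (i : Fin M) (n : ℕ) :
    poch q (q * p.aInit i / p.aM3) n ≠ 0 := by
  have := h.series_ne.xv_ne i 0 n
  rwa [(h.a_mul_div_v hq0 _).1] at this

lemma x_aM2_ne (h : InDomain q p) (hq0 : q ≠ 0) (i : Fin M) (n : ℕ) :
    poch q (q * p.aInit i / p.aM2) n ≠ 0 := by
  have := h.series_ne.xv_ne i 1 n
  rwa [(h.a_mul_div_v hq0 _).2] at this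

end InDomain

lemma mul_jb_eq (hq : ‖q‖ < 1) (α β : ℂ) {b : ℂ} (hb : pochInf q (q * b / β) ≠ 0) (n : ℕ) :
    (pochInf q (b * (q ^ (n + 1) / β)))⁻¹ * (pochInf q (q * b / α) * pochInf q (q * b / β)) =
      jb q α β b n := by
  have h1 := pochInf_eq_poch_mul hq (q * b / β) n
  rw [show q * b / β * q ^ n = b * (q ^ (n + 1) / β) by ring] at h1
  rw [h1] at hb
  have := right_ne_zero_of_mul hb
  rw [h1, jb]
  generalize pochInf q (b * (q ^ (n + 1) / β)) = X at *
  field_simp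

/-- Multiplying by all (q b_j / α)_∞ (q b_j / β)_∞ replaces each 1 / (b_j t)_∞ by its regularization
`jb`. -/
lemma jackS_three_mul (hq0 : q ≠ 0) (hq : ‖q‖ < 1) {p : Param M} (h : InDomain q p) :
    jackS q (Fin.natAdd M 2) p *
      ∏ j, (pochInf q (q * p.2 j / p.aM2) * pochInf q (q * p.2 j / p.aM3)) =
    jHalf q p.aM2 p.aM3 p.aInit p.aM1 (fun j => p.2 (Fin.castAdd 3 j)) (p.2 (Fin.natAdd M 0))
      (p.2 (Fin.natAdd M 1)) p.bM3 := by
  rw [h.admissible_three.jackS_eq hq0 hq, jHalf, ← tsum_mul_right]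
  refine tsum_congr fun n => ?_
  have h3 := h.aM3_ne
  rw [show p.1 (Fin.natAdd M 2) = p.aM3 from rfl, jackE, div_eq_mul_inv (∏ i, _),
    ← Finset.prod_inv_distrib, mul_assoc, mul_assoc,
    ← Finset.prod_mul_distrib, Finset.prod_congr rfl fun j _ =>
      mul_jb_eq hq p.aM2 p.aM3 (h.bM3_ne j) n, prod_fin_add_three, prod_fin_add_three]
  have e : ∀ w : ℂ, w * (q ^ (n + 1) / p.aM3) = w * q ^ (n + 1) / p.aM3 :=
    fun w => by rw [mul_div_assoc]
  have e2 : p.1 (Fin.natAdd M 2) * q ^ (n + 1) / p.aM3 = q ^ (n + 1) := mul_div_cancel_left₀ _ h3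
  simp only [e, e2, jTerm]
  simp only [Param.aInit, Param.aM1, Param.aM2, Param.aM3, Param.bM3]
  have e3 : Fin.last (M + 2) = (Fin.natAdd M 2 : Fin (M + 3)) := rfl
  rw [e3]
  ring

lemma jackS_two_mul (hq0 : q ≠ 0) (hq : ‖q‖ < 1) {p : Param M} (h : InDomain q p) :
    jackS q (Fin.natAdd M 1) p *
      ∏ j, (pochInf q (q * p.2 j / p.aM2) * pochInf q (q * p.2 j / p.aM3)) =
    jHalf q p.aM3 p.aM2 p.aInit p.aM1 (fun j => p.2 (Fin.castAdd 3 j)) (p.2 (Fin.natAdd M 0))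
      (p.2 (Fin.natAdd M 1)) p.bM3 := by
  rw [h.admissible_two.jackS_eq hq0 hq, jHalf, ← tsum_mul_right]
  refine tsum_congr fun n => ?_
  have h3 := h.aM2_ne
  rw [show p.1 (Fin.natAdd M 1) = p.aM2 from rfl, jackE, div_eq_mul_inv (∏ i, _),
    ← Finset.prod_inv_distrib, mul_assoc, mul_assoc,
    Finset.prod_congr rfl fun j _ => mul_comm (pochInf q (q * p.2 j / p.aM2)) _,
    ← Finset.prod_mul_distrib, Finset.prod_congr rfl fun j _ =>
      mul_jb_eq hq p.aM3 p.aM2 (h.bM2_ne j) n, prod_fin_add_three, prod_fin_add_three]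
  have e : ∀ w : ℂ, w * (q ^ (n + 1) / p.aM2) = w * q ^ (n + 1) / p.aM2 :=
    fun w => by rw [mul_div_assoc]
  have e2 : p.1 (Fin.natAdd M 1) * q ^ (n + 1) / p.aM2 = q ^ (n + 1) := mul_div_cancel_left₀ _ h3
  simp only [e, e2, jTerm]
  simp only [Param.aInit, Param.aM1, Param.aM2, Param.aM3, Param.bM3]
  have e3 : Fin.last (M + 2) = (Fin.natAdd M 2 : Fin (M + 3)) := rfl
  rw [e3]
  ring

/-- The factor between the terms of Kajihara's series and those of the normalized series. -/
noncomputable def kFactor (q : ℂ) (p : Param M) : ℂ :=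
  (∏ i : Fin M, pochInf q (q * p.aInit i / p.aM2) * pochInf q (q * p.aInit i / p.aM3) /
      pochInf q (q ^ 2 * p.aInit i * p.bM3 / (p.aM2 * p.aM3))) *
    ∏ j : Fin (M + 2), pochInf q (q ^ 2 * p.bInit j * p.bM3 / (p.aM2 * p.aM3))

lemma kFactor_ne_zero (hq0 : q ≠ 0) (hq : ‖q‖ < 1) {p : Param M} (h : InDomain q p) :
    kFactor q p ≠ 0 := by
  refine mul_ne_zero (Finset.prod_ne_zero_iff.2 fun i _ => div_ne_zero (mul_ne_zero ?_ ?_)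
    (h.ab_ne i)) (Finset.prod_ne_zero_iff.2 fun j _ => ?_)
  · exact pochInf_ne_zero_of_poch hq (h.x_aM2_ne hq0 i)
  · exact pochInf_ne_zero_of_poch hq (h.x_aM3_ne hq0 i)
  · have := pochInf_ne_zero_of_poch hq (h.series_ne.au_ne j)
    convert this using 2
    simp only [Param.kA, Param.kU]
    field_simp

/-- Finite shifted factorials in the denominators are traded for infinite products by (w)_n (w
q^n)_∞ = (w)_∞, and v_1 = a β, v_2 = a α for α = a_{M+2}, β = a_{M+3}. -/
lemma kFactor_mul_kajiharaTerm (hq0 : q ≠ 0) (hq : ‖q‖ < 1) {p : Param M} (h : InDomain q p)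
    (l : Fin M → ℕ) :
    kFactor q p * kajiharaTerm q p.aInit (p.kA q) p.kU (p.kV q) p.kZ l =
      kTerm q (q * p.bM3 / (p.aM2 * p.aM3)) p.aM2 p.aM3 (p.aM1 / p.bM3) p.aInit
        (fun j => p.2 (Fin.castAdd 3 j)) (p.2 (Fin.natAdd M 0)) (p.2 (Fin.natAdd M 1)) l := by
  have h1 := h.aM2_ne
  have h2 := h.aM3_ne
  have h3 := h.bM3_ne'
  set a := q * p.bM3 / (p.aM2 * p.aM3) with ha
  have hkA : p.kA q = a := rfl
  set L := ∑ i, l i with hL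
  have hi : ∀ i : Fin M, pochInf q (q * p.aInit i / p.aM2) * pochInf q (q * p.aInit i / p.aM3) /
      pochInf q (q ^ 2 * p.aInit i * p.bM3 / (p.aM2 * p.aM3)) *
      ((1 - a * p.aInit i * q ^ (L + l i)) / (1 - a * p.aInit i) *
      (poch q (a * p.aInit i) L * ∏ j, poch q (p.aInit i * p.kU j) (l i)) /
      ((∏ j, poch q (q * p.aInit i / p.aInit j) (l i)) *
        ∏ k, poch q (a * q * p.aInit i / p.kV q k) (l i))) =
      ((1 - a * p.aInit i * q ^ (L + l i)) *
      (pochInf q (q * p.aInit i / p.aM2 * q ^ l i) * pochInf q (q * p.aInit i / p.aM3 * q ^ l i)) /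
      (pochInf q (a * p.aInit i * q ^ L) * ∏ j, poch q (q * p.aInit i / p.aInit j) (l i))) *
      ∏ j : Fin (M + 2), poch q (p.aInit i / p.2 j.castSucc) (l i) := by
    intro i
    have hu : ∏ j, poch q (p.aInit i * p.kU j) (l i) =
        ∏ j : Fin (M + 2), poch q (p.aInit i / p.2 j.castSucc) (l i) :=
      Finset.prod_congr rfl fun j _ => by rw [Param.kU, mul_one_div]; rfl
    have hv := h.a_mul_div_v hq0 (p.aInit i)
    rw [hkA] at hv
    rw [hu, Fin.prod_univ_two, hv.1, hv.2]
    have e1 := pochInf_eq_poch_mul hq (q * p.aInit i / p.aM2) (l i)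
    have e2 := pochInf_eq_poch_mul hq (q * p.aInit i / p.aM3) (l i)
    have e3 := pochInf_eq_poch_mul hq (a * p.aInit i) L
    rw [pochInf_eq_one_sub_mul hq (a * p.aInit i),
      show q * (a * p.aInit i) = q ^ 2 * p.aInit i * p.bM3 / (p.aM2 * p.aM3) by rw [ha]; ring] at e3
    have n1 := h.x_aM2_ne hq0 i (l i)
    have n2 := h.x_aM3_ne hq0 i (l i)
    have n3 := h.series_ne.one_sub_ne i
    rw [hkA] at n3
    have n4 := mul_ne_zero n3 (h.ab_ne i)
    rw [e3] at n4
    have n5 := left_ne_zero_of_mul n4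
    have n6 := right_ne_zero_of_mul n4
    have e4 : pochInf q (q ^ 2 * p.aInit i * p.bM3 / (p.aM2 * p.aM3)) =
        poch q (a * p.aInit i) L * pochInf q (a * p.aInit i * q ^ L) / (1 - a * p.aInit i) := by
      rw [← e3, mul_div_cancel_left₀ _ n3]
    have n7 : ∏ j, poch q (q * p.aInit i / p.aInit j) (l i) ≠ 0 :=
      Finset.prod_ne_zero_iff.2 fun j _ => h.series_ne.xx_ne i j _
    rw [e1, e2, e4]
    generalize ∏ j, poch q (q * p.aInit i / p.aInit j) (l i) = A1 at *
    generalize ∏ j : Fin (M + 2), poch q (p.aInit i / p.2 j.castSucc) (l i) = A2 at *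
    generalize pochInf q (q * p.aInit i / p.aM2 * q ^ l i) = A3 at *
    generalize pochInf q (q * p.aInit i / p.aM3 * q ^ l i) = A4 at *
    generalize poch q (q * p.aInit i / p.aM2) (l i) = A5 at *
    generalize poch q (q * p.aInit i / p.aM3) (l i) = A6 at *
    generalize pochInf q (a * p.aInit i * q ^ L) = A7 at *
    generalize poch q (a * p.aInit i) L = A8 at *
    generalize 1 - a * p.aInit i = A9 at *
    generalize 1 - a * p.aInit i * q ^ (L + l i) = A10 at *
    field_simp
  have hj : ∀ j : Fin (M + 2), pochInf q (q ^ 2 * p.bInit j * p.bM3 / (p.aM2 * p.aM3)) *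
      (poch q (a * q / p.kU j) L)⁻¹ = pochInf q (a * q * p.2 j.castSucc * q ^ L) := by
    intro j
    have e1 : a * q / p.kU j = a * q * p.2 j.castSucc := by
      rw [Param.kU, div_div_eq_mul_div, div_one]
      rfl
    have n1 := h.series_ne.au_ne j L
    rw [hkA, e1] at n1
    have e2 : q ^ 2 * p.bInit j * p.bM3 / (p.aM2 * p.aM3) = a * q * p.2 j.castSucc := by
      rw [ha, Param.bInit]
      ring
    rw [e1, e2, pochInf_eq_poch_mul hq _ L]
    field_simp
  have hv0 : p.kV q 0 = a * p.aM3 := by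
    simp only [Param.kV, Matrix.cons_val_zero, ha]
    field_simp
  have hv1 : p.kV q 1 = a * p.aM2 := by
    show q * p.bM3 / p.aM3 = a * p.aM2
    rw [ha]
    field_simp
  have hb : (∏ j : Fin (M + 2), pochInf q (a * q * p.2 j.castSucc * q ^ L)) *
      (∏ i, ∏ j : Fin (M + 2), poch q (p.aInit i / p.2 j.castSucc) (l i)) =
      (∏ j : Fin M, bfac q a p.aInit (p.2 (Fin.castAdd 3 j)) l L) *
      (bfac q a p.aInit (p.2 (Fin.natAdd M 0)) l L *
        bfac q a p.aInit (p.2 (Fin.natAdd M 1)) l L) := by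
    rw [Finset.prod_comm, ← Finset.prod_mul_distrib]
    exact prod_fin_add_two fun j => bfac q a p.aInit (p.2 j) l L
  rw [kTerm, ← hL, mul_assoc (core _ _ _ _ _ _ _ _), ← hb, ← Finset.prod_congr rfl fun j _ => hj j,
    Finset.prod_mul_distrib, Finset.prod_inv_distrib, core, kFactor, kajiharaTerm, ← hL,
    Fin.prod_univ_two (fun k => poch q (p.kV q k) L), hv0, hv1, hkA]
  have hprod := Finset.prod_congr (s₁ := Finset.univ) rfl fun i _ => hi i
  rw [Finset.prod_mul_distrib, Finset.prod_mul_distrib] at hprod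
  rw [show p.kZ = p.aM1 / p.bM3 from rfl]
  linear_combination (∏ j : Fin (M + 2), pochInf q (q ^ 2 * p.bInit j * p.bM3 / (p.aM2 * p.aM3))) *
    (∏ j : Fin (M + 2), poch q (a * q / p.kU j) L)⁻¹ * (p.aM1 / p.bM3) ^ L *
    (vandermonde (fun i => p.aInit i * q ^ l i) / vandermonde p.aInit) *
    (poch q (a * p.aM3) L * poch q (a * p.aM2) L) * hprod

lemma summable_kajiharaTerm (hq0 : q ≠ 0) (hq : ‖q‖ < 1) {p : Param M} (h : InDomain q p) :
    Summable (kajiharaTerm q p.aInit (p.kA q) p.kU (p.kV q) p.kZ) := by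
  rw [← summable_mul_left_iff (kFactor_ne_zero hq0 hq h)]
  simp only [kFactor_mul_kajiharaTerm hq0 hq h]
  exact summable_kTerm hq _ _ h.norm_lt (h.generic hq0 hq) _ _ _

/-- The expansion is used with x = (a_1, …, a_M), c = a_{M+1}, α = a_{M+2}, β = a_{M+3} and (d, e,
f) = (b_{M+1}, b_{M+2}, b_{M+3}). Its balancing condition is then that of D. -/
theorem normW_eq_jackS (hq0 : q ≠ 0) (hq : ‖q‖ < 1) {p : Param M} (h : InDomain q p) :
    q * pochInf q q * normW q p = jackS q (Fin.natAdd M 2) p - jackS q (Fin.natAdd M 1) p := by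
  have hab : p.aM2 ≠ p.aM3 := fun he => h.aM3_sub_ne (by rw [he, sub_self])
  have hbal := h.balance
  rw [prod_fin_add_three, prod_fin_add_three p.2] at hbal
  have hexp := hasExpansion (x := p.aInit) (b := fun j => p.2 (Fin.castAdd 3 j)) (c := p.aM1)
    (d := p.2 (Fin.natAdd M 0)) (e := p.2 (Fin.natAdd M 1)) (f := p.bM3) hq0 hq h.aM2_ne h.aM3_ne
    hab h.bM3_ne' (h.a_ne _) (h.b_ne _) (h.b_ne _) (fun j => h.b_ne _) h.norm_lt
    (h.generic hq0 hq) (fun i => pochInf_ne_zero_of_poch hq (h.x_aM2_ne hq0 i))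
    (fun i => pochInf_ne_zero_of_poch hq (h.x_aM3_ne hq0 i)) (by
      refine hbal.trans ?_
      rw [← mul_assoc]
      rfl)
  set Q₀ := ∏ j, (pochInf q (q * p.2 j / p.aM2) * pochInf q (q * p.2 j / p.aM3)) with hQ
  have hQ0 : Q₀ ≠ 0 := Finset.prod_ne_zero_iff.2 fun j _ => mul_ne_zero (h.bM2_ne j) (h.bM3_ne j)
  rw [HasExpansion, jFull, ← jackS_three_mul hq0 hq h, ← jackS_two_mul hq0 hq h,
    ← tsum_congr (kFactor_mul_kajiharaTerm hq0 hq h), tsum_mul_left] at hexp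
  refine mul_right_cancel₀ hQ0 ?_
  rw [sub_mul, hexp]
  have e1 : (∏ j : Fin (M + 3), 1 / (pochInf q (q * p.2 j / p.aM2) *
      pochInf q (q * p.2 j / p.aM3))) = Q₀⁻¹ := by
    simp only [one_div]
    exact Finset.prod_inv_distrib ..
  have e2 : normFactor q p = kFactor q p * Q₀⁻¹ * (pochInf q (p.aM1 / p.bM3) *
      pochInf q (p.aM2 / p.aM3) * pochInf q (p.aM3 / p.aM2)) * (1 / (p.aM3 - p.aM2)) := by
    rw [normFactor, e1, kFactor]
  rw [normW, e2, kajiharaW]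
  field_simp

end QRP

/-! ### The system for the normalized series. -/

theorem mainTheorem6 (q : ℂ) (hq0 : 0 < ‖q‖) (hq1 : ‖q‖ < 1) (M : ℕ) (hM : 1 ≤ M) :
    (∀ p ∈ QRP.domain q M, Summable (QRP.kajiharaTerm q p.aInit (p.kA q) p.kU (p.kV q) p.kZ)) ∧
      QRP.SatisfiesQRP q M (QRP.domain q M) (fun p => QRP.normW q p) := by
  have hq : q ≠ 0 := norm_pos_iff.1 hq0
  have hqq : QRP.pochInf q q ≠ 0 := by simpa using QRP.pochInf_pow_succ_ne_zero hq1 0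
  have hκ : q * QRP.pochInf q q ≠ 0 := mul_ne_zero hq hqq
  have hW : ∀ p ∈ QRP.domain q M, q * QRP.pochInf q q * QRP.normW q p =
      QRP.jackS q (Fin.natAdd M 2) p - QRP.jackS q (Fin.natAdd M 1) p :=
    fun p hp => QRP.normW_eq_jackS hq hq1 hp
  have ad2 : ∀ p ∈ QRP.domain q M, QRP.Admissible q (Fin.natAdd M 1) p :=
    fun p hp => hp.admissible_two
  have ad3 : ∀ p ∈ QRP.domain q M, QRP.Admissible q (Fin.natAdd M 2) p :=
    fun p hp => hp.admissible_three
  have i2 : (Fin.natAdd M 1 : Fin (M + 3)) ≠ 0 := fun h => by simpa using congrArg Fin.val h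
  have i3 : (Fin.natAdd M 2 : Fin (M + 3)) ≠ 0 := fun h => by simpa using congrArg Fin.val h
  -- A three-term relation valid for S_{M+2} and S_{M+3} passes to their difference, and q (q)_∞ ≠ 0
  -- can be cancelled.
  have lift : ∀ {p₁ p₂ p₃ : QRP.Param M} (c₁ c₂ c₃ : ℂ), p₁ ∈ QRP.domain q M →
      p₂ ∈ QRP.domain q M → p₃ ∈ QRP.domain q M →
      (∀ i : Fin (M + 3), i ≠ 0 → QRP.Admissible q i p₁ → QRP.Admissible q i p₂ →
        QRP.Admissible q i p₃ →
        c₁ * QRP.jackS q i p₁ - c₂ * QRP.jackS q i p₂ + c₃ * QRP.jackS q i p₃ = 0) →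
      c₁ * QRP.normW q p₁ - c₂ * QRP.normW q p₂ + c₃ * QRP.normW q p₃ = 0 := by
    intro p₁ p₂ p₃ c₁ c₂ c₃ h1 h2 h3 h
    refine (mul_eq_zero_iff_left hκ).1 ?_
    linear_combination c₁ * hW _ h1 - c₂ * hW _ h2 + c₃ * hW _ h3 +
      h _ i3 (ad3 _ h1) (ad3 _ h2) (ad3 _ h3) - h _ i2 (ad2 _ h1) (ad2 _ h2) (ad2 _ h3)
  refine ⟨fun p hp => QRP.summable_kajiharaTerm hq hq1 hp, ?_, ?_, ?_, ?_, ?_, ?_, ?_, ?_⟩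
  · intro p h
    have hp : p ∈ QRP.domain q M := by
      simpa [QRP.shA, QRP.shB] using h 0 (by norm_num) (by positivity)
    have hE := QRP.InShiftRange.opE (M := M) hq
    -- Here W is replaced by the difference of integrals at the points T^n p, -1 ≤ n ≤ M; the two
    -- images under Ê_M are equal and cancel.
    have e1 : QRP.opE q M ((q * QRP.pochInf q q) • fun p => QRP.normW q p) p =
        QRP.opE q M (QRP.jackS q (Fin.natAdd M 2) - QRP.jackS q (Fin.natAdd M 1)) p :=
      hE.congr fun n h1 h2 => hW _ (h n h1 h2)
    rw [map_smul, map_sub, Pi.smul_apply, Pi.sub_apply, smul_eq_mul,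
      QRP.opE_jackS hq hq1 i3 hp.balance (hp.b_ne 0) fun n h1 h2 => ad3 _ (h n h1 h2),
      QRP.opE_jackS hq hq1 i2 hp.balance (hp.b_ne 0) fun n h1 h2 => ad2 _ (h n h1 h2),
      sub_self] at e1
    exact (mul_eq_zero_iff_left hκ).1 e1
  · intro k l hk hl hkl p hp h1 h2
    exact lift _ _ _ h1 h2 hp fun i _ a1 a2 a => QRP.jackS_eqAA hq hq1 hkl hk a a1 a2
  · intro k hk p hp h1 h2
    exact lift _ _ _ h1 h2 hp fun i hi a1 a2 a => QRP.jackS_eqA hq hq1 hk hi a a1 a2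
  · intro k l hk hl hkl p hp h1 h2
    exact lift _ _ _ h1 h2 hp fun i _ a1 a2 a => QRP.jackS_eqBB hq hq1 hkl hl a a1 a2
  · intro k hk p hp h1 h2
    exact lift _ _ _ h1 h2 hp fun i _ a1 a2 a => QRP.jackS_eqB hq hq1 hk a a1 a2
  · intro k l hk hl hkl p hp h1 h2
    exact lift _ _ _ h1 h2 hp fun i _ a1 a2 a => QRP.jackS_eqAB hq hq1 hl a a1 a2
  · intro k l hk hl hkl p hp h1 h2
    exact lift _ _ _ h1 h2 hp fun i hi a1 a2 a => QRP.jackS_eqABinv hq hq1 hi a a1 a2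
  · intro p hp h1
    refine (mul_eq_zero_iff_left hκ).1 ?_
    linear_combination q * hW _ h1 - hW _ hp + QRP.jackS_smul hq p (Fin.natAdd M 2) -
      QRP.jackS_smul hq p (Fin.natAdd M 1)
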